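/- Consider the simply typed $\lambda$-calculus à la Church with a single ground type $\circ$ and a countably infinite supply of constants, all of type $\circ$. For a finite set $\mathcal C$ of constants, *observational equivalence* $\equiv_{\mathcal C}$ between closed terms of the same type whose constants belong to $\mathcal C$ is defined by recursion on the type: for $t,t':\circ$, $t\equiv_{\mathcal C}t'$ iff $t=_\beta t'$; for $t,t':A\to B$, $t\equiv_{\mathcal C}t'$ iff $(t\,u)\equiv_{\mathcal C}(t'\,u)$ for every closed term $u:A$ whose constants belong to $\mathcal C$. A *cell* is a multiple-hole context $\Sigma[\ ]_1\dots[\ ]_K=(y\,C_1\dots C_p)$ of ground type, where $y$ is a variable, all holes are of ground type and each $C_j[\ ]_1\dots[\ ]_K$ is a context without free variables. A closed term in $\eta$-long form is *cellular* iff it is of the form $\lambda y_1\dots y_n.a$ with $a$ a constant, or of the form $\lambda y_1\dots y_n.\Sigma[w_1]_1\dots[w_K]_K$ where $\Sigma$ is a cell whose free variable is among $y_1,\dots,y_n$ and each $\lambda y_1\dots y_n.w_k$ is cellular (the bodies $a$, $\Sigma[w_1]_1\dots[w_K]_K$ and $w_k$ being of ground type, and filling being capture-avoiding). It is *hereditary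 cellular* iff moreover, for each cell $(y\,C_1\dots C_p)$ in it, each $\lambda x_1\dots x_K.\,C_j[x_1]\dots[x_K]$ is hereditary cellular. **Theorem.** There is a computable function $\mathcal R$ such that for every type $A$ and every finite set $\mathcal C$ of constants of ground type, $\mathcal R(A,\mathcal C)$ is a finite list of closed terms of type $A$ with constants in $\mathcal C$, all of them hereditary cellular, which contains a representative of each $\equiv_{\mathcal C}$-class of closed terms of type $A$ with constants in $\mathcal C$. Moreover all minimal models are decidable: the relation $t\equiv_{\mathcal C}t'$ between closed terms of type $A$ with constants in $\mathcal C$ is decidable, uniformly in $A$, $\mathcal C$, $t$, $t'$. -/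

import Mathlib

namespace STLC

/-- Simple types over a single ground type `o`. -/
inductive Ty : Type
  | o : Ty
  | arr (A B : Ty) : Ty

/-- The type `B₁ → ⋯ → Bₚ → o`. -/
def Ty.arrs : List Ty → Ty
  | [] => Ty.o
  | B :: Bs => Ty.arr B (Ty.arrs Bs)

/-- Church-style raw terms, with de Bruijn indices (so that alpha-equivalent terms are equal).
`const c` is the `c`-th constant of ground type. -/
inductive Tm : Type
  | var (i : ℕ) : Tm
  | const (c : ℕ) : Tm
  | app (s t : Tm) : Tm
  | lam (A : Ty) (t : Tm) : Tm

/-! Effective numberings of types and terms: these are the codings with respect to which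
computability is understood. -/

def Ty.toNat : Ty → ℕ
  | Ty.o => 0
  | Ty.arr A B => Nat.pair A.toNat B.toNat + 1

def Ty.ofNat : ℕ → Ty
  | 0 => Ty.o
  | n + 1 =>
    have _h1 : n.unpair.1 < n + 1 := Nat.lt_succ_of_le (Nat.unpair_left_le n)
    have _h2 : n.unpair.2 < n + 1 := Nat.lt_succ_of_le (Nat.unpair_right_le n)
    Ty.arr (Ty.ofNat n.unpair.1) (Ty.ofNat n.unpair.2)

theorem Ty.ofNat_toNat (A : Ty) : Ty.ofNat A.toNat = A := by
  induction A with
  | o => simp [Ty.toNat, Ty.ofNat]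
  | arr A B hA hB => simp [Ty.toNat, Ty.ofNat, hA, hB]

theorem Ty.toNat_ofNat (n : ℕ) : (Ty.ofNat n).toNat = n := by
  induction n using Nat.strong_induction_on with
  | _ n ih =>
    cases n with
    | zero => simp [Ty.toNat, Ty.ofNat]
    | succ n =>
      have h1 : n.unpair.1 < n + 1 := Nat.lt_succ_of_le (Nat.unpair_left_le n)
      have h2 : n.unpair.2 < n + 1 := Nat.lt_succ_of_le (Nat.unpair_right_le n)
      simp [Ty.toNat, Ty.ofNat, ih _ h1, ih _ h2]

def Ty.equivNat : Ty ≃ ℕ := ⟨Ty.toNat, Ty.ofNat, Ty.ofNat_toNat, Ty.toNat_ofNat⟩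

instance : Denumerable Ty := Denumerable.mk' Ty.equivNat

def Tm.toNat : Tm → ℕ
  | Tm.var i => 4 * i
  | Tm.const c => 4 * c + 1
  | Tm.app s t => 4 * Nat.pair s.toNat t.toNat + 2
  | Tm.lam A t => 4 * Nat.pair A.toNat t.toNat + 3

def Tm.ofNat (n : ℕ) : Tm :=
  if h0 : n % 4 = 0 then Tm.var (n / 4)
  else if h1 : n % 4 = 1 then Tm.const (n / 4)
  else
    have _h3 : (n / 4).unpair.1 < n := lt_of_le_of_lt (Nat.unpair_left_le _) (by omega)
    have _h4 : (n / 4).unpair.2 < n := lt_of_le_of_lt (Nat.unpair_right_le _) (by omega)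
    if n % 4 = 2 then Tm.app (Tm.ofNat (n / 4).unpair.1) (Tm.ofNat (n / 4).unpair.2)
    else Tm.lam (Ty.ofNat (n / 4).unpair.1) (Tm.ofNat (n / 4).unpair.2)
termination_by n

theorem Tm.ofNat_toNat (t : Tm) : Tm.ofNat t.toNat = t := by
  induction t with
  | var i => rw [Tm.toNat, Tm.ofNat]; simp
  | const c =>
    rw [Tm.toNat, Tm.ofNat]
    have h1 : (4 * c + 1) % 4 = 1 := by omega
    have h2 : (4 * c + 1) / 4 = c := by omega
    simp [h1, h2]
  | app s t hs ht =>
    rw [Tm.toNat, Tm.ofNat]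
    have h1 : (4 * Nat.pair s.toNat t.toNat + 2) % 4 = 2 := by omega
    have h2 : (4 * Nat.pair s.toNat t.toNat + 2) / 4 = Nat.pair s.toNat t.toNat := by omega
    simp [h1, h2, hs, ht]
  | lam A t ht =>
    rw [Tm.toNat, Tm.ofNat]
    have h1 : (4 * Nat.pair A.toNat t.toNat + 3) % 4 = 3 := by omega
    have h2 : (4 * Nat.pair A.toNat t.toNat + 3) / 4 = Nat.pair A.toNat t.toNat := by omega
    simp [h1, h2, ht, Ty.ofNat_toNat]

theorem Tm.toNat_ofNat (n : ℕ) : (Tm.ofNat n).toNat = n := by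
  induction n using Nat.strong_induction_on with
  | _ n ih =>
    rw [Tm.ofNat]
    split_ifs with h0 h1 h2
    · simp only [Tm.toNat]; omega
    · simp only [Tm.toNat]; omega
    · have h3 : (n / 4).unpair.1 < n := lt_of_le_of_lt (Nat.unpair_left_le _) (by omega)
      have h4 : (n / 4).unpair.2 < n := lt_of_le_of_lt (Nat.unpair_right_le _) (by omega)
      simp only [Tm.toNat, ih _ h3, ih _ h4, Nat.pair_unpair]; omega
    · have h4 : (n / 4).unpair.2 < n := lt_of_le_of_lt (Nat.unpair_right_le _) (by omega)
      simp only [Tm.toNat, Ty.toNat_ofNat, ih _ h4, Nat.pair_unpair]; omega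

def Tm.equivNat : Tm ≃ ℕ := ⟨Tm.toNat, Tm.ofNat, Tm.ofNat_toNat, Tm.toNat_ofNat⟩

instance : Denumerable Tm := Denumerable.mk' Tm.equivNat

/-- The typing judgement `Γ ⊢ t : A`; the variable with index `i` has the `i`-th type of `Γ`. -/
inductive HasType : List Ty → Tm → Ty → Prop
  | var {Γ : List Ty} {i : ℕ} {A : Ty} : Γ[i]? = some A → HasType Γ (Tm.var i) A
  | const {Γ : List Ty} {c : ℕ} : HasType Γ (Tm.const c) Ty.o
  | app {Γ : List Ty} {s t : Tm} {A B : Ty} :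
      HasType Γ s (Ty.arr A B) → HasType Γ t A → HasType Γ (Tm.app s t) B
  | lam {Γ : List Ty} {t : Tm} {A B : Ty} :
      HasType (A :: Γ) t B → HasType Γ (Tm.lam A t) (Ty.arr A B)

/-- The set of constants that occur in a term. -/
def Tm.consts : Tm → Finset ℕ
  | Tm.var _ => ∅
  | Tm.const c => {c}
  | Tm.app s t => s.consts ∪ t.consts
  | Tm.lam _ t => t.consts

/-- `t` is a closed term of type `A` whose constants belong to `C`. -/
def IsClosedTerm (C : Finset ℕ) (t : Tm) (A : Ty) : Prop :=
  HasType [] t A ∧ t.consts ⊆ C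

/-- Extension of a renaming under a binder. -/
def upRen (ρ : ℕ → ℕ) : ℕ → ℕ
  | 0 => 0
  | i + 1 => ρ i + 1

def Tm.rename : (ℕ → ℕ) → Tm → Tm
  | ρ, Tm.var i => Tm.var (ρ i)
  | _, Tm.const c => Tm.const c
  | ρ, Tm.app s t => Tm.app (s.rename ρ) (t.rename ρ)
  | ρ, Tm.lam A t => Tm.lam A (t.rename (upRen ρ))

/-- Extension of a substitution under a binder. -/
def upSubst (σ : ℕ → Tm) : ℕ → Tm
  | 0 => Tm.var 0
  | i + 1 => (σ i).rename Nat.succ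

/-- Simultaneous capture-avoiding substitution of `σ i` for the variable with index `i`. -/
def Tm.subst : (ℕ → Tm) → Tm → Tm
  | σ, Tm.var i => σ i
  | _, Tm.const c => Tm.const c
  | σ, Tm.app s t => Tm.app (s.subst σ) (t.subst σ)
  | σ, Tm.lam A t => Tm.lam A (t.subst (upSubst σ))

/-- The substitution of `u` for the variable with index `0`, the other indices being lowered. -/
def substZero (u : Tm) : ℕ → Tm
  | 0 => u
  | i + 1 => Tm.var i

/-- One-step beta-reduction, in any context. -/
inductive BetaStep : Tm → Tm → Prop
  | beta (A : Ty) (t u : Tm) : BetaStep (Tm.app (Tm.lam A t) u) (t.subst (substZero u))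
  | appL {s s' : Tm} (t : Tm) : BetaStep s s' → BetaStep (Tm.app s t) (Tm.app s' t)
  | appR (s : Tm) {t t' : Tm} : BetaStep t t' → BetaStep (Tm.app s t) (Tm.app s t')
  | lam (A : Ty) {t t' : Tm} : BetaStep t t' → BetaStep (Tm.lam A t) (Tm.lam A t')

/-- Beta-equivalence. -/
def BetaEq : Tm → Tm → Prop := Relation.EqvGen BetaStep

/-- Observational equivalence of closed terms of a given type, in the calculus whose constants
are those of `C`. -/
def ObsEquiv (C : Finset ℕ) : Ty → Tm → Tm → Prop
  | Ty.o, t, t' => IsClosedTerm C t Ty.o ∧ IsClosedTerm C t' Ty.o ∧ BetaEq t t'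
  | Ty.arr A B, t, t' =>
      IsClosedTerm C t (Ty.arr A B) ∧ IsClosedTerm C t' (Ty.arr A B) ∧
        ∀ u : Tm, IsClosedTerm C u A → ObsEquiv C B (Tm.app t u) (Tm.app t' u)

/-- `h u₁ ⋯ uₚ`. -/
def Tm.apps (h : Tm) (us : List Tm) : Tm := us.foldl Tm.app h

/-- A context with holes `[ ]₁, …, [ ]_K` of ground type and without free variables is given by a
term `c` whose free variables are among `K` variables of ground type, which mark the holes (the
indices `0, …, K - 1`). `c.fill ws` is the result of filling the holes with the `K` terms `ws`. -/
def Tm.fill (ws : List Tm) (c : Tm) : Tm := c.subst (fun k => ws.getD k (Tm.var k))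

/-- `HereditaryCellular Γ t A`: the closure `λ y₁ … yₙ. t` of the term `t` of type `A` over the
variables of `Γ` is a hereditary cellular term. For a closed term take `Γ = []`: its leading
abstractions `λ y₁ … yₙ` are then moved into `Γ` by the rule `lam`, until a body of ground type
is reached. This body is a constant, or of the form `Σ[w₁]…[w_K]` where
* `Σ` is the cell `y C₁ … Cₚ` with `y` in `Γ` and with closed contexts `Cⱼ` (`cs`), each of which is
  such that `λ x₁ … x_K. Cⱼ[x₁]…[x_K]` is again hereditary cellular,
* each `λ y₁ … yₙ. wₖ` (`ws`) is hereditary cellular. -/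
inductive HereditaryCellular : List Ty → Tm → Ty → Prop
  | const {Γ : List Ty} {a : ℕ} : HereditaryCellular Γ (Tm.const a) Ty.o
  | lam {Γ : List Ty} {t : Tm} {A B : Ty} :
      HereditaryCellular (A :: Γ) t B → HereditaryCellular Γ (Tm.lam A t) (Ty.arr A B)
  | cell {Γ : List Ty} {y : ℕ} {Bs : List Ty} {cs ws : List Tm} :
      Γ[y]? = some (Ty.arrs Bs) →
      cs.length = Bs.length →
      (∀ (j : ℕ) (c : Tm) (B : Ty), cs[j]? = some c → Bs[j]? = some B →
        HereditaryCellular (List.replicate ws.length Ty.o) c B) →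
      (∀ w ∈ ws, HereditaryCellular Γ w Ty.o) →
      HereditaryCellular Γ ((Tm.var y).apps (cs.map (Tm.fill ws))) Ty.o

end STLC

/-! A closed term of ground type is convertible to exactly one constant of `C`, and observational
equivalence is the logical relation generated by convertibility. Hence every type has finitely many
classes (`finite_classes`); the difficulty is to compute representatives.

Hereditary cellular terms suffice (`WT.exists_hCell`). Evaluate a closed instance `v C₁ … Cₚ` of a
cell with fresh constants in its holes: by the fundamental theorem of logical relations the answer
is a constant of `C` or the fresh constant of one hole, and accordingly the cell is a constant
function or a projection, uniformly in its contents (`IsCell.eval`). Suppose now that a cell `g`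
with contents `wₖ` occurs under the binders of a context `K` that does not bind its head. Then `K g`
has the same value as `K T`, where `T` is the same cell with representatives of the `K wₖ` as
contents; `T` no longer depends on the variables bound by `K`. Repeating this (`HCell.rep_context`)
turns each argument of a head variable into a closed context filled with terms in the outer
variables, so that the application becomes a cell (`rep_apps`). A computability argument in the
style of Tait (`reflect_reify`, `WT.good`) extends this to all terms.

Completeness of a list `L` at a type can then be verified by finite means. When the contents of a
cell agree with elements of `L`, its holes can be indexed by `L`; its contexts become closed terms
of types `o → ⋯ → o → Bⱼ`, of lower order than the given type, and matter only up to equivalence. So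
`L` is complete once it contains the constant functions and is closed under finitely many cells,
everything being tested on a complete list of argument vectors. These conditions form the proof
system `Cert`. It is sound (`Cert.vecComplete`), and finiteness of the model shows that certificates
always exist (`exists_cert`).

Evaluation, cellularity and certificates are inductively defined by recursively enumerable rules,
hence recursively enumerable. A search for certified representatives therefore always succeeds, and
a certificate reduces both equivalence and inequivalence to finitely many evaluations, so that
Post's theorem gives decidability. -/

namespace STLC

/-! ### Renaming and substitution -/

theorem upRen_id : upRen id = id := by
  funext i; cases i <;> rfl

theorem upSubst_var : upSubst Tm.var = Tm.var := by
  funext i; cases i <;> rfl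

theorem upRen_comp (ρ ρ' : ℕ → ℕ) : upRen (ρ' ∘ ρ) = upRen ρ' ∘ upRen ρ := by
  funext i; cases i <;> rfl

theorem upSubst_comp_upRen (ρ : ℕ → ℕ) (σ : ℕ → Tm) :
    upSubst σ ∘ upRen ρ = upSubst (σ ∘ ρ) := by
  funext i; cases i <;> rfl

namespace Tm

theorem rename_id (t : Tm) : t.rename id = t := by
  induction t with
  | var i => rfl
  | const c => rfl
  | app s t hs ht => simp [rename, hs, ht]
  | lam A t ht => simp [rename, upRen_id, ht]

theorem subst_var (t : Tm) : t.subst var = t := by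
  induction t with
  | var i => rfl
  | const c => rfl
  | app s t hs ht => simp [subst, hs, ht]
  | lam A t ht => simp [subst, upSubst_var, ht]

theorem rename_rename (t : Tm) (ρ ρ' : ℕ → ℕ) :
    (t.rename ρ).rename ρ' = t.rename (ρ' ∘ ρ) := by
  induction t generalizing ρ ρ' with
  | var i => rfl
  | const c => rfl
  | app s t hs ht => simp [rename, hs, ht]
  | lam A t ht => simp [rename, ht, upRen_comp]

theorem subst_rename (t : Tm) (ρ : ℕ → ℕ) (σ : ℕ → Tm) :
    (t.rename ρ).subst σ = t.subst (σ ∘ ρ) := by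
  induction t generalizing ρ σ with
  | var i => rfl
  | const c => rfl
  | app s t hs ht => simp [rename, subst, hs, ht]
  | lam A t ht => simp [rename, subst, ht, upSubst_comp_upRen]

end Tm

theorem upSubst_rename (σ : ℕ → Tm) (ρ : ℕ → ℕ) :
    (fun i => (upSubst σ i).rename (upRen ρ)) = upSubst (fun i => (σ i).rename ρ) := by
  funext i
  cases i with
  | zero => rfl
  | succ i => simp only [upSubst, Tm.rename_rename]; rfl

namespace Tm

theorem rename_subst (t : Tm) (σ : ℕ → Tm) (ρ : ℕ → ℕ) :
    (t.subst σ).rename ρ = t.subst (fun i => (σ i).rename ρ) := by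
  induction t generalizing ρ σ with
  | var i => rfl
  | const c => rfl
  | app s t hs ht => simp [rename, subst, hs, ht]
  | lam A t ht => simp [rename, subst, ht, upSubst_rename]

end Tm

theorem upSubst_subst (σ τ : ℕ → Tm) :
    (fun i => (upSubst σ i).subst (upSubst τ)) = upSubst (fun i => (σ i).subst τ) := by
  funext i
  cases i with
  | zero => rfl
  | succ i => simp only [upSubst, Tm.subst_rename, Tm.rename_subst]; rfl

namespace Tm

theorem subst_subst (t : Tm) (σ τ : ℕ → Tm) :
    (t.subst σ).subst τ = t.subst (fun i => (σ i).subst τ) := by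
  induction t generalizing σ τ with
  | var i => rfl
  | const c => rfl
  | app s t hs ht => simp [subst, hs, ht]
  | lam A t ht => simp [subst, ht, upSubst_subst]

theorem rename_eq_subst (t : Tm) (ρ : ℕ → ℕ) : t.rename ρ = t.subst (fun i => var (ρ i)) := by
  rw [← subst_var (t.rename ρ), subst_rename]; rfl

end Tm

/-- The substitution of `u` for the index `0` and of `σ i` for the index `i + 1`. -/
def consSubst (u : Tm) (σ : ℕ → Tm) : ℕ → Tm
  | 0 => u
  | i + 1 => σ i

theorem substZero_eq (u : Tm) : substZero u = consSubst u Tm.var := by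
  funext i; cases i <;> rfl

theorem upSubst_eq (σ : ℕ → Tm) :
    upSubst σ = consSubst (Tm.var 0) (fun i => (σ i).rename Nat.succ) := by
  funext i; cases i <;> rfl

theorem Tm.subst_upSubst_consSubst (t : Tm) (σ τ : ℕ → Tm) (u : Tm) :
    (t.subst (upSubst σ)).subst (consSubst u τ) =
      t.subst (consSubst u (fun i => (σ i).subst τ)) := by
  rw [Tm.subst_subst]
  congr 1
  funext i
  cases i with
  | zero => rfl
  | succ i => simp only [upSubst, Tm.subst_rename]; rfl

theorem Tm.subst_upSubst_substZero (t : Tm) (σ : ℕ → Tm) (u : Tm) :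
    (t.subst (upSubst σ)).subst (substZero u) = t.subst (consSubst u σ) := by
  simp only [substZero_eq, Tm.subst_upSubst_consSubst, Tm.subst_var]

theorem Tm.subst_substZero (t : Tm) (σ : ℕ → Tm) (u : Tm) :
    (t.subst (substZero u)).subst σ = t.subst (consSubst (u.subst σ) σ) := by
  rw [Tm.subst_subst]
  congr 1
  funext i
  cases i <;> rfl

theorem Tm.subst_substZero_comm (t : Tm) (σ : ℕ → Tm) (u : Tm) :
    (t.subst (substZero u)).subst σ = (t.subst (upSubst σ)).subst (substZero (u.subst σ)) := by
  rw [Tm.subst_substZero, Tm.subst_upSubst_substZero]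

theorem Tm.apps_append (h : Tm) (us vs : List Tm) : h.apps (us ++ vs) = (h.apps us).apps vs := by
  simp [Tm.apps]

@[simp] theorem Tm.apps_nil (h : Tm) : h.apps [] = h := rfl

@[simp] theorem Tm.apps_cons (h u : Tm) (us : List Tm) :
    h.apps (u :: us) = (h.app u).apps us := rfl

theorem Tm.apps_subst (h : Tm) (us : List Tm) (σ : ℕ → Tm) :
    (h.apps us).subst σ = (h.subst σ).apps (us.map (Tm.subst σ)) := by
  induction us generalizing h with
  | nil => rfl
  | cons u us ih => simp [ih, Tm.subst]

theorem Tm.apps_rename (h : Tm) (us : List Tm) (ρ : ℕ → ℕ) :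
    (h.apps us).rename ρ = (h.rename ρ).apps (us.map (Tm.rename ρ)) := by
  induction us generalizing h with
  | nil => rfl
  | cons u us ih => simp [ih, Tm.rename]

/-! ### Beta-equivalence -/

theorem BetaEq.refl (t : Tm) : BetaEq t t := Relation.EqvGen.refl t

theorem BetaEq.symm {t u : Tm} (h : BetaEq t u) : BetaEq u t := Relation.EqvGen.symm _ _ h

theorem BetaEq.trans {t u v : Tm} (h : BetaEq t u) (h' : BetaEq u v) : BetaEq t v :=
  Relation.EqvGen.trans _ _ _ h h'

theorem BetaStep.betaEq {t u : Tm} (h : BetaStep t u) : BetaEq t u := Relation.EqvGen.rel _ _ h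

theorem BetaEq.map {f : Tm → Tm} (hf : ∀ t u, BetaStep t u → BetaStep (f t) (f u)) {t u : Tm}
    (h : BetaEq t u) : BetaEq (f t) (f u) := by
  induction h with
  | rel _ _ h => exact (hf _ _ h).betaEq
  | refl => exact BetaEq.refl _
  | symm _ _ _ ih => exact ih.symm
  | trans _ _ _ _ _ ih ih' => exact ih.trans ih'

theorem BetaEq.app {s s' t t' : Tm} (hs : BetaEq s s') (ht : BetaEq t t') :
    BetaEq (Tm.app s t) (Tm.app s' t') :=
  (hs.map fun _ _ => BetaStep.appL t).trans (ht.map fun _ _ => BetaStep.appR s')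

theorem BetaEq.apps {s s' : Tm} (hs : BetaEq s s') (us : List Tm) :
    BetaEq (s.apps us) (s'.apps us) := by
  induction us generalizing s s' with
  | nil => exact hs
  | cons u us ih => exact ih (hs.app (BetaEq.refl u))

theorem BetaStep.subst {t u : Tm} (h : BetaStep t u) (σ : ℕ → Tm) :
    BetaStep (t.subst σ) (u.subst σ) := by
  induction h generalizing σ with
  | beta A t u =>
    rw [Tm.subst_substZero_comm]
    exact BetaStep.beta _ _ _
  | appL t _ ih => exact BetaStep.appL _ (ih σ)
  | appR s _ ih => exact BetaStep.appR _ (ih σ)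
  | lam A _ ih => exact BetaStep.lam A (ih _)

theorem BetaEq.subst {t u : Tm} (h : BetaEq t u) (σ : ℕ → Tm) :
    BetaEq (t.subst σ) (u.subst σ) :=
  h.map fun _ _ h => h.subst σ

/-- A beta-redex under a substitution. -/
theorem BetaEq.beta_subst (A : Ty) (t u : Tm) (σ : ℕ → Tm) :
    BetaEq (Tm.app ((Tm.lam A t).subst σ) u) (t.subst (consSubst u σ)) := by
  rw [← Tm.subst_upSubst_substZero]
  exact (BetaStep.beta _ _ _).betaEq

/-! ### Confluence -/

/-- Parallel reduction. -/
inductive Par : Tm → Tm → Prop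
  | var (i : ℕ) : Par (Tm.var i) (Tm.var i)
  | const (c : ℕ) : Par (Tm.const c) (Tm.const c)
  | app {s s' t t' : Tm} : Par s s' → Par t t' → Par (Tm.app s t) (Tm.app s' t')
  | lam (A : Ty) {t t' : Tm} : Par t t' → Par (Tm.lam A t) (Tm.lam A t')
  | beta (A : Ty) {t t' u u' : Tm} : Par t t' → Par u u' →
      Par (Tm.app (Tm.lam A t) u) (t'.subst (substZero u'))

theorem Par.refl (t : Tm) : Par t t := by
  induction t with
  | var i => exact .var i
  | const c => exact .const c
  | app s t hs ht => exact .app hs ht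
  | lam A t ht => exact .lam A ht

theorem BetaStep.par {t u : Tm} (h : BetaStep t u) : Par t u := by
  induction h with
  | beta A t u => exact .beta A (.refl t) (.refl u)
  | appL t _ ih => exact .app ih (.refl t)
  | appR s _ ih => exact .app (.refl s) ih
  | lam A _ ih => exact .lam A ih

theorem Par.rename {t u : Tm} (h : Par t u) (ρ : ℕ → ℕ) : Par (t.rename ρ) (u.rename ρ) := by
  induction h generalizing ρ with
  | var i => exact .var _
  | const c => exact .const c
  | app _ _ ih ih' => exact .app (ih ρ) (ih' ρ)
  | lam A _ ih => exact .lam A (ih _)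
  | @beta A t t' u u' _ _ ih ih' =>
    have e : (t'.subst (substZero u')).rename ρ =
        (t'.rename (upRen ρ)).subst (substZero (u'.rename ρ)) := by
      rw [Tm.rename_subst, Tm.subst_rename]
      congr 1
      funext i
      cases i <;> rfl
    rw [e]
    exact .beta A (ih _) (ih' ρ)

theorem Par.upSubst {σ τ : ℕ → Tm} (h : ∀ i, Par (σ i) (τ i)) (i : ℕ) :
    Par (STLC.upSubst σ i) (STLC.upSubst τ i) := by
  cases i with
  | zero => exact .var 0
  | succ i => exact (h i).rename _

theorem Par.subst {t u : Tm} (h : Par t u) {σ τ : ℕ → Tm} (hσ : ∀ i, Par (σ i) (τ i)) :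
    Par (t.subst σ) (u.subst τ) := by
  induction h generalizing σ τ with
  | var i => exact hσ i
  | const c => exact .const c
  | app _ _ ih ih' => exact .app (ih hσ) (ih' hσ)
  | lam A _ ih => exact .lam A (ih (Par.upSubst hσ))
  | beta A _ _ ih ih' =>
    rw [Tm.subst_substZero_comm]
    exact .beta A (ih (Par.upSubst hσ)) (ih' hσ)

theorem Par.substZero {u u' : Tm} (h : Par u u') (i : ℕ) :
    Par (STLC.substZero u i) (STLC.substZero u' i) := by
  cases i with
  | zero => exact h
  | succ i => exact .var i

/-- Two parallel reductions are compared case by case. The only overlap is a redex contracted on one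
side and kept on the other; there a parallel reduct of an abstraction is an abstraction, and `Par`
is stable under substitution. -/
theorem Par.diamond {a b c : Tm} (h : Par a b) (h' : Par a c) : ∃ d, Par b d ∧ Par c d := by
  induction h generalizing c with
  | var i => cases h'; exact ⟨_, .var i, .var i⟩
  | const k => cases h'; exact ⟨_, .const k, .const k⟩
  | lam A _ ih =>
    cases h' with
    | lam _ h' =>
      obtain ⟨d, h1, h2⟩ := ih h'
      exact ⟨_, .lam A h1, .lam A h2⟩
  | app hs _ ih ih' =>
    cases h' with
    | app h1 h2 =>
      obtain ⟨d, h3, h4⟩ := ih h1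
      obtain ⟨e, h5, h6⟩ := ih' h2
      exact ⟨_, .app h3 h5, .app h4 h6⟩
    | beta A h1 h2 =>
      cases hs with
      | lam _ hs =>
        -- The induction hypothesis concerns the whole abstraction, so the reduction of its body is
        -- wrapped again; inverting both resulting reductions recovers a common reduct of the
        -- bodies.
        obtain ⟨d, h3, h4⟩ := ih (.lam A h1)
        obtain ⟨e, h5, h6⟩ := ih' h2
        cases h3 with
        | lam _ h3 =>
          cases h4 with
          | lam _ h4 => exact ⟨_, .beta A h3 h5, h4.subst (Par.substZero h6)⟩
  | beta A _ _ ih ih' =>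
    cases h' with
    | app h1 h2 =>
      cases h1 with
      | lam _ h1 =>
        obtain ⟨d, h3, h4⟩ := ih h1
        obtain ⟨e, h5, h6⟩ := ih' h2
        exact ⟨_, h3.subst (Par.substZero h5), .beta A h4 h6⟩
    | beta _ h1 h2 =>
      obtain ⟨d, h3, h4⟩ := ih h1
      obtain ⟨e, h5, h6⟩ := ih' h2
      exact ⟨_, h3.subst (Par.substZero h5), h4.subst (Par.substZero h6)⟩

/-- Confluence serves only to show that distinct constants are not convertible (`BetaEq.const_inj`),
which makes values unique. -/
theorem BetaEq.join {t u : Tm} (h : BetaEq t u) :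
    Relation.Join (Relation.ReflTransGen Par) t u := by
  have hE : Equivalence (Relation.Join (Relation.ReflTransGen Par)) :=
    Relation.equivalence_join_reflTransGen fun a b c hb hc => by
      obtain ⟨d, h1, h2⟩ := hb.diamond hc
      exact ⟨d, .single h1, .single h2⟩
  induction h with
  | rel _ _ h => exact ⟨_, .single h.par, .refl⟩
  | refl => exact hE.refl _
  | symm _ _ _ ih => exact hE.symm ih
  | trans _ _ _ _ _ ih ih' => exact hE.trans ih ih'

theorem Par.const_eq {c : ℕ} {t : Tm} (h : Relation.ReflTransGen Par (Tm.const c) t) :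
    t = Tm.const c := by
  induction h with
  | refl => rfl
  | tail _ h ih => subst ih; cases h; rfl

theorem BetaEq.const_inj {a b : ℕ} (h : BetaEq (Tm.const a) (Tm.const b)) : a = b := by
  obtain ⟨d, h1, h2⟩ := h.join
  have := (Par.const_eq h1).symm.trans (Par.const_eq h2)
  simpa using this

/-! ### Typing -/

/-- `t` has type `A` in the context `Γ`, and its constants belong to `C`. -/
def WT (C : Finset ℕ) (Γ : List Ty) (t : Tm) (A : Ty) : Prop :=
  HasType Γ t A ∧ t.consts ⊆ C

/-- `ρ` maps the variables of `Γ` to variables of `Δ` of the same type. -/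
def IsRen (ρ : ℕ → ℕ) (Γ Δ : List Ty) : Prop :=
  ∀ (i : ℕ) (A : Ty), Γ[i]? = some A → Δ[ρ i]? = some A

/-- `σ` maps the variables of `Γ` to terms of the same type in the context `Δ`. -/
def IsSub (C : Finset ℕ) (σ : ℕ → Tm) (Γ Δ : List Ty) : Prop :=
  ∀ (i : ℕ) (A : Ty), Γ[i]? = some A → WT C Δ (σ i) A

theorem IsRen.up {ρ : ℕ → ℕ} {Γ Δ : List Ty} (h : IsRen ρ Γ Δ) (A : Ty) :
    IsRen (upRen ρ) (A :: Γ) (A :: Δ) := by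
  intro i B hi
  cases i with
  | zero => exact hi
  | succ i => exact h i B hi

theorem IsRen.succ (Γ : List Ty) (A : Ty) : IsRen Nat.succ Γ (A :: Γ) := fun _ _ h => h

theorem IsRen.comp {ρ ρ' : ℕ → ℕ} {Γ Δ Θ : List Ty} (h : IsRen ρ Γ Δ) (h' : IsRen ρ' Δ Θ) :
    IsRen (ρ' ∘ ρ) Γ Θ := fun i A hi => h' _ _ (h i A hi)

theorem IsRen.prefix (Z Γ : List Ty) : IsRen (· + Z.length) Γ (Z ++ Γ) := by
  intro i A hi
  simpa [List.getElem?_append_right] using hi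

theorem HasType.rename {Γ : List Ty} {t : Tm} {A : Ty} (h : HasType Γ t A) {ρ : ℕ → ℕ}
    {Δ : List Ty} (hρ : IsRen ρ Γ Δ) : HasType Δ (t.rename ρ) A := by
  induction h generalizing ρ Δ with
  | var hi => exact .var (hρ _ _ hi)
  | const => exact .const
  | app _ _ ih ih' => exact .app (ih hρ) (ih' hρ)
  | lam _ ih => exact .lam (ih (hρ.up _))

theorem Tm.consts_rename (t : Tm) (ρ : ℕ → ℕ) : (t.rename ρ).consts = t.consts := by
  induction t generalizing ρ with
  | var i => rfl
  | const c => rfl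
  | app s t hs ht => simp [Tm.rename, Tm.consts, hs, ht]
  | lam A t ht => simp [Tm.rename, Tm.consts, ht]

namespace WT

variable {C : Finset ℕ} {Γ Δ : List Ty} {s t : Tm} {A B : Ty}

theorem var {i : ℕ} (h : Γ[i]? = some A) : WT C Γ (Tm.var i) A :=
  ⟨.var h, by simp [Tm.consts]⟩

theorem const {c : ℕ} (h : c ∈ C) : WT C Γ (Tm.const c) Ty.o :=
  ⟨.const, by simpa [Tm.consts] using h⟩

theorem app (hs : WT C Γ s (Ty.arr A B)) (ht : WT C Γ t A) : WT C Γ (Tm.app s t) B :=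
  ⟨.app hs.1 ht.1, Finset.union_subset hs.2 ht.2⟩

theorem lam (ht : WT C (A :: Γ) t B) : WT C Γ (Tm.lam A t) (Ty.arr A B) :=
  ⟨.lam ht.1, ht.2⟩

theorem mono {C' : Finset ℕ} (h : WT C Γ t A) (hC : C ⊆ C') : WT C' Γ t A :=
  ⟨h.1, h.2.trans hC⟩

theorem rename (h : WT C Γ t A) {ρ : ℕ → ℕ} (hρ : IsRen ρ Γ Δ) : WT C Δ (t.rename ρ) A :=
  ⟨h.1.rename hρ, by rw [Tm.consts_rename]; exact h.2⟩

/-- Induction over typed terms with constants in `C`. -/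
theorem rec {P : List Ty → Tm → Ty → Prop}
    (hvar : ∀ {Γ i A}, Γ[i]? = some A → P Γ (Tm.var i) A)
    (hconst : ∀ {Γ c}, c ∈ C → P Γ (Tm.const c) Ty.o)
    (happ : ∀ {Γ s t A B}, WT C Γ s (Ty.arr A B) → WT C Γ t A → P Γ s (Ty.arr A B) → P Γ t A →
      P Γ (Tm.app s t) B)
    (hlam : ∀ {Γ t A B}, WT C (A :: Γ) t B → P (A :: Γ) t B → P Γ (Tm.lam A t) (Ty.arr A B))
    (h : WT C Γ t A) : P Γ t A := by
  obtain ⟨h, hC⟩ := h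
  induction h with
  | var hi => exact hvar hi
  | const => exact hconst (by simpa [Tm.consts] using hC)
  | app h1 h2 ih ih' =>
    have hC' := Finset.union_subset_iff.1 hC
    exact happ ⟨h1, hC'.1⟩ ⟨h2, hC'.2⟩ (ih hC'.1) (ih' hC'.2)
  | lam h1 ih => exact hlam ⟨h1, hC⟩ (ih hC)

end WT

theorem IsSub.cons {C : Finset ℕ} {σ : ℕ → Tm} {Γ Δ : List Ty} (h : IsSub C σ Γ Δ) {A : Ty}
    {u : Tm} (hu : WT C Δ u A) : IsSub C (consSubst u σ) (A :: Γ) Δ := by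
  intro i B hi
  cases i with
  | zero => simp at hi; subst hi; exact hu
  | succ i => exact h i B hi

theorem IsSub.rename {C : Finset ℕ} {σ : ℕ → Tm} {Γ Δ Θ : List Ty} (h : IsSub C σ Γ Δ)
    {ρ : ℕ → ℕ} (hρ : IsRen ρ Δ Θ) : IsSub C (fun i => (σ i).rename ρ) Γ Θ :=
  fun i A hi => (h i A hi).rename hρ

theorem IsSub.up {C : Finset ℕ} {σ : ℕ → Tm} {Γ Δ : List Ty} (h : IsSub C σ Γ Δ) (A : Ty) :
    IsSub C (upSubst σ) (A :: Γ) (A :: Δ) := by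
  rw [upSubst_eq]
  exact (h.rename (IsRen.succ Δ A)).cons (WT.var rfl)

theorem IsSub.nil {C : Finset ℕ} (σ : ℕ → Tm) (Δ : List Ty) : IsSub C σ [] Δ := by
  intro i A hi; simp at hi

theorem WT.subst {C : Finset ℕ} {Γ Δ : List Ty} {t : Tm} {A : Ty} {σ : ℕ → Tm}
    (h : WT C Γ t A) (hσ : IsSub C σ Γ Δ) : WT C Δ (t.subst σ) A := by
  revert Δ σ
  refine WT.rec (P := fun Γ t A => ∀ {Δ σ}, IsSub C σ Γ Δ → WT C Δ (t.subst σ) A)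
    ?_ ?_ ?_ ?_ h
  · intro Γ i A hi Δ σ hσ; exact hσ i A hi
  · intro Γ c hc Δ σ _; exact WT.const hc
  · intro Γ s t A B _ _ ih ih' Δ σ hσ; exact (ih hσ).app (ih' hσ)
  · intro Γ t A B _ ih Δ σ hσ; exact (ih (hσ.up A)).lam

theorem HasType.subst_congr {Γ : List Ty} {t : Tm} {A : Ty} (h : HasType Γ t A) {σ τ : ℕ → Tm}
    (hσ : ∀ i < Γ.length, σ i = τ i) : t.subst σ = t.subst τ := by
  induction h generalizing σ τ with
  | var hi => exact hσ _ (List.getElem?_eq_some_iff.1 hi).1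
  | const => rfl
  | app _ _ ih ih' => simp [Tm.subst, ih hσ, ih' hσ]
  | lam _ ih =>
    simp only [Tm.subst]
    rw [ih]
    intro i hi
    cases i with
    | zero => rfl
    | succ i => simp only [upSubst]; rw [hσ i (by simpa using hi)]

theorem HasType.subst_closed {t : Tm} {A : Ty} (h : HasType [] t A) (σ : ℕ → Tm) :
    t.subst σ = t := by
  rw [h.subst_congr (τ := Tm.var) (by simp), Tm.subst_var]

theorem WT.apps {C : Finset ℕ} {Γ : List Ty} {h : Tm} {Bs : List Ty} {us : List Tm} {A : Ty}
    (hh : WT C Γ h (Bs.foldr Ty.arr A)) (hus : List.Forall₂ (fun u B => WT C Γ u B) us Bs) :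
    WT C Γ (h.apps us) A := by
  induction hus generalizing h with
  | nil => exact hh
  | cons hu _ ih => exact ih (hh.app hu)

theorem Ty.arrs_eq_foldr (Bs : List Ty) : Ty.arrs Bs = Bs.foldr Ty.arr Ty.o := by
  induction Bs with
  | nil => rfl
  | cons B Bs ih => simp [Ty.arrs, ih]

theorem Ty.exists_eq_arrs (A : Ty) : ∃ As, A = Ty.arrs As := by
  induction A with
  | o => exact ⟨[], rfl⟩
  | arr A B _ ih =>
    obtain ⟨Bs, rfl⟩ := ih
    exact ⟨A :: Bs, rfl⟩

/-! ### Logical relations between closed terms -/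

/-- The logical relation between closed terms with constants in `C` which is generated by the
relation `R` on closed terms of ground type. -/
def LR (C : Finset ℕ) (R : Tm → Tm → Prop) : Ty → Tm → Tm → Prop
  | Ty.o, t, t' => WT C [] t Ty.o ∧ WT C [] t' Ty.o ∧ R t t'
  | Ty.arr A B, t, t' => WT C [] t (Ty.arr A B) ∧ WT C [] t' (Ty.arr A B) ∧
      ∀ u u' : Tm, LR C R A u u' → LR C R B (Tm.app t u) (Tm.app t' u')

/-- Invariance of a relation under beta-equivalence. -/
def BetaInvariant (R : Tm → Tm → Prop) : Prop :=
  ∀ {t t' u u' : Tm}, BetaEq t t' → BetaEq u u' → R t u → R t' u'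

/-- Two substitutions whose values at the variables of `Γ` are related. -/
def LRSub (C : Finset ℕ) (R : Tm → Tm → Prop) (Γ : List Ty) (σ τ : ℕ → Tm) : Prop :=
  ∀ (i : ℕ) (A : Ty), Γ[i]? = some A → LR C R A (σ i) (τ i)

section

variable {C : Finset ℕ} {R : Tm → Tm → Prop} {A : Ty} {t t' u u' : Tm}

theorem LR.left (h : LR C R A t u) : WT C [] t A := by
  cases A <;> exact h.1

theorem LR.right (h : LR C R A t u) : WT C [] u A := by
  cases A <;> exact h.2.1

/-- `BetaEq` is a relation on raw terms and expansion can destroy typability, so the typing of the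
new terms is supplied separately. -/
theorem LR.betaEq (hR : BetaInvariant R) (ht : BetaEq t t') (hu : BetaEq u u')
    (wt : WT C [] t' A) (wu : WT C [] u' A) (h : LR C R A t u) : LR C R A t' u' := by
  induction A generalizing t t' u u' with
  | o => exact ⟨wt, wu, hR ht hu h.2.2⟩
  | arr A B _ ih =>
    refine ⟨wt, wu, fun v v' hv => ?_⟩
    exact ih (ht.app (.refl _)) (hu.app (.refl _)) (wt.app hv.left) (wu.app hv.right)
      (h.2.2 v v' hv)

theorem LRSub.left {Γ : List Ty} {σ τ : ℕ → Tm} (h : LRSub C R Γ σ τ) : IsSub C σ Γ [] :=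
  fun i A hi => (h i A hi).left

theorem LRSub.right {Γ : List Ty} {σ τ : ℕ → Tm} (h : LRSub C R Γ σ τ) : IsSub C τ Γ [] :=
  fun i A hi => (h i A hi).right

theorem LRSub.cons {Γ : List Ty} {σ τ : ℕ → Tm} (h : LRSub C R Γ σ τ) (hu : LR C R A u u') :
    LRSub C R (A :: Γ) (consSubst u σ) (consSubst u' τ) := by
  intro i B hi
  cases i with
  | zero => simp at hi; subst hi; exact hu
  | succ i => exact h i B hi

theorem LRSub.nil (σ τ : ℕ → Tm) : LRSub C R [] σ τ := by
  intro i A hi; simp at hi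

/-- The fundamental theorem of logical relations. -/
theorem WT.lr {C₀ : Finset ℕ} {Γ : List Ty} (h : WT C₀ Γ t A) (hC : C₀ ⊆ C)
    (hR : BetaInvariant R) (hconst : ∀ a ∈ C₀, R (Tm.const a) (Tm.const a)) {σ τ : ℕ → Tm}
    (hσ : LRSub C R Γ σ τ) : LR C R A (t.subst σ) (t.subst τ) := by
  revert σ τ
  refine WT.rec (P := fun Γ t A => ∀ {σ τ}, LRSub C R Γ σ τ → LR C R A (t.subst σ) (t.subst τ))
    ?_ ?_ ?_ ?_ h
  · intro Γ i A hi σ τ hσ; exact hσ i A hi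
  · intro Γ c hc σ τ _; exact ⟨.const (hC hc), .const (hC hc), hconst c hc⟩
  · intro Γ s t A B _ _ ih ih' σ τ hσ; exact (ih hσ).2.2 _ _ (ih' hσ)
  · intro Γ t A B wt ih σ τ hσ
    have wl := (wt.mono hC).lam
    refine ⟨wl.subst hσ.left, wl.subst hσ.right, fun u u' hu => ?_⟩
    exact (ih (hσ.cons hu)).betaEq hR (BetaEq.beta_subst A t u σ).symm
      (BetaEq.beta_subst A t u' τ).symm ((wl.subst hσ.left).app hu.left)
      ((wl.subst hσ.right).app hu.right)

/-- The term uses constants of `C₀` while the relation lives over `C`. This leaves room for fresh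
constants that `R` need not relate to themselves. -/
theorem WT.lr_closed {C₀ : Finset ℕ} (h : WT C₀ [] t A) (hC : C₀ ⊆ C)
    (hR : BetaInvariant R) (hconst : ∀ a ∈ C₀, R (Tm.const a) (Tm.const a)) : LR C R A t t := by
  have := h.lr hC hR hconst (LRSub.nil Tm.var Tm.var)
  rwa [Tm.subst_var] at this

theorem LR.apps {h h' : Tm} {Bs : List Ty} {us us' : List Tm} (hh : LR C R (Ty.arrs Bs) h h')
    (hl : us.length = Bs.length) (hl' : us'.length = Bs.length)
    (hus : ∀ (j : ℕ) (u u' : Tm) (B : Ty), us[j]? = some u → us'[j]? = some u' →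
      Bs[j]? = some B → LR C R B u u') :
    LR C R Ty.o (h.apps us) (h'.apps us') := by
  induction Bs generalizing h h' us us' with
  | nil =>
    obtain rfl := List.length_eq_zero_iff.1 hl
    obtain rfl := List.length_eq_zero_iff.1 hl'
    exact hh
  | cons B Bs ih =>
    cases us with
    | nil => simp at hl
    | cons u us =>
      cases us' with
      | nil => simp at hl'
      | cons u' us' =>
        simp only [Tm.apps_cons]
        refine ih (hh.2.2 _ _ (hus 0 u u' B rfl rfl rfl)) (by simpa using hl) (by simpa using hl')
          fun j v v' D h1 h2 h3 => hus (j + 1) v v' D h1 h2 h3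

end

/-! ### Evaluation of closed ground terms -/

/-- Instance of the fundamental theorem for the relation "both sides are convertible to one and the
same constant of `C`"; no normalization theorem is needed. -/
theorem WT.exists_betaEq_const {C : Finset ℕ} {t : Tm} (h : WT C [] t Ty.o) :
    ∃ a ∈ C, BetaEq t (Tm.const a) := by
  have := h.lr_closed (R := fun t u => ∃ a ∈ C, BetaEq t (Tm.const a) ∧ BetaEq u (Tm.const a))
    subset_rfl ?_ ?_
  · obtain ⟨-, -, a, ha, h1, -⟩ := this
    exact ⟨a, ha, h1⟩
  · rintro t t' u u' ht hu ⟨a, ha, h1, h2⟩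
    exact ⟨a, ha, ht.symm.trans h1, hu.symm.trans h2⟩
  · exact fun a ha => ⟨a, ha, .refl _, .refl _⟩

/-! ### Observational equivalence is a logical relation -/

theorem betaInvariant_betaEq : BetaInvariant BetaEq :=
  fun ht hu h => (ht.symm.trans h).trans hu

theorem WT.lr_betaEq {C : Finset ℕ} {Γ : List Ty} {t : Tm} {A : Ty} (h : WT C Γ t A)
    {σ τ : ℕ → Tm} (hσ : LRSub C BetaEq Γ σ τ) :
    LR C BetaEq A (t.subst σ) (t.subst τ) :=
  h.lr subset_rfl betaInvariant_betaEq (fun _ _ => .refl _) hσ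

theorem WT.lr_betaEq_self {C : Finset ℕ} {t : Tm} {A : Ty} (h : WT C [] t A) :
    LR C BetaEq A t t :=
  h.lr_closed subset_rfl betaInvariant_betaEq (fun _ _ => .refl _)

section

variable {C : Finset ℕ} {A : Ty} {t u v : Tm}

theorem LR.symm (h : LR C BetaEq A t u) : LR C BetaEq A u t := by
  induction A generalizing t u with
  | o => exact ⟨h.2.1, h.1, h.2.2.symm⟩
  | arr A B ihA ihB =>
    exact ⟨h.2.1, h.1, fun x y hxy => ihB (h.2.2 _ _ (ihA hxy))⟩

theorem LR.trans (h : LR C BetaEq A t u) (h' : LR C BetaEq A u v) : LR C BetaEq A t v := by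
  induction A generalizing t u v with
  | o => exact ⟨h.1, h'.2.1, h.2.2.trans h'.2.2⟩
  | arr A B ihA ihB =>
    exact ⟨h.1, h'.2.1, fun x y hxy => ihB (h.2.2 _ _ hxy) (h'.2.2 _ _ (ihA hxy.symm hxy))⟩

/-- Testing on equal arguments and testing on related arguments agree because every closed term is
related to itself: for related `x`, `y` one passes from `t x` to `t y` and then to `u y`. In
particular observational equivalence is a congruence for application. -/
theorem obsEquiv_iff_lr : ObsEquiv C A t u ↔ LR C BetaEq A t u := by
  induction A generalizing t u with
  | o => rfl
  | arr A B ihA ihB =>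
    constructor
    · rintro ⟨ht, hu, h⟩
      refine ⟨ht, hu, fun x y hxy => ?_⟩
      have h1 := (WT.lr_betaEq_self ht).2.2 x y hxy
      exact h1.trans (ihB.1 (h y hxy.right))
    · rintro ⟨ht, hu, h⟩
      exact ⟨ht, hu, fun x hx => ihB.2 (h x x (WT.lr_betaEq_self hx))⟩

theorem ObsEquiv.lr (h : ObsEquiv C A t u) : LR C BetaEq A t u := obsEquiv_iff_lr.1 h

theorem LR.obs (h : LR C BetaEq A t u) : ObsEquiv C A t u := obsEquiv_iff_lr.2 h

theorem ObsEquiv.left (h : ObsEquiv C A t u) : WT C [] t A := h.lr.left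

theorem ObsEquiv.right (h : ObsEquiv C A t u) : WT C [] u A := h.lr.right

theorem ObsEquiv.symm (h : ObsEquiv C A t u) : ObsEquiv C A u t := h.lr.symm.obs

theorem ObsEquiv.trans (h : ObsEquiv C A t u) (h' : ObsEquiv C A u v) : ObsEquiv C A t v :=
  (h.lr.trans h'.lr).obs

theorem ObsEquiv.refl (h : WT C [] t A) : ObsEquiv C A t t := h.lr_betaEq_self.obs

theorem ObsEquiv.app {B : Ty} {t' u' : Tm} (h : ObsEquiv C (Ty.arr A B) t t')
    (h' : ObsEquiv C A u u') : ObsEquiv C B (Tm.app t u) (Tm.app t' u') :=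
  (h.lr.2.2 _ _ h'.lr).obs

theorem BetaEq.obsEquiv (h : BetaEq t u) (ht : WT C [] t A) (hu : WT C [] u A) :
    ObsEquiv C A t u :=
  (ht.lr_betaEq_self.betaEq betaInvariant_betaEq (.refl _) h ht hu).obs

end

/-! ### Closed contexts with ground holes -/

theorem Tm.fill_subst {K : ℕ} {c : Tm} {B : Ty} {ws : List Tm}
    (hc : HasType (List.replicate K Ty.o) c B) (hK : ws.length = K) (σ : ℕ → Tm) :
    (c.fill ws).subst σ = c.fill (ws.map (Tm.subst σ)) := by
  rw [Tm.fill, Tm.fill, Tm.subst_subst]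
  refine hc.subst_congr fun i hi => ?_
  simp at hi
  simp [List.getD, show i < ws.length by omega]

theorem isSub_fill {C : Finset ℕ} {Γ : List Ty} {ws : List Tm}
    (h : ∀ w ∈ ws, WT C Γ w Ty.o) :
    IsSub C (fun k => ws.getD k (Tm.var k)) (List.replicate ws.length Ty.o) Γ := by
  intro i A hi
  obtain ⟨hi', rfl⟩ : i < ws.length ∧ Ty.o = A := by
    simpa [List.getElem?_replicate] using hi
  simpa [List.getD, hi'] using h _ (List.getElem_mem hi')

theorem WT.fill {C : Finset ℕ} {Γ : List Ty} {ws : List Tm} {c : Tm} {B : Ty}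
    (hc : WT C (List.replicate ws.length Ty.o) c B) (h : ∀ w ∈ ws, WT C Γ w Ty.o) :
    WT C Γ (c.fill ws) B :=
  hc.subst (isSub_fill h)

theorem lrSub_fill {C : Finset ℕ} {R : Tm → Tm → Prop} {ws ws' : List Tm}
    (h : List.Forall₂ (LR C R Ty.o) ws ws') :
    LRSub C R (List.replicate ws.length Ty.o) (fun k => ws.getD k (Tm.var k))
      (fun k => ws'.getD k (Tm.var k)) := by
  intro i A hi
  obtain ⟨hi', rfl⟩ : i < ws.length ∧ Ty.o = A := by
    simpa [List.getElem?_replicate] using hi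
  have hi'' : i < ws'.length := h.length_eq ▸ hi'
  simpa [List.getD, hi', hi''] using h.get hi' hi''

/-- The closed contexts `cs` are of the types `Bs`, with `K` holes. -/
def IsCell (C : Finset ℕ) (K : ℕ) (cs : List Tm) (Bs : List Ty) : Prop :=
  cs.length = Bs.length ∧ ∀ (j : ℕ) (c : Tm) (B : Ty), cs[j]? = some c → Bs[j]? = some B →
    WT C (List.replicate K Ty.o) c B

theorem WT.apps_of_getElem? {C : Finset ℕ} {Γ : List Ty} {h : Tm} {Bs : List Ty} {us : List Tm}
    (hh : WT C Γ h (Ty.arrs Bs)) (hl : us.length = Bs.length)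
    (hus : ∀ (j : ℕ) (u : Tm) (B : Ty), us[j]? = some u → Bs[j]? = some B → WT C Γ u B) :
    WT C Γ (h.apps us) Ty.o := by
  rw [Ty.arrs_eq_foldr] at hh
  refine hh.apps (List.forall₂_iff_get.2 ⟨hl, fun i h1 h2 => ?_⟩)
  exact hus i _ _ (List.getElem?_eq_getElem h1) (List.getElem?_eq_getElem h2)

theorem IsCell.wt {C : Finset ℕ} {Γ : List Ty} {v : Tm} {cs ws : List Tm} {Bs : List Ty}
    (h : IsCell C ws.length cs Bs) (hv : WT C Γ v (Ty.arrs Bs)) (hw : ∀ w ∈ ws, WT C Γ w Ty.o) :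
    WT C Γ (v.apps (cs.map (Tm.fill ws))) Ty.o := by
  refine hv.apps_of_getElem? (by simpa using h.1) fun j u B hu hB => ?_
  simp only [List.getElem?_map, Option.map_eq_some_iff] at hu
  obtain ⟨c, hc, rfl⟩ := hu
  exact (h.2 j c B hc hB).fill hw

theorem IsCell.lr {C₀ C : Finset ℕ} {R : Tm → Tm → Prop} {v v' : Tm} {cs ws ws' : List Tm}
    {Bs : List Ty} (h : IsCell C₀ ws.length cs Bs) (hC : C₀ ⊆ C) (hR : BetaInvariant R)
    (hconst : ∀ a ∈ C₀, R (Tm.const a) (Tm.const a)) (hv : LR C R (Ty.arrs Bs) v v')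
    (hw : List.Forall₂ (LR C R Ty.o) ws ws') :
    LR C R Ty.o (v.apps (cs.map (Tm.fill ws))) (v'.apps (cs.map (Tm.fill ws'))) := by
  refine hv.apps (by simpa using h.1) (by simpa using h.1) fun j u u' B hu hu' hB => ?_
  simp only [List.getElem?_map, Option.map_eq_some_iff] at hu hu'
  obtain ⟨c, hc, rfl⟩ := hu
  obtain ⟨c', hc', rfl⟩ := hu'
  obtain rfl := Option.some.inj (hc.symm.trans hc')
  exact (h.2 j c B hc hB).lr hC hR hconst (lrSub_fill hw)

theorem IsCell.mono {C C' : Finset ℕ} {K : ℕ} {cs : List Tm} {Bs : List Ty}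
    (h : IsCell C K cs Bs) (hC : C ⊆ C') : IsCell C' K cs Bs :=
  ⟨h.1, fun j c B hc hB => (h.2 j c B hc hB).mono hC⟩

/-- A closed cell either ignores its holes or evaluates to one of them, uniformly. -/
theorem IsCell.eval {C : Finset ℕ} {K : ℕ} {v : Tm} {cs : List Tm} {Bs : List Ty}
    (h : IsCell C K cs Bs) (hv : WT C [] v (Ty.arrs Bs)) :
    (∃ a : ℕ, ∀ ws : List Tm, ws.length = K → (∀ w ∈ ws, WT C [] w Ty.o) →
        BetaEq (v.apps (cs.map (Tm.fill ws))) (Tm.const a)) ∨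
    (∃ k < K, ∀ ws : List Tm, ws.length = K → (∀ w ∈ ws, WT C [] w Ty.o) →
        BetaEq (v.apps (cs.map (Tm.fill ws))) (ws.getD k (Tm.var k))) := by
  -- All constants from `m` on lie outside `C`; the constant `m + i` is put into the `i`-th hole.
  set m := C.sup id + 1 with hm
  have hfresh : ∀ a ∈ C, a < m := fun a ha => Nat.lt_succ_of_le (Finset.le_sup (f := id) ha)
  set C' := C ∪ (Finset.range K).image (m + ·) with hC'
  have hCC' : C ⊆ C' := Finset.subset_union_left
  set fs : List Tm := (List.range K).map fun i => Tm.const (m + i) with hfs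
  have hfl : fs.length = K := by simp [hfs]
  have hfw : ∀ w ∈ fs, WT C' [] w Ty.o := by
    intro w hw
    simp only [hfs, List.mem_map, List.mem_range] at hw
    obtain ⟨i, hi, rfl⟩ := hw
    exact .const (Finset.mem_union_right _ (Finset.mem_image_of_mem _ (Finset.mem_range.2 hi)))
  have hcell : IsCell C fs.length cs Bs := by rw [hfl]; exact h
  obtain ⟨r, hr, hval⟩ := ((hcell.mono hCC').wt (hv.mono hCC') hfw).exists_betaEq_const
  -- The cell itself uses only constants of `C`, so a relation that preserves these and relates each
  -- fresh constant to the actual content of its hole also relates the two filled cells.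
  have key : ∀ R : Tm → Tm → Prop, BetaInvariant R → (∀ a ∈ C, R (Tm.const a) (Tm.const a)) →
      ∀ ws : List Tm, ws.length = K → (∀ w ∈ ws, WT C [] w Ty.o) →
      (∀ i, ∀ hi : i < ws.length, R (Tm.const (m + i)) ws[i]) →
      R (v.apps (cs.map (Tm.fill fs))) (v.apps (cs.map (Tm.fill ws))) := by
    intro R hR hconst ws hwl hww hRw
    refine (hcell.lr hCC' hR hconst (hv.lr_closed hCC' hR hconst) ?_).2.2
    refine List.forall₂_iff_get.2 ⟨hfl.trans hwl.symm, fun i h1 h2 => ?_⟩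
    refine ⟨hfw _ (List.get_mem _ _), (hww _ (List.get_mem _ _)).mono hCC', ?_⟩
    simpa [hfs] using hRw i h2
  by_cases hrC : r ∈ C
  · left
    refine ⟨r, fun ws hwl hww => ?_⟩
    -- For the holes the implication is vacuous: a fresh constant is not convertible to `r ∈ C`.
    refine key (fun n n' => BetaEq n (Tm.const r) → BetaEq n' (Tm.const r)) ?_ ?_ ws hwl hww ?_ hval
    · exact fun ht hu h hn => hu.symm.trans (h (ht.trans hn))
    · exact fun _ _ h => h
    · intro i _ hi
      have := hfresh r hrC
      have := hi.const_inj
      omega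
  · right
    rw [hC', Finset.mem_union, or_iff_right hrC, Finset.mem_image] at hr
    obtain ⟨k, hk, rfl⟩ := hr
    refine ⟨k, Finset.mem_range.1 hk, fun ws hwl hww => ?_⟩
    -- The relation reads "if the left side evaluates to the fresh constant of hole `k`, the right
    -- side is the content of hole `k`". It is vacuous for constants of `C` and for the other holes.
    refine key (fun n n' => BetaEq n (Tm.const (m + k)) → BetaEq n' (ws.getD k (Tm.var k)))
      ?_ ?_ ws hwl hww ?_ hval
    · exact fun ht hu h hn => hu.symm.trans (h (ht.trans hn))
    · intro a ha h
      have := hfresh a ha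
      have := h.const_inj
      omega
    · intro i hi h
      have : i = k := by have := h.const_inj; omega
      subst this
      simpa [List.getD, hi] using BetaEq.refl _

/-! ### Hereditary cellular terms with constants in a given set -/

/-- Hereditary cellular terms all of whose constants, including those which occur only in the
contents of vacuous holes, belong to `C`. -/
inductive HCell (C : Finset ℕ) : List Ty → Tm → Ty → Prop
  | const {Γ : List Ty} {a : ℕ} : a ∈ C → HCell C Γ (Tm.const a) Ty.o
  | lam {Γ : List Ty} {t : Tm} {A B : Ty} :
      HCell C (A :: Γ) t B → HCell C Γ (Tm.lam A t) (Ty.arr A B)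
  | cell {Γ : List Ty} {y : ℕ} {Bs : List Ty} {cs ws : List Tm} :
      Γ[y]? = some (Ty.arrs Bs) →
      cs.length = Bs.length →
      (∀ (j : ℕ) (c : Tm) (B : Ty), cs[j]? = some c → Bs[j]? = some B →
        HCell C (List.replicate ws.length Ty.o) c B) →
      (∀ w ∈ ws, HCell C Γ w Ty.o) →
      HCell C Γ ((Tm.var y).apps (cs.map (Tm.fill ws))) Ty.o

section

variable {C : Finset ℕ} {Γ Δ Z : List Ty} {t u : Tm} {A B : Ty}

theorem HCell.hereditaryCellular (h : HCell C Γ t A) : HereditaryCellular Γ t A := by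
  induction h with
  | const _ => exact .const
  | lam _ ih => exact .lam ih
  | cell hy hl _ _ ih ih' => exact .cell hy hl ih ih'

theorem HCell.wt (h : HCell C Γ t A) : WT C Γ t A := by
  induction h with
  | const ha => exact .const ha
  | lam _ ih => exact ih.lam
  | cell hy hl _ _ ih ih' => exact IsCell.wt ⟨hl, ih⟩ (.var hy) ih'

theorem IsCell.map_fill_subst {K : ℕ} {cs ws : List Tm} {Bs : List Ty} (h : IsCell C K cs Bs)
    (hK : ws.length = K) (σ : ℕ → Tm) :
    (cs.map (Tm.fill ws)).map (Tm.subst σ) = cs.map (Tm.fill (ws.map (Tm.subst σ))) := by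
  rw [List.map_map]
  refine List.map_congr_left fun c hc => ?_
  obtain ⟨j, hj, rfl⟩ := List.getElem_of_mem hc
  exact Tm.fill_subst (h.2 j _ _ (List.getElem?_eq_getElem hj)
    (List.getElem?_eq_getElem (h.1 ▸ hj))).1 hK σ

theorem IsCell.subst {K : ℕ} {cs ws : List Tm} {Bs : List Ty} (h : IsCell C K cs Bs)
    (hK : ws.length = K) (v : Tm) (σ : ℕ → Tm) :
    (v.apps (cs.map (Tm.fill ws))).subst σ =
      (v.subst σ).apps (cs.map (Tm.fill (ws.map (Tm.subst σ)))) := by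
  rw [Tm.apps_subst, h.map_fill_subst hK]

theorem HCell.rename (h : HCell C Γ t A) {ρ : ℕ → ℕ} (hρ : IsRen ρ Γ Δ) :
    HCell C Δ (t.rename ρ) A := by
  induction h generalizing ρ Δ with
  | const ha => exact .const ha
  | lam _ ih => exact .lam (ih (hρ.up _))
  | @cell Γ y Bs cs ws hy hl hc _ _ ih =>
    have hcell : IsCell C ws.length cs Bs := ⟨hl, fun j c B h1 h2 => (hc j c B h1 h2).wt⟩
    have e : ws.map (Tm.subst fun i => Tm.var (ρ i)) = ws.map (Tm.rename ρ) :=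
      List.map_congr_left fun w _ => (Tm.rename_eq_subst w ρ).symm
    rw [Tm.rename_eq_subst, hcell.subst rfl, e]
    refine .cell (hρ _ _ hy) hl (by simpa using hc) ?_
    intro w' hw'
    obtain ⟨w, hw, rfl⟩ := List.mem_map.1 hw'
    exact ih w hw hρ

/-! ### Terms whose cells have their head variables in a given prefix of the context -/

/-- `Reduced C Γ Z t B`: the term `t` of type `B` in the context `Z ++ Γ` is built from cells whose
head variable is in `Z` (or is bound in `t`) and from hereditary cellular terms in `Γ`. -/
inductive Reduced (C : Finset ℕ) (Γ : List Ty) : List Ty → Tm → Ty → Prop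
  | leaf {Z : List Ty} {w : Tm} : HCell C Γ w Ty.o →
      Reduced C Γ Z (w.rename (· + Z.length)) Ty.o
  | lam {Z : List Ty} {t : Tm} {A B : Ty} :
      Reduced C Γ (A :: Z) t B → Reduced C Γ Z (Tm.lam A t) (Ty.arr A B)
  | cell {Z : List Ty} {y : ℕ} {Bs : List Ty} {cs ws : List Tm} :
      Z[y]? = some (Ty.arrs Bs) →
      cs.length = Bs.length →
      (∀ (j : ℕ) (c : Tm) (B : Ty), cs[j]? = some c → Bs[j]? = some B →
        HCell C (List.replicate ws.length Ty.o) c B) →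
      (∀ w ∈ ws, Reduced C Γ Z w Ty.o) →
      Reduced C Γ Z ((Tm.var y).apps (cs.map (Tm.fill ws))) Ty.o

theorem getElem?_append_of_some {α : Type*} {l l' : List α} {i : ℕ} {a : α} (h : l[i]? = some a) :
    (l ++ l')[i]? = some a := by
  rw [List.getElem?_append_left (List.getElem?_eq_some_iff.1 h).1, h]

theorem Reduced.wt (h : Reduced C Γ Z t A) : WT C (Z ++ Γ) t A := by
  induction h with
  | leaf hw => exact hw.wt.rename (IsRen.prefix _ _)
  | lam _ ih => exact ih.lam
  | cell hy hl hc _ ih =>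
    exact IsCell.wt ⟨hl, fun j c B h1 h2 => (hc j c B h1 h2).wt⟩
      (.var (getElem?_append_of_some hy)) ih

/-- The extension of a substitution under `n` binders. -/
def upsSubst (n : ℕ) (σ : ℕ → Tm) (i : ℕ) : Tm :=
  if i < n then Tm.var i else (σ (i - n)).rename (· + n)

theorem upsSubst_zero (σ : ℕ → Tm) : upsSubst 0 σ = σ := by
  funext i
  simpa [upsSubst] using! Tm.rename_id (σ i)

theorem upSubst_upsSubst (n : ℕ) (σ : ℕ → Tm) : upSubst (upsSubst n σ) = upsSubst (n + 1) σ := by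
  funext i
  cases i with
  | zero => simp [upsSubst, upSubst]
  | succ i =>
    simp only [upsSubst, upSubst, Nat.add_lt_add_iff_right, Nat.add_sub_add_right]
    split_ifs
    · rfl
    · rw [Tm.rename_rename]; rfl

theorem exists_forall₂ {α β : Type*} {R : α → β → Prop} {l : List α} (h : ∀ a ∈ l, ∃ b, R a b) :
    ∃ l', List.Forall₂ R l l' := by
  induction l with
  | nil => exact ⟨[], .nil⟩
  | cons a l ih =>
    obtain ⟨b, hb⟩ := h a List.mem_cons_self
    obtain ⟨l', hl'⟩ := ih fun x hx => h x (List.mem_cons_of_mem _ hx)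
    exact ⟨b :: l', .cons hb hl'⟩

theorem map_eq_of_forall₂ {α β : Type*} {f : β → α} {l : List α} {l' : List β}
    (h : List.Forall₂ (fun a b => f b = a) l l') : l'.map f = l := by
  induction h with
  | nil => rfl
  | cons h _ ih => simp [h, ih]

theorem forall_mem_right_of_forall₂ {α β : Type*} {R : α → β → Prop} {P : β → Prop} {l : List α}
    {l' : List β} (h : List.Forall₂ R l l') (hP : ∀ a b, R a b → P b) : ∀ b ∈ l', P b := by
  induction h with
  | nil => simp
  | cons h _ ih => simpa using ⟨hP _ _ h, ih⟩

/-- As `Q` is monotone in its list, the witnesses for the elements of `l` can be concatenated. This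
lets several contexts share one list of hole contents, as the arguments of a cell must. -/
theorem exists_common_list {α β : Type*} {l : List α} {P : β → Prop} {Q : α → List β → Prop}
    (hQ : ∀ a m m', m ⊆ m' → Q a m → Q a m') (h : ∀ a ∈ l, ∃ m, (∀ b ∈ m, P b) ∧ Q a m) :
    ∃ m, (∀ b ∈ m, P b) ∧ ∀ a ∈ l, Q a m := by
  induction l with
  | nil => exact ⟨[], by simp, by simp⟩
  | cons a l ih =>
    obtain ⟨m, hm, hm'⟩ := h a List.mem_cons_self
    obtain ⟨n, hn, hn'⟩ := ih fun x hx => h x (List.mem_cons_of_mem _ hx)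
    refine ⟨m ++ n, fun b hb => (List.mem_append.1 hb).elim (hm b) (hn b), ?_⟩
    intro x hx
    rcases List.mem_cons.1 hx with rfl | hx
    · exact hQ _ _ _ (List.subset_append_left _ _) hm'
    · exact hQ _ _ _ (List.subset_append_right _ _) (hn' x hx)

/-- A reduced term is a closed context filled with hereditary cellular terms. -/
theorem Reduced.exists_context (h : Reduced C Γ Z t A) :
    ∃ ws₀ : List Tm, (∀ w ∈ ws₀, HCell C Γ w Ty.o) ∧ ∀ ws, ws₀ ⊆ ws →
      ∃ c, c.subst (upsSubst Z.length fun k => ws.getD k (Tm.var k)) = t ∧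
        HCell C (Z ++ List.replicate ws.length Ty.o) c A := by
  induction h with
  | @leaf Z w hw =>
    refine ⟨[w], by simpa using hw, fun ws hws => ?_⟩
    obtain ⟨k, hk, rfl⟩ := List.getElem_of_mem (hws List.mem_cons_self)
    -- A leaf becomes a hole. Its variable counts as hereditary cellular because it is a cell with a
    -- ground head and no arguments.
    refine ⟨(Tm.var (k + Z.length)).apps ([].map (Tm.fill [])), ?_, ?_⟩
    · simp [Tm.subst, upsSubst, List.getD, hk]
    · refine HCell.cell (Bs := []) (IsRen.prefix _ _ _ _ ?_) rfl (by simp) (by simp)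
      simp [hk, Ty.arrs]
  | lam _ ih =>
    obtain ⟨ws₀, h0, h⟩ := ih
    refine ⟨ws₀, h0, fun ws hws => ?_⟩
    obtain ⟨c, rfl, hc'⟩ := h ws hws
    exact ⟨_, by rw [Tm.subst, upSubst_upsSubst]; rfl, .lam hc'⟩
  | @cell Z y Bs cs us hy hl hc hw ih =>
    obtain ⟨ws₀, h0, h⟩ := exists_common_list (by
      intro u m m' hm h ws hws; exact h ws (List.Subset.trans hm hws)) ih
    refine ⟨ws₀, h0, fun ws hws => ?_⟩
    obtain ⟨ds, hds⟩ := exists_forall₂ fun u hu => h u hu ws hws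
    have hlen := hds.length_eq
    have hcell : IsCell C ds.length cs Bs :=
      ⟨hl, fun j c B h1 h2 => hlen ▸ (hc j c B h1 h2).wt⟩
    refine ⟨(Tm.var y).apps (cs.map (Tm.fill ds)), ?_, ?_⟩
    · rw [hcell.subst rfl, map_eq_of_forall₂ (hds.imp fun _ _ h => h.1), Tm.subst, upsSubst,
        if_pos (List.getElem?_eq_some_iff.1 hy).1]
    · refine .cell (getElem?_append_of_some hy) hl (hlen ▸ hc) ?_
      exact forall_mem_right_of_forall₂ hds fun _ _ h => h.2

/-! ### Elimination of the nested cells -/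

/-- The ground term `b` is pointwise equivalent to a hereditary cellular term. -/
def Rep (C : Finset ℕ) (Γ : List Ty) (b : Tm) : Prop :=
  ∃ b', HCell C Γ b' Ty.o ∧ ∀ σ, IsSub C σ Γ [] → BetaEq (b.subst σ) (b'.subst σ)

theorem Rep.congr {b b' : Tm} (h : Rep C Γ b')
    (e : ∀ σ, IsSub C σ Γ [] → BetaEq (b.subst σ) (b'.subst σ)) : Rep C Γ b := by
  obtain ⟨d, hd, h⟩ := h
  exact ⟨d, hd, fun σ hσ => (e σ hσ).trans (h σ hσ)⟩

/-- If the left-hand side has the value `c`, then so does the right-hand side. -/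
def ValueLE (c : ℕ) (t u : Tm) : Prop :=
  BetaEq t (Tm.const c) → BetaEq u (Tm.const c)

theorem betaInvariant_valueLE (c : ℕ) : BetaInvariant (ValueLE c) :=
  fun ht hu h hc => hu.symm.trans (h (ht.trans hc))

theorem ValueLE.refl (c : ℕ) (t : Tm) : ValueLE c t t := fun h => h

/-- `K` behaves like a context with a hole of type `B` that binds the variables of `Z`. -/
structure IsContext (C : Finset ℕ) (Γ Z : List Ty) (B : Ty) (K : Tm → Tm) : Prop where
  wt : ∀ u, WT C (Z ++ Γ) u B → WT C Γ (K u) Ty.o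
  -- The bound variables of `Z` range over related values, those of `Γ` are fixed by `σ`. A
  -- one-sided comparison is enough: a closed ground term always has a value `c`, and it suffices to
  -- transport that value.
  mono : ∀ (c : ℕ) (σ : ℕ → Tm), IsSub C σ Γ [] → ∀ u u' : Tm, WT C (Z ++ Γ) u B →
    WT C (Z ++ Γ) u' B →
    (∀ τ τ' : ℕ → Tm, LRSub C (ValueLE c) (Z ++ Γ) τ τ' → (∀ i, τ (i + Z.length) = σ i) →
      (∀ i, τ' (i + Z.length) = σ i) → LR C (ValueLE c) B (u.subst τ) (u'.subst τ')) →
    ValueLE c ((K u).subst σ) ((K u').subst σ)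

theorem WT.lr_valueLE {c : ℕ} {σ τ : ℕ → Tm} (h : WT C Γ t A)
    (hσ : LRSub C (ValueLE c) Γ σ τ) : LR C (ValueLE c) A (t.subst σ) (t.subst τ) :=
  h.lr subset_rfl (betaInvariant_valueLE c) (fun _ _ => ValueLE.refl _ _) hσ

theorem IsSub.lrSub_valueLE {c : ℕ} {σ : ℕ → Tm} (h : IsSub C σ Γ []) :
    LRSub C (ValueLE c) Γ σ σ := fun i A hi =>
  (h i A hi).lr_closed subset_rfl (betaInvariant_valueLE c) (fun _ _ => ValueLE.refl _ _)

/-- This lemma and `IsContext.cell` move the hole of a context one step inwards, under an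
abstraction or into one content of a cell; they drive the descent in `HCell.rep_context`. -/
theorem IsContext.lam {K : Tm → Tm} (h : IsContext C Γ Z (Ty.arr A B) K) :
    IsContext C Γ (A :: Z) B (fun t => K (Tm.lam A t)) := by
  refine ⟨fun u hu => h.wt _ hu.lam, fun c σ hσ u u' hu hu' hyp => ?_⟩
  refine h.mono c σ hσ _ _ hu.lam hu'.lam fun τ τ' hτ h1 h2 => ?_
  have w1 := hu.lam.subst hτ.left
  have w2 := hu'.lam.subst hτ.right
  refine ⟨w1, w2, fun a a' ha => ?_⟩
  exact (hyp _ _ (hτ.cons ha) h1 h2).betaEq (betaInvariant_valueLE c)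
    (BetaEq.beta_subst A u a τ).symm (BetaEq.beta_subst A u' a' τ').symm (w1.app ha.left)
    (w2.app ha.right)

theorem forall₂_append_cons {α : Type*} {R : α → α → Prop} {l r : List α} {a a' : α}
    (hl : ∀ x ∈ l, R x x) (hr : ∀ x ∈ r, R x x) (ha : R a a') :
    List.Forall₂ R (l ++ a :: r) (l ++ a' :: r) := by
  have hself : ∀ m : List α, (∀ x ∈ m, R x x) → List.Forall₂ R m m := by
    intro m hm
    induction m with
    | nil => exact .nil
    | cons x m ih =>
      exact .cons (hm x List.mem_cons_self) (ih fun y hy => hm y (List.mem_cons_of_mem _ hy))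
  exact List.rel_append (hself l hl) (.cons ha (hself r hr))

theorem IsContext.cell {K : Tm → Tm} (h : IsContext C Γ Z Ty.o K) {y : ℕ} {Bs : List Ty}
    {cs l r : List Tm} (hy : (Z ++ Γ)[y]? = some (Ty.arrs Bs))
    (hc : IsCell C (l.length + (r.length + 1)) cs Bs) (hl : ∀ w ∈ l, WT C (Z ++ Γ) w Ty.o)
    (hr : ∀ w ∈ r, WT C (Z ++ Γ) w Ty.o) :
    IsContext C Γ Z Ty.o (fun u => K ((Tm.var y).apps (cs.map (Tm.fill (l ++ u :: r))))) := by
  have hlen : ∀ u, (l ++ u :: r).length = l.length + (r.length + 1) := fun u => by simp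
  have hwt : ∀ u, WT C (Z ++ Γ) u Ty.o →
      WT C (Z ++ Γ) ((Tm.var y).apps (cs.map (Tm.fill (l ++ u :: r)))) Ty.o := by
    intro u hu
    refine IsCell.wt ((hlen u).symm ▸ hc) (.var hy) ?_
    simp only [List.mem_append, List.mem_cons]
    rintro w (hw | rfl | hw)
    exacts [hl w hw, hu, hr w hw]
  refine ⟨fun u hu => h.wt _ (hwt u hu), fun c σ hσ u u' hu hu' hyp => ?_⟩
  refine h.mono c σ hσ _ _ (hwt u hu) (hwt u' hu') fun τ τ' hτ h1 h2 => ?_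
  rw [hc.subst (hlen u), hc.subst (hlen u')]
  refine IsCell.lr (C₀ := C) (by rw [List.length_map, hlen]; exact hc) subset_rfl
    (betaInvariant_valueLE c) (fun _ _ => ValueLE.refl _ _) (hτ y _ hy) ?_
  rw [List.forall₂_map_left_iff, List.forall₂_map_right_iff]
  exact forall₂_append_cons (fun w hw => (hl w hw).lr_valueLE hτ)
    (fun w hw => (hr w hw).lr_valueLE hτ) (hyp τ τ' hτ h1 h2)

/-- The entries are replaced from left to right: when `w` is treated, those before it already
satisfy `R` and those from `w` on are original. The argument is in continuation form, since `Q`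
before a replacement is derived from `Q` after all admissible replacements. -/
theorem replace_each {Q : List Tm → Prop} {R : ℕ → Tm → Prop} (ws : List Tm)
    (step : ∀ (l : List Tm) (w : Tm) (r : List Tm), l.length + (r.length + 1) = ws.length →
      (∀ (j : ℕ) (x : Tm), l[j]? = some x → R j x) →
      (∀ (j : ℕ) (x : Tm), (w :: r)[j]? = some x → ws[l.length + j]? = some x) →
      (∀ w', R l.length w' → Q (l ++ w' :: r)) → Q (l ++ w :: r))
    (last : ∀ ws' : List Tm, ws'.length = ws.length →
      (∀ (j : ℕ) (x : Tm), ws'[j]? = some x → R j x) → Q ws') : Q ws := by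
  have key : ∀ r l : List Tm, l.length + r.length = ws.length →
      (∀ (j : ℕ) (x : Tm), l[j]? = some x → R j x) →
      (∀ (j : ℕ) (x : Tm), r[j]? = some x → ws[l.length + j]? = some x) → Q (l ++ r) := by
    intro r
    induction r with
    | nil => intro l hl hR _; exact last _ (by simpa using hl) (by simpa using hR)
    | cons w r ih =>
      intro l hl hR hr
      refine step l w r (by simpa using hl) hR hr fun w' hw' => ?_
      have := ih (l ++ [w']) (by simp at hl ⊢; omega) ?_ ?_
      · simpa using this
      · intro j x hx
        rcases lt_trichotomy j l.length with hj | rfl | hj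
        · rw [List.getElem?_append_left hj] at hx; exact hR j x hx
        · simp at hx; exact hx ▸ hw'
        · rw [List.getElem?_eq_none (by simp; omega)] at hx; cases hx
      · intro j x hx
        have := hr (j + 1) x hx
        rwa [List.length_append, List.length_singleton, add_assoc, add_comm 1 j]
  exact key ws [] (by simp) (by simp) (by simp)

/-- A cell with its head in `Γ` inside a context that binds `Z` can be moved outside. -/
theorem IsContext.rep_of_outer_cell {K : Tm → Tm} (h : IsContext C Γ Z Ty.o K) {k : ℕ}
    {Bs : List Ty} {cs ws : List Tm} (hk : Γ[k]? = some (Ty.arrs Bs))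
    (hl : cs.length = Bs.length)
    (hc : ∀ (j : ℕ) (c : Tm) (B : Ty), cs[j]? = some c → Bs[j]? = some B →
        HCell C (List.replicate ws.length Ty.o) c B)
    (hw : ∀ w ∈ ws, HCell C (Z ++ Γ) w Ty.o) (hrep : ∀ w ∈ ws, Rep C Γ (K w))
    (hred : ∀ u', Reduced C Γ Z u' Ty.o → Rep C Γ (K u')) :
    Rep C Γ (K ((Tm.var (k + Z.length)).apps (cs.map (Tm.fill ws)))) := by
  obtain ⟨ts, hts⟩ := exists_forall₂ hrep
  have hlen := hts.length_eq
  have hcell : IsCell C ws.length cs Bs := ⟨hl, fun j c B h1 h2 => (hc j c B h1 h2).wt⟩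
  -- This is the cell moved outside: each content `w` is replaced by a representative in `Γ` of `K
  -- w`.
  have hT : HCell C Γ ((Tm.var k).apps (cs.map (Tm.fill ts))) Ty.o :=
    .cell hk hl (hlen ▸ hc) (forall_mem_right_of_forall₂ hts fun _ _ h => h.1)
  set T := (Tm.var k).apps (cs.map (Tm.fill ts)) with hTdef
  set g := (Tm.var (k + Z.length)).apps (cs.map (Tm.fill ws)) with hg
  have hk' : (Z ++ Γ)[k + Z.length]? = some (Ty.arrs Bs) := IsRen.prefix Z Γ k _ hk
  have wg : WT C (Z ++ Γ) g Ty.o := hcell.wt (.var hk') fun w h => (hw w h).wt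
  have wT : WT C (Z ++ Γ) (T.rename (· + Z.length)) Ty.o := hT.wt.rename (IsRen.prefix _ _)
  -- It remains to see that `K g` and `K T` have the same value; `T`, weakened by `Z`, is a leaf and
  -- hence reduced.
  refine (hred _ (.leaf hT)).congr fun σ hσ => ?_
  obtain ⟨c, -, hval⟩ := ((h.wt g wg).subst hσ).exists_betaEq_const
  refine hval.trans (BetaEq.symm ?_)
  have hTσ : T.subst σ = (σ k).apps (cs.map (Tm.fill (ts.map (Tm.subst σ)))) :=
    hcell.subst hlen.symm _ _
  have hgτ : ∀ τ : ℕ → Tm, (∀ i, τ (i + Z.length) = σ i) →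
      g.subst τ = (σ k).apps (cs.map (Tm.fill (ws.map (Tm.subst τ)))) := by
    intro τ hτ
    rw [hg, hcell.subst rfl, Tm.subst, hτ]
  have hleaf : ∀ τ : ℕ → Tm, (∀ i, τ (i + Z.length) = σ i) →
      (T.rename (· + Z.length)).subst τ = T.subst σ := by
    intro τ hτ
    rw [Tm.subst_rename]
    congr 1
    funext i
    exact hτ i
  have wtσ : ∀ w ∈ ts.map (Tm.subst σ), WT C [] w Ty.o := by
    intro w hw
    obtain ⟨t, ht, rfl⟩ := List.mem_map.1 hw
    exact (forall_mem_right_of_forall₂ hts (P := fun t => HCell C Γ t Ty.o)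
      (fun _ _ h => h.1) t ht).wt.subst hσ
  have wwτ : ∀ τ : ℕ → Tm, IsSub C τ (Z ++ Γ) [] → ∀ w ∈ ws.map (Tm.subst τ), WT C [] w Ty.o := by
    intro τ hτ w hw'
    obtain ⟨t, ht, rfl⟩ := List.mem_map.1 hw'
    exact (hw t ht).wt.subst hτ
  rcases hcell.eval (hσ k _ hk) with ⟨a, ha⟩ | ⟨j, hj, hproj⟩
  -- If the cell ignores its holes, `g` and `T` have the same value `a` under every instance.
  · refine h.mono c σ hσ _ _ wg wT (fun τ τ' hτ h1 h2 => ?_) hval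
    refine ⟨wg.subst hτ.left, wT.subst hτ.right, fun hc => ?_⟩
    rw [hleaf τ' h2, hTσ]
    rw [hgτ τ h1] at hc
    exact (ha _ (by simpa using hlen.symm) wtσ).trans
      ((ha _ (by simp) (wwτ τ hτ.left)).symm.trans hc)
  -- If the cell projects on hole `j`, the value `c` of `K g` is that of `K ws[j]`, hence of the
  -- `j`-th term of `ts`, hence of `T` itself.
  · have hgw : ∀ τ : ℕ → Tm, IsSub C τ (Z ++ Γ) [] → (∀ i, τ (i + Z.length) = σ i) →
        BetaEq (g.subst τ) (ws[j].subst τ) := by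
      intro τ hτ h1
      rw [hgτ τ h1]
      simpa [List.getD, hj] using hproj _ (by simp) (wwτ τ hτ)
    have wj : WT C (Z ++ Γ) ws[j] Ty.o := (hw _ (List.getElem_mem hj)).wt
    have e1 : BetaEq ((K ws[j]).subst σ) (Tm.const c) := by
      refine h.mono c σ hσ _ _ wg wj (fun τ τ' hτ h1 h2 => ?_) hval
      refine ⟨wg.subst hτ.left, wj.subst hτ.right, fun hc => ?_⟩
      exact (wj.lr_valueLE hτ).2.2 ((hgw τ hτ.left h1).symm.trans hc)
    have e2 : BetaEq (T.subst σ) (Tm.const c) := by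
      have hj' : j < ts.length := hlen ▸ hj
      have := hproj _ (by simpa using hlen.symm) wtσ
      rw [hTσ]
      refine this.trans (BetaEq.trans ?_ e1)
      simpa [List.getD, hj'] using ((hts.get hj hj').2 σ hσ).symm
    -- Since `T` has value `c` whatever the variables of `Z` are, `ValueLE c` from `g` to `T` holds
    -- trivially, and monotonicity of `K` carries `c` from `K g` to `K T`.
    refine h.mono c σ hσ _ _ wg wT (fun τ τ' hτ h1 h2 => ?_) hval
    refine ⟨wg.subst hτ.left, wT.subst hτ.right, fun _ => ?_⟩
    rwa [hleaf τ' h2]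

/-- The induction on `u` keeps `K` arbitrary, so that `K` can absorb the part of `u` already
traversed. The hypothesis `hred` is the continuation: representability once the hole holds a reduced
term. -/
theorem HCell.rep_context (hu : HCell C Δ u B) {Z Γ : List Ty} (hΔ : Δ = Z ++ Γ) {K : Tm → Tm}
    (hK : IsContext C Γ Z B K) (hred : ∀ u', Reduced C Γ Z u' B → Rep C Γ (K u')) :
    Rep C Γ (K u) := by
  induction hu generalizing Z K with
  | @const _ a ha => exact hred _ (.leaf (w := Tm.const a) (.const ha))
  | lam _ ih =>
    subst hΔ
    exact ih rfl hK.lam fun u' hu' => hred _ (.lam hu')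
  | @cell Δ y Bs cs ws hy hl hc hw _ ih =>
    subst hΔ
    -- A cell with its head in `Z` stays in place and its contents are reduced one after another; a
    -- cell with its head in `Γ` is moved outside.
    rcases lt_or_ge y Z.length with hyZ | hyZ
    · have hy' : Z[y]? = some (Ty.arrs Bs) := by rwa [List.getElem?_append_left hyZ] at hy
      refine replace_each (Q := fun ws => Rep C Γ (K ((Tm.var y).apps (cs.map (Tm.fill ws)))))
        (R := fun _ w => Reduced C Γ Z w Ty.o) ws ?_ ?_
      · intro l w r hlen hL hR hstep
        have hmem : ∀ x ∈ w :: r, x ∈ ws := by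
          intro x hx
          obtain ⟨j, hj⟩ := List.getElem?_of_mem hx
          exact List.mem_of_getElem? (hR j x hj)
        refine ih w (hmem w List.mem_cons_self) rfl
          (K := fun u => K ((Tm.var y).apps (cs.map (Tm.fill (l ++ u :: r))))) ?_ hstep
        refine hK.cell hy ⟨hl, fun j c B h1 h2 => hlen ▸ (hc j c B h1 h2).wt⟩ ?_ ?_
        · intro x hx
          obtain ⟨j, hj⟩ := List.getElem?_of_mem hx
          exact (hL j x hj).wt
        · exact fun x hx => (hw x (hmem x (List.mem_cons_of_mem _ hx))).wt
      · intro ws' hlen hR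
        refine hred _ (.cell hy' hl (hlen ▸ hc) fun w hw' => ?_)
        obtain ⟨j, hj⟩ := List.getElem?_of_mem hw'
        exact hR j w hj
    · obtain ⟨k, rfl⟩ := Nat.exists_eq_add_of_le' hyZ
      have hk : Γ[k]? = some (Ty.arrs Bs) := by
        rw [List.getElem?_append_right hyZ] at hy
        simpa using hy
      exact hK.rep_of_outer_cell hk hl hc hw (fun w hw' => ih w hw' rfl hK hred) hred

theorem isContext_apps {y : ℕ} {Bs : List Ty} {l r : List Tm} (hy : Γ[y]? = some (Ty.arrs Bs))
    (hlen : l.length + (r.length + 1) = Bs.length) (hB : Bs[l.length]? = some B)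
    (hlr : ∀ (u : Tm) (j : ℕ) (x : Tm) (D : Ty), j ≠ l.length → (l ++ u :: r)[j]? = some x →
      Bs[j]? = some D → WT C Γ x D) :
    IsContext C Γ [] B (fun u => (Tm.var y).apps (l ++ u :: r)) := by
  have hmid : ∀ (u x : Tm), (l ++ u :: r)[l.length]? = some x → x = u := by
    intro u x hx; simpa using hx.symm
  refine ⟨fun u hu => ?_, fun c σ hσ u u' hu hu' hyp => ?_⟩
  · refine (WT.var hy).apps_of_getElem? (by simpa using hlen) fun j x D hx hD => ?_
    by_cases hj : j = l.length
    · subst hj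
      obtain rfl := hmid u x hx
      obtain rfl := Option.some.inj (hB.symm.trans hD)
      exact hu
    · exact hlr u j x D hj hx hD
  · have hσ' := hσ.lrSub_valueLE (c := c)
    simp only [Tm.apps_subst]
    refine (LR.apps (hσ' y _ hy) (by simpa using hlen) (by simpa using hlen)
      fun j x x' D hx hx' hD => ?_).2.2
    simp only [List.getElem?_map, Option.map_eq_some_iff] at hx hx'
    obtain ⟨x, hx, rfl⟩ := hx
    obtain ⟨x', hx', rfl⟩ := hx'
    by_cases hj : j = l.length
    · subst hj
      obtain rfl := hmid u x hx
      obtain rfl := hmid u' x' hx'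
      obtain rfl := Option.some.inj (hB.symm.trans hD)
      exact hyp σ σ hσ' (fun _ => rfl) (fun _ => rfl)
    · have : x = x' := by
        rcases Nat.lt_or_gt_of_ne hj with hj | hj
        · rw [List.getElem?_append_left hj] at hx hx'
          exact Option.some.inj (hx.symm.trans hx')
        · obtain ⟨m, rfl⟩ := Nat.exists_eq_add_of_lt hj
          rw [List.getElem?_append_right (by omega)] at hx hx'
          rw [show l.length + m + 1 - l.length = m + 1 by omega] at hx hx'
          exact Option.some.inj (hx.symm.trans hx')
      subst this
      exact (hlr u j x D hj hx hD).lr_valueLE hσ'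

/-- A variable applied to hereditary cellular terms is pointwise equivalent to a hereditary
cellular term. -/
theorem rep_apps {y : ℕ} {Bs : List Ty} {us : List Tm} (hy : Γ[y]? = some (Ty.arrs Bs))
    (hus : List.Forall₂ (fun u B => HCell C Γ u B) us Bs) : Rep C Γ ((Tm.var y).apps us) := by
  have hlen := hus.length_eq
  have hus' : ∀ (j : ℕ) (u : Tm) (B : Ty), us[j]? = some u → Bs[j]? = some B → HCell C Γ u B := by
    intro j u B hu hB
    obtain ⟨h1, rfl⟩ := List.getElem?_eq_some_iff.1 hu
    obtain ⟨h2, rfl⟩ := List.getElem?_eq_some_iff.1 hB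
    exact hus.get h1 h2
  -- Each argument is made reduced in turn, the others forming the context `isContext_apps`. The
  -- relation depends on the position because the arguments have different types.
  refine replace_each (Q := fun us => Rep C Γ ((Tm.var y).apps us))
    (R := fun j u => ∀ B, Bs[j]? = some B → Reduced C Γ [] u B) us ?_ ?_
  · intro l w r hlr hL hR hstep
    obtain ⟨B, hB⟩ : ∃ B, Bs[l.length]? = some B :=
      ⟨_, List.getElem?_eq_getElem (by omega)⟩
    refine (hus' _ w B (hR 0 w rfl) hB).rep_context (Z := []) rfl
      (K := fun u => (Tm.var y).apps (l ++ u :: r)) ?_ ?_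
    · refine isContext_apps hy (by omega) hB fun u j x D hj hx hD => ?_
      rcases Nat.lt_or_gt_of_ne hj with hj | hj
      · rw [List.getElem?_append_left hj] at hx
        exact (hL j x hx D hD).wt
      · obtain ⟨m, rfl⟩ := Nat.exists_eq_add_of_lt hj
        rw [List.getElem?_append_right (by omega),
          show l.length + m + 1 - l.length = m + 1 by omega] at hx
        exact (hus' _ x D (hR (m + 1) x hx) hD).wt
    · intro u' hu'
      refine hstep u' fun B' hB' => ?_
      obtain rfl := Option.some.inj (hB.symm.trans hB')
      exact hu'
  · intro us' hlen' hR
    -- Reduced arguments are closed contexts filled with terms over `Γ`; choosing a common list `ws`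
    -- of contents turns the application into one cell.
    obtain ⟨ws, hws, h⟩ := exists_common_list (l := us'.zip Bs) (P := fun w => HCell C Γ w Ty.o)
      (Q := fun p ws₀ => ∀ ws, ws₀ ⊆ ws → ∃ c : Tm, c.fill ws = p.1 ∧
        HCell C (List.replicate ws.length Ty.o) c p.2) (by
      intro u m m' hm h ws hws; exact h ws (List.Subset.trans hm hws)) (by
      rintro ⟨u, B⟩ hu
      obtain ⟨j, hj⟩ := List.getElem?_of_mem hu
      rw [List.getElem?_zip_eq_some] at hj
      have := (hR j u hj.1 B hj.2).exists_context
      simp only [List.length_nil, upsSubst_zero, List.nil_append] at this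
      exact this)
    obtain ⟨cs, hcs⟩ := exists_forall₂ fun p hp => h p hp ws (List.Subset.refl ws)
    have e1 : List.Forall₂ (fun u c => Tm.fill ws c = u) us' cs := by
      have := hcs.imp fun _ _ h => h.1
      rw [← List.forall₂_map_left_iff (f := Prod.fst) (R := fun u c => Tm.fill ws c = u),
        List.map_fst_zip (by omega)] at this
      exact this
    have e2 : List.Forall₂ (fun B c => HCell C (List.replicate ws.length Ty.o) c B) Bs cs := by
      have := hcs.imp fun _ _ h => h.2
      rw [← List.forall₂_map_left_iff (f := Prod.snd)
        (R := fun B c => HCell C (List.replicate ws.length Ty.o) c B),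
        List.map_snd_zip (by omega)] at this
      exact this
    rw [← map_eq_of_forall₂ e1]
    refine ⟨_, .cell hy e2.length_eq.symm (fun j c B hc hB => ?_) hws, fun σ _ => .refl _⟩
    obtain ⟨h1, rfl⟩ := List.getElem?_eq_some_iff.1 hc
    obtain ⟨h2, rfl⟩ := List.getElem?_eq_some_iff.1 hB
    exact e2.get h2 h1

/-! ### Normalization to hereditary cellular terms -/

/-- Observational equivalence of all closed instances. -/
def Eqv (C : Finset ℕ) (Γ : List Ty) (A : Ty) (t t' : Tm) : Prop :=
  ∀ σ, IsSub C σ Γ [] → ObsEquiv C A (t.subst σ) (t'.subst σ)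

/-- Computability predicate for the normalization proof. -/
def Good (C : Finset ℕ) : Ty → List Ty → Tm → Prop
  | Ty.o, Γ, t => WT C Γ t Ty.o ∧ Rep C Γ t
  | Ty.arr A B, Γ, t => WT C Γ t (Ty.arr A B) ∧ ∀ (Δ : List Ty) (ρ : ℕ → ℕ) (u : Tm),
      IsRen ρ Γ Δ → Good C A Δ u → Good C B Δ (Tm.app (t.rename ρ) u)

/-- `t` is pointwise equivalent to a variable applied to hereditary cellular terms. -/
def Neutral (C : Finset ℕ) (Γ : List Ty) (t : Tm) (A : Ty) : Prop :=
  WT C Γ t A ∧ ∃ (y : ℕ) (Bs : List Ty) (us : List Tm), Γ[y]? = some (Bs.foldr Ty.arr A) ∧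
    List.Forall₂ (fun u B => HCell C Γ u B) us Bs ∧ Eqv C Γ A t ((Tm.var y).apps us)

theorem Good.wt (h : Good C A Γ t) : WT C Γ t A := by
  cases A <;> exact h.1

theorem IsRen.isSub_comp {ρ : ℕ → ℕ} (hρ : IsRen ρ Γ Δ) {σ : ℕ → Tm} (hσ : IsSub C σ Δ []) :
    IsSub C (σ ∘ ρ) Γ [] := fun i A hi => hσ _ A (hρ i A hi)

theorem Good.rename {ρ : ℕ → ℕ} (h : Good C A Γ t) (hρ : IsRen ρ Γ Δ) :
    Good C A Δ (t.rename ρ) := by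
  cases A with
  | o =>
    obtain ⟨wt, b, hb, e⟩ := h
    refine ⟨wt.rename hρ, b.rename ρ, hb.rename hρ, fun σ hσ => ?_⟩
    rw [Tm.subst_rename, Tm.subst_rename]
    exact e _ (hρ.isSub_comp hσ)
  | arr A B =>
    refine ⟨h.1.rename hρ, fun Θ ρ' u hρ' hu => ?_⟩
    rw [Tm.rename_rename]
    exact h.2 Θ _ u (hρ.comp hρ') hu

theorem Good.congr {t' : Tm} (h : Good C A Γ t) (wt' : WT C Γ t' A) (e : Eqv C Γ A t t') :
    Good C A Γ t' := by
  induction A generalizing Γ t t' with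
  | o => exact ⟨wt', h.2.congr fun σ hσ => (e σ hσ).lr.2.2.symm⟩
  | arr A B _ ih =>
    refine ⟨wt', fun Δ ρ u hρ hu => ?_⟩
    refine ih (h.2 Δ ρ u hρ hu) ((wt'.rename hρ).app hu.wt) fun σ hσ => ?_
    simp only [Tm.subst, Tm.subst_rename]
    exact (e _ (hρ.isSub_comp hσ)).app (.refl (hu.wt.subst hσ))

/-- Simultaneous induction on the type. Reflection at ground type is exactly `rep_apps`. Each half
at an arrow type needs the other half at the domain: arguments of neutral terms must be reified, and
reification applies a term to a fresh variable, which is computable by reflection. -/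
theorem reflect_reify (C : Finset ℕ) (A : Ty) :
    (∀ Γ t, Neutral C Γ t A → Good C A Γ t) ∧
    (∀ Γ t, Good C A Γ t → ∃ t', HCell C Γ t' A ∧ Eqv C Γ A t t') := by
  induction A with
  | o =>
    constructor
    · rintro Γ t ⟨wt, y, Bs, us, hy, hus, e⟩
      rw [← Ty.arrs_eq_foldr] at hy
      exact ⟨wt, (rep_apps hy hus).congr fun σ hσ => (e σ hσ).lr.2.2⟩
    · rintro Γ t ⟨wt, b, hb, e⟩
      exact ⟨b, hb, fun σ hσ => (e σ hσ).obsEquiv (wt.subst hσ) (hb.wt.subst hσ)⟩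
  | arr A B ihA ihB =>
    constructor
    · rintro Γ t ⟨wt, y, Bs, us, hy, hus, e⟩
      refine ⟨wt, fun Δ ρ u hρ hu => ?_⟩
      obtain ⟨u', hu', e'⟩ := ihA.2 Δ u hu
      refine ihB.1 _ _ ⟨(wt.rename hρ).app hu.wt, ρ y, Bs ++ [A], us.map (Tm.rename ρ) ++ [u'],
        ?_, ?_, fun σ hσ => ?_⟩
      · rw [List.foldr_append]
        exact hρ _ _ hy
      · refine List.rel_append ?_ (.cons hu' .nil)
        rw [List.forall₂_map_left_iff]
        exact hus.imp fun _ _ h => h.rename hρ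
      · have h1 := (e _ (hρ.isSub_comp hσ)).app (e' σ hσ)
        have h2 : ((Tm.var (ρ y)).apps (us.map (Tm.rename ρ) ++ [u'])).subst σ =
            Tm.app (((Tm.var y).apps us).subst (σ ∘ ρ)) (u'.subst σ) := by
          rw [Tm.apps_append, ← Tm.subst_rename, Tm.apps_rename]
          rfl
        rw [h2]
        simp only [Tm.subst, Tm.subst_rename]
        exact h1
    · intro Γ t ht
      have h0 : Good C A (A :: Γ) (Tm.var 0) := by
        refine ihA.1 _ _ ⟨.var rfl, 0, [], [], rfl, .nil, fun σ hσ => .refl ?_⟩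
        exact hσ 0 A rfl
      obtain ⟨b, hb, e⟩ := ihB.2 _ _ (ht.2 (A :: Γ) Nat.succ (Tm.var 0) (IsRen.succ Γ A) h0)
      refine ⟨Tm.lam A b, .lam hb, fun σ hσ => ?_⟩
      have w1 := ht.wt.subst hσ
      have w2 := hb.wt.lam.subst hσ
      refine ⟨w1, w2, fun u hu => ?_⟩
      have h1 := e (consSubst u σ) (hσ.cons hu)
      simp only [Tm.subst, Tm.subst_rename] at h1
      exact h1.trans ((BetaEq.beta_subst A b u σ).symm.obsEquiv h1.right (w2.app hu))

theorem WT.good (h : WT C Γ t A) {σ : ℕ → Tm}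
    (hσ : ∀ (i : ℕ) (B : Ty), Γ[i]? = some B → Good C B Δ (σ i)) : Good C A Δ (t.subst σ) := by
  revert Δ σ
  refine WT.rec (P := fun Γ t A => ∀ {Δ σ}, (∀ (i : ℕ) (B : Ty), Γ[i]? = some B →
    Good C B Δ (σ i)) → Good C A Δ (t.subst σ)) ?_ ?_ ?_ ?_ h
  · intro Γ i A hi Δ σ hσ; exact hσ i A hi
  · intro Γ c hc Δ σ _; exact ⟨.const hc, _, .const hc, fun _ _ => .refl _⟩
  · intro Γ s t A B _ _ ih ih' Δ σ hσ
    have := (ih hσ).2 Δ id _ (fun _ _ h => h) (ih' hσ)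
    rwa [Tm.rename_id] at this
  · intro Γ t A B wt ih Δ σ hσ
    have hsub : IsSub C σ Γ Δ := fun i B hi => (hσ i B hi).wt
    refine ⟨wt.lam.subst hsub, fun Θ ρ u hρ hu => ?_⟩
    have h1 : Good C B Θ (t.subst (consSubst u fun i => (σ i).rename ρ)) := by
      refine ih fun i D hi => ?_
      cases i with
      | zero => simp at hi; exact hi ▸ hu
      | succ i => exact (hσ i D hi).rename hρ
    have w := ((wt.lam.subst hsub).rename hρ).app hu.wt
    refine h1.congr w fun τ hτ => ?_
    rw [Tm.rename_subst] at w ⊢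
    exact ((BetaEq.beta_subst A t u _).subst τ).symm.obsEquiv (h1.wt.subst hτ) (w.subst hτ)

/-- Every closed term is observationally equivalent to a hereditary cellular term. -/
theorem WT.exists_hCell (h : WT C [] t A) : ∃ t', HCell C [] t' A ∧ ObsEquiv C A t t' := by
  have h1 : Good C A [] (t.subst Tm.var) := h.good (by simp)
  rw [Tm.subst_var] at h1
  obtain ⟨t', ht', e⟩ := (reflect_reify C A).2 _ _ h1
  have := e Tm.var (IsSub.nil _ _)
  rw [Tm.subst_var, Tm.subst_var] at this
  exact ⟨t', ht', this⟩

end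

/-! ### An abstract machine -/

/-- The environment `e` extended by the closure `c`; environments are coded as terms. -/
def extEnv (c : Tm × Tm) (e : Tm) : Tm := Tm.app (Tm.app c.1 c.2) e

/-- The substitution described by an environment. -/
def envSubst : Tm → ℕ → Tm
  | Tm.app (Tm.app t e) _, 0 => t.subst (envSubst e)
  | Tm.app (Tm.app _ _) r, i + 1 => envSubst r i
  | _, i => Tm.var i

theorem envSubst_extEnv (c : Tm × Tm) (e : Tm) :
    envSubst (extEnv c e) = consSubst (c.1.subst (envSubst c.2)) (envSubst e) := by
  funext i
  cases i <;> simp [extEnv, envSubst, consSubst]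

theorem envSubst_const (a : ℕ) : envSubst (Tm.const a) = Tm.var := by
  funext i
  cases i <;> simp [envSubst]

/-- `Run t e S a`: the machine started on the term `t` in the environment `e` with the stack `S`
stops at the constant `a`. -/
inductive Run : Tm → Tm → List (Tm × Tm) → ℕ → Prop
  | const (a : ℕ) (e : Tm) : Run (Tm.const a) e [] a
  | app {s u e : Tm} {S : List (Tm × Tm)} {a : ℕ} :
      Run s e ((u, e) :: S) a → Run (Tm.app s u) e S a
  | lam {A : Ty} {t e : Tm} {c : Tm × Tm} {S : List (Tm × Tm)} {a : ℕ} :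
      Run t (extEnv c e) S a → Run (Tm.lam A t) e (c :: S) a
  | zero {c : Tm × Tm} {e : Tm} {S : List (Tm × Tm)} {a : ℕ} :
      Run c.1 c.2 S a → Run (Tm.var 0) (extEnv c e) S a
  | succ {i : ℕ} {c : Tm × Tm} {e : Tm} {S : List (Tm × Tm)} {a : ℕ} :
      Run (Tm.var i) e S a → Run (Tm.var (i + 1)) (extEnv c e) S a

/-- Soundness of the machine, closures being read back as substitution instances. The machine
replaces conversion by rules without substitution, for which enumerability is easy to check. -/
theorem Run.betaEq {t e : Tm} {S : List (Tm × Tm)} {a : ℕ} (h : Run t e S a) :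
    BetaEq ((t.subst (envSubst e)).apps (S.map fun c => c.1.subst (envSubst c.2)))
      (Tm.const a) := by
  induction h with
  | const a e => exact .refl _
  | app _ ih => exact ih
  | @lam A t e c S a _ ih =>
    rw [envSubst_extEnv] at ih
    exact ((BetaEq.beta_subst A t _ _).apps _).trans ih
  | zero _ ih => rwa [envSubst_extEnv]
  | succ _ ih => rwa [envSubst_extEnv]

/-- The stacks for which every computable closure of type `A` stops. -/
def GoodStack : Ty → List (Tm × Tm) → Prop
  | Ty.o, S => S = []
  | Ty.arr A B, S => ∃ c S', S = c :: S' ∧ (∀ S'', GoodStack A S'' → ∃ a, Run c.1 c.2 S'' a) ∧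
      GoodStack B S'

/-- Computable closures. -/
def GoodClosure (A : Ty) (c : Tm × Tm) : Prop := ∀ S, GoodStack A S → ∃ a, Run c.1 c.2 S a

/-- Environments all of whose closures are computable. -/
inductive GoodEnv : List Ty → Tm → Prop
  | nil (e : Tm) : GoodEnv [] e
  | cons {A : Ty} {Γ : List Ty} {c : Tm × Tm} {e : Tm} :
      GoodClosure A c → GoodEnv Γ e → GoodEnv (A :: Γ) (extEnv c e)

/-- Termination by computability in orthogonal form: a closure is good when it stops against all
good stacks, and a good stack at an arrow type is a good closure pushed on a good stack. -/
theorem HasType.goodClosure {Γ : List Ty} {t : Tm} {A : Ty} (h : HasType Γ t A) {e : Tm}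
    (he : GoodEnv Γ e) : GoodClosure A (t, e) := by
  induction h generalizing e with
  | @var Γ i A hi =>
    intro S hS
    induction he generalizing i with
    | nil e => simp at hi
    | cons hc _ ih =>
      cases i with
      | zero =>
        obtain rfl : _ = A := by simpa using hi
        obtain ⟨a, ha⟩ := hc S hS
        exact ⟨a, .zero ha⟩
      | succ i =>
        obtain ⟨a, ha⟩ := ih (i := i) (by simpa using hi)
        exact ⟨a, .succ ha⟩
  | @const Γ c =>
    intro S hS
    obtain rfl : S = [] := hS
    exact ⟨c, .const c e⟩
  | @app Γ s t A B _ _ ih ih' =>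
    intro S hS
    obtain ⟨a, ha⟩ := ih he ((t, e) :: S) ⟨_, _, rfl, ih' he, hS⟩
    exact ⟨a, .app ha⟩
  | @lam Γ t A B _ ih =>
    rintro S ⟨c, S', rfl, hc, hS'⟩
    obtain ⟨a, ha⟩ := ih (.cons hc he) S' hS'
    exact ⟨a, .lam ha⟩

/-- The closed term `t` evaluates to the constant `a`. -/
def Halts (t : Tm) (a : ℕ) : Prop := Run t (Tm.const 0) [] a

theorem Halts.betaEq {t : Tm} {a : ℕ} (h : Halts t a) : BetaEq t (Tm.const a) := by
  have := Run.betaEq h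
  rwa [envSubst_const, Tm.subst_var] at this

section

variable {C : Finset ℕ} {A B : Ty} {As Bs : List Ty} {t u : Tm} {us vs : List Tm}

theorem WT.halts (h : WT C [] t Ty.o) {a : ℕ} (e : BetaEq t (Tm.const a)) : Halts t a := by
  obtain ⟨b, hb⟩ := h.1.goodClosure (.nil (Tm.const 0)) [] rfl
  have hb' : Halts t b := hb
  obtain rfl := (hb'.betaEq.symm.trans e).const_inj
  exact hb

theorem WT.exists_halts (h : WT C [] t Ty.o) : ∃ a ∈ C, Halts t a := by
  obtain ⟨a, ha, e⟩ := h.exists_betaEq_const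
  exact ⟨a, ha, h.halts e⟩

/-- `t` and `u` evaluate to the same constant. -/
def SameValue (t u : Tm) : Prop := ∃ a, Halts t a ∧ Halts u a

theorem SameValue.betaEq (h : SameValue t u) : BetaEq t u := by
  obtain ⟨a, h1, h2⟩ := h
  exact h1.betaEq.trans h2.betaEq.symm

theorem BetaEq.sameValue (e : BetaEq t u) (ht : WT C [] t Ty.o) (hu : WT C [] u Ty.o) :
    SameValue t u := by
  obtain ⟨a, -, h⟩ := ht.exists_halts
  exact ⟨a, h, hu.halts (e.symm.trans h.betaEq)⟩

/-! ### Vectors of closed terms -/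

/-- Componentwise observational equivalence. -/
inductive VecObs (C : Finset ℕ) : List Ty → List Tm → List Tm → Prop
  | nil : VecObs C [] [] []
  | cons {A : Ty} {As : List Ty} {u v : Tm} {us vs : List Tm} : ObsEquiv C A u v →
      VecObs C As us vs → VecObs C (A :: As) (u :: us) (v :: vs)

/-- Closed terms of the given types. -/
abbrev VecWT (C : Finset ℕ) (us : List Tm) (As : List Ty) : Prop :=
  List.Forall₂ (fun u A => WT C [] u A) us As

theorem VecObs.refl (h : VecWT C us As) : VecObs C As us us := by
  induction h with
  | nil => exact .nil
  | cons h _ ih => exact .cons (.refl h) ih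

theorem VecObs.left (h : VecObs C As us vs) : VecWT C us As := by
  induction h with
  | nil => exact .nil
  | cons h _ ih => exact .cons h.left ih

theorem VecObs.symm (h : VecObs C As us vs) : VecObs C As vs us := by
  induction h with
  | nil => exact .nil
  | cons h _ ih => exact .cons h.symm ih

theorem VecObs.getElem? (h : VecObs C As us vs) {i : ℕ} (hA : As[i]? = some A) :
    ∃ u v, us[i]? = some u ∧ vs[i]? = some v ∧ ObsEquiv C A u v := by
  induction h generalizing i with
  | nil => simp at hA
  | cons h _ ih =>
    cases i with
    | zero =>
      obtain rfl : _ = A := by simpa using hA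
      exact ⟨_, _, rfl, rfl, h⟩
    | succ i => exact ih hA

theorem ObsEquiv.apps (h : ObsEquiv C (As.foldr Ty.arr A) t u) (hv : VecObs C As us vs) :
    ObsEquiv C A (t.apps us) (u.apps vs) := by
  induction hv generalizing t u with
  | nil => exact h
  | cons h' _ ih => exact ih (h.app h')

theorem obsEquiv_arrs_iff : ObsEquiv C (Ty.arrs As) t u ↔
    WT C [] t (Ty.arrs As) ∧ WT C [] u (Ty.arrs As) ∧
      ∀ us, VecWT C us As → BetaEq (t.apps us) (u.apps us) := by
  constructor
  · intro h
    refine ⟨h.left, h.right, fun us hus => ?_⟩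
    rw [Ty.arrs_eq_foldr] at h
    exact (h.apps (.refl hus)).lr.2.2
  · rintro ⟨ht, hu, h⟩
    induction As generalizing t u with
    | nil => exact ⟨ht, hu, h [] .nil⟩
    | cons A As ih =>
      exact ⟨ht, hu, fun v hv => ih (ht.app hv) (hu.app hv)
        fun us hus => h (v :: us) (.cons hv hus)⟩

/-- A list of closed terms which represents every class. -/
def Complete (C : Finset ℕ) (A : Ty) (L : List Tm) : Prop :=
  (∀ r ∈ L, WT C [] r A) ∧ ∀ t, WT C [] t A → ∃ r ∈ L, ObsEquiv C A t r

/-- A list of vectors of closed terms which represents every class. -/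
def VecComplete (C : Finset ℕ) (As : List Ty) (V : List (List Tm)) : Prop :=
  (∀ us ∈ V, VecWT C us As) ∧ ∀ us, VecWT C us As → ∃ vs ∈ V, VecObs C As us vs

/-- Terms respect equivalence of their arguments, so the finitely many test vectors in `V` decide.
-/
theorem VecComplete.obsEquiv_iff {V : List (List Tm)} (hV : VecComplete C As V) :
    ObsEquiv C (Ty.arrs As) t u ↔ WT C [] t (Ty.arrs As) ∧ WT C [] u (Ty.arrs As) ∧
      ∀ us ∈ V, SameValue (t.apps us) (u.apps us) := by
  rw [obsEquiv_arrs_iff]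
  refine and_congr_right fun ht => and_congr_right fun hu => ⟨fun h us hus => ?_, fun h us hus => ?_⟩
  · rw [Ty.arrs_eq_foldr] at ht hu
    exact (h us (hV.1 us hus)).sameValue (ht.apps (hV.1 us hus)) (hu.apps (hV.1 us hus))
  · obtain ⟨vs, hvs, e⟩ := hV.2 us hus
    have h1 := (ObsEquiv.refl ht)
    have h2 := (ObsEquiv.refl hu)
    rw [Ty.arrs_eq_foldr] at h1 h2
    exact ((h1.apps e).lr.2.2.trans (h vs hvs).betaEq).trans (h2.apps e).lr.2.2.symm

/-! ### Finiteness of the minimal model -/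

/-- Observational equivalence as a setoid on closed terms. -/
def obsSetoid (C : Finset ℕ) (A : Ty) : Setoid { t : Tm // WT C [] t A } where
  r t u := ObsEquiv C A t.1 u.1
  iseqv := ⟨fun t => .refl t.2, fun h => h.symm, fun h h' => h.trans h'⟩

/-- Ground classes inject into `C`, and a class at `A → B` is determined by the function it induces
between the quotients. The argument is not effective; it is used only to show that certificates
exist. -/
theorem finite_classes (C : Finset ℕ) (A : Ty) : Finite (Quotient (obsSetoid C A)) := by
  induction A with
  | o =>
    have h : ∀ t : { t : Tm // WT C [] t Ty.o }, ∃ a : C, BetaEq t.1 (Tm.const a) := by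
      intro t
      obtain ⟨a, ha, e⟩ := t.2.exists_betaEq_const
      exact ⟨⟨a, ha⟩, e⟩
    choose f hf using h
    refine Finite.of_injective (fun q : Quotient (obsSetoid C Ty.o) => f q.out) fun q q' hq => ?_
    rw [← q.out_eq, ← q'.out_eq]
    refine Quotient.sound (s := obsSetoid C Ty.o) ⟨q.out.2, q'.out.2, (hf _).trans ?_⟩
    have hq' : f q.out = f q'.out := hq
    rw [hq']
    exact (hf _).symm
  | arr A B _ _ =>
    refine Finite.of_injective (fun (q : Quotient (obsSetoid C (Ty.arr A B)))
      (p : Quotient (obsSetoid C A)) => (⟦⟨Tm.app q.out.1 p.out.1, q.out.2.app p.out.2⟩⟧ :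
        Quotient (obsSetoid C B))) fun q q' hq => ?_
    rw [← q.out_eq, ← q'.out_eq]
    refine Quotient.sound (s := obsSetoid C (Ty.arr A B)) ⟨q.out.2, q'.out.2, fun u hu => ?_⟩
    have h1 : ObsEquiv C A u (⟦⟨u, hu⟩⟧ : Quotient (obsSetoid C A)).out.1 :=
      (Quotient.exact (s := obsSetoid C A) (Quotient.out_eq ⟦⟨u, hu⟩⟧)).symm
    have h2 : ObsEquiv C B _ _ := Quotient.exact (s := obsSetoid C B)
      (congrFun hq (⟦⟨u, hu⟩⟧ : Quotient (obsSetoid C A)))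
    exact (((ObsEquiv.refl q.out.2).app h1).trans h2).trans ((ObsEquiv.refl q'.out.2).app h1.symm)

theorem exists_complete (C : Finset ℕ) (A : Ty) : ∃ L, Complete C A L := by
  have := finite_classes C A
  have := Fintype.ofFinite (Quotient (obsSetoid C A))
  refine ⟨(Finset.univ : Finset (Quotient (obsSetoid C A))).toList.map fun q => q.out.1, ?_, ?_⟩
  · intro r hr
    obtain ⟨q, -, rfl⟩ := List.mem_map.1 hr
    exact q.out.2
  · intro t ht
    refine ⟨(⟦⟨t, ht⟩⟧ : Quotient (obsSetoid C A)).out.1, List.mem_map.2 ⟨_, by simp, rfl⟩, ?_⟩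
    exact (Quotient.exact (s := obsSetoid C A) (Quotient.out_eq ⟦⟨t, ht⟩⟧)).symm

/-! ### Iterated abstraction -/

/-- `λ x₁ … xₙ. t` with `xᵢ` of the `i`-th type of the list. -/
def Tm.lams : List Ty → Tm → Tm
  | [], t => t
  | A :: As, t => Tm.lam A (Tm.lams As t)

/-- The substitution for the `n` innermost variables by the list `us`, the last element of which
is substituted for the index `0`. -/
def consAll : List Tm → (ℕ → Tm) → ℕ → Tm
  | [], σ => σ
  | u :: us, σ => consAll us (consSubst u σ)

theorem consAll_add (us : List Tm) (σ : ℕ → Tm) (m : ℕ) :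
    consAll us σ (m + us.length) = σ m := by
  induction us generalizing σ m with
  | nil => rfl
  | cons u us ih =>
    rw [List.length_cons, ← add_assoc, add_right_comm]
    exact ih _ _

/-- List positions and de Bruijn indices run in opposite directions: the first argument is bound
outermost and has the highest index. -/
theorem consAll_apply (us : List Tm) (σ : ℕ → Tm) {i j : ℕ} (h : i + j + 1 = us.length) :
    us[i]? = some (consAll us σ j) := by
  induction us generalizing σ i j with
  | nil => simp at h
  | cons u us ih =>
    rw [List.length_cons] at h
    cases i with
    | succ i => exact ih _ (by omega)
    | zero =>
      obtain rfl : j = 0 + us.length := by omega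
      simp only [List.getElem?_cons_zero, consAll, consAll_add, consSubst]

theorem WT.lams {Γ : List Ty} (h : WT C (As.reverseAux Γ) t A) :
    WT C Γ (Tm.lams As t) (As.foldr Ty.arr A) := by
  induction As generalizing Γ with
  | nil => exact h
  | cons B As ih => exact (ih h).lam

theorem isSub_consAll {Γ : List Ty} {σ : ℕ → Tm} (hσ : IsSub C σ Γ []) (h : VecWT C us As) :
    IsSub C (consAll us σ) (As.reverseAux Γ) [] := by
  induction h generalizing σ Γ with
  | nil => exact hσ
  | cons h _ ih => exact ih (hσ.cons h)

theorem BetaEq.lams_apps (σ : ℕ → Tm) (h : us.length = As.length) :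
    BetaEq (((Tm.lams As t).subst σ).apps us) (t.subst (consAll us σ)) := by
  induction As generalizing us σ with
  | nil =>
    obtain rfl := List.length_eq_zero_iff.1 h
    exact .refl _
  | cons A As ih =>
    cases us with
    | nil => simp at h
    | cons u us =>
      exact ((BetaEq.beta_subst A _ u σ).apps us).trans (ih _ (by simpa using h))

theorem HCell.exists_body {Γ : List Ty} (h : HCell C Γ t (Ty.arrs As)) :
    ∃ b, HCell C (As.reverseAux Γ) b Ty.o ∧ t = Tm.lams As b := by
  induction As generalizing Γ t with
  | nil => exact ⟨t, h, rfl⟩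
  | cons A As ih =>
    cases h with
    | lam h =>
      obtain ⟨b, hb, rfl⟩ := ih h
      exact ⟨b, hb, rfl⟩

end

/-! ### Certificates of completeness -/

/-- The type `o → ⋯ → o → B` with one argument for each element of `L`. -/
def holeTy (L : List Tm) (B : Ty) : Ty := (L.map fun _ => Ty.o).foldr Ty.arr B

/-- A finitary proof system for the completeness of lists of vectors of closed terms. -/
inductive Cert (C : Finset ℕ) : List Ty → List (List Tm) → Prop
  | nil : Cert C [] [[]]
  | cons {A : Ty} {As : List Ty} {U V : List (List Tm)} : Cert C [A] U → Cert C As V →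
      Cert C (A :: As) (U.flatMap fun us => V.map fun vs => us ++ vs)
  -- For each argument type `Ty.arrs p.1`, the list `p.2` contains, up to equivalence, all vectors
  -- of closed contexts whose holes are indexed by `L`. The last two premises say that `L` contains
  -- the constant functions and is closed under the cells built from these contexts, as tested on
  -- `V`.
  | cells {ps : List (List Ty × List (List Tm))} {L : List Tm} {V : List (List Tm)} :
      Cert C (ps.map fun p => Ty.arrs p.1) V →
      (∀ p ∈ ps, Cert C (p.1.map (holeTy L)) p.2) →
      (∀ r ∈ L, WT C [] r (Ty.arrs (ps.map fun p => Ty.arrs p.1))) →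
      (∀ a ∈ C, ∃ r ∈ L, ∀ us ∈ V, Halts (r.apps us) a) →
      (∀ i < ps.length, ∀ ms ∈ (ps.getD i ([], [])).2, ∃ r ∈ L, ∀ us ∈ V,
        SameValue (r.apps us) ((us.getD i (Tm.const 0)).apps
          (ms.map fun m => m.apps (L.map fun r => r.apps us)))) →
      Cert C [Ty.arrs (ps.map fun p => Ty.arrs p.1)] (L.map fun r => [r])

theorem Ty.arrs_injective {As Bs : List Ty} (h : Ty.arrs As = Ty.arrs Bs) : As = Bs := by
  induction As generalizing Bs with
  | nil =>
    cases Bs with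
    | nil => rfl
    | cons => cases h
  | cons A As ih =>
    cases Bs with
    | nil => cases h
    | cons B Bs =>
      simp only [Ty.arrs, Ty.arr.injEq] at h
      rw [h.1, ih h.2]

section

variable {C : Finset ℕ} {A B : Ty} {As Bs : List Ty} {t u : Tm} {us vs : List Tm}

theorem vecComplete_singleton {L : List Tm} :
    VecComplete C [A] (L.map fun r => [r]) ↔ Complete C A L := by
  constructor
  · rintro ⟨h1, h2⟩
    refine ⟨fun r hr => ?_, fun t ht => ?_⟩
    · have := h1 [r] (List.mem_map.2 ⟨r, hr, rfl⟩)
      simpa [VecWT] using this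
    · obtain ⟨vs, hvs, e⟩ := h2 [t] (.cons ht .nil)
      obtain ⟨r, hr, rfl⟩ := List.mem_map.1 hvs
      cases e with
      | cons e _ => exact ⟨r, hr, e⟩
  · rintro ⟨h1, h2⟩
    refine ⟨fun us hus => ?_, fun us hus => ?_⟩
    · obtain ⟨r, hr, rfl⟩ := List.mem_map.1 hus
      exact .cons (h1 r hr) .nil
    · cases hus with
      | cons ht h =>
        cases h
        obtain ⟨r, hr, e⟩ := h2 _ ht
        exact ⟨[r], List.mem_map.2 ⟨r, hr, rfl⟩, .cons e .nil⟩

theorem VecComplete.cons {U V : List (List Tm)} (hU : VecComplete C [A] U)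
    (hV : VecComplete C As V) :
    VecComplete C (A :: As) (U.flatMap fun us => V.map fun vs => us ++ vs) := by
  refine ⟨fun us hus => ?_, fun us hus => ?_⟩
  · obtain ⟨us, hu, hus⟩ := List.mem_flatMap.1 hus
    obtain ⟨vs, hv, rfl⟩ := List.mem_map.1 hus
    exact List.rel_append (hU.1 us hu) (hV.1 vs hv)
  · cases hus with
    | @cons t _ us _ ht hus =>
      obtain ⟨us', hus', e⟩ := hU.2 [t] (.cons ht .nil)
      obtain ⟨vs', hvs', e'⟩ := hV.2 us hus
      refine ⟨us' ++ vs', List.mem_flatMap.2 ⟨_, hus', List.mem_map.2 ⟨_, hvs', rfl⟩⟩, ?_⟩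
      cases e with
      | cons e h => cases h; exact .cons e e'

theorem vecObs_ground {l : List Tm} {f g : Tm → Tm}
    (h : ∀ r ∈ l, ObsEquiv C Ty.o (f r) (g r)) :
    VecObs C (l.map fun _ => Ty.o) (l.map f) (l.map g) := by
  induction l with
  | nil => exact .nil
  | cons r l ih =>
    exact .cons (h r List.mem_cons_self) (ih fun x hx => h x (List.mem_cons_of_mem _ hx))

theorem vecObs_of_getElem? (h1 : us.length = As.length) (h2 : vs.length = As.length)
    (h : ∀ (j : ℕ) (u v : Tm) (A : Ty), us[j]? = some u → vs[j]? = some v → As[j]? = some A →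
      ObsEquiv C A u v) : VecObs C As us vs := by
  induction As generalizing us vs with
  | nil =>
    obtain rfl := List.length_eq_zero_iff.1 h1
    obtain rfl := List.length_eq_zero_iff.1 h2
    exact .nil
  | cons A As ih =>
    cases us with
    | nil => simp at h1
    | cons u us =>
      cases vs with
      | nil => simp at h2
      | cons v vs =>
        exact .cons (h 0 u v A rfl rfl rfl) (ih (by simpa using h1) (by simpa using h2)
          fun j u v A hu hv hA => h (j + 1) u v A hu hv hA)

theorem getElem?_reverse_ctx {y : ℕ} (h : (As.reverseAux [])[y]? = some A) :
    ∃ i, i + y + 1 = As.length ∧ As[i]? = some A := by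
  have h' : As.reverse[y]? = some A := h
  obtain ⟨hy, rfl⟩ := List.getElem?_eq_some_iff.1 h'
  rw [List.length_reverse] at hy
  refine ⟨As.length - 1 - y, by omega, ?_⟩
  rw [List.getElem_reverse, List.getElem?_eq_getElem]

/-- The abstraction of the holes of a closed context, the `k`-th hole being identified with the
variable `idx k` of a list of `K` ground variables. -/
theorem exists_hole_abstraction {L ws : List Tm} {c : Tm}
    (hc : WT C (List.replicate ws.length Ty.o) c B) (R : Tm → Tm → Prop)
    (hR : ∀ w ∈ ws, ∃ r ∈ L, R w r) :
    ∃ d, WT C [] d (holeTy L B) ∧ ∀ f g : Tm → Tm,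
      (∀ r ∈ L, WT C [] (f r) Ty.o) → (∀ w ∈ ws, ∀ r ∈ L, R w r → ObsEquiv C Ty.o (f r) (g w)) →
      ObsEquiv C B (d.apps (L.map f)) (c.fill (ws.map g)) := by
  -- A hole with content `w` is assigned to some `r = L[i]` related to `w`, and `j` is the de Bruijn
  -- index of the `i`-th abstracted variable. Several holes may share a variable.
  have h : ∀ w ∈ ws, ∃ j, ∃ r, ∃ i, i + j + 1 = L.length ∧ L[i]? = some r ∧ R w r := by
    intro w hw
    obtain ⟨r, hr, h⟩ := hR w hw
    obtain ⟨i, hi, rfl⟩ := List.getElem_of_mem hr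
    exact ⟨L.length - 1 - i, _, i, by omega, List.getElem?_eq_getElem hi, h⟩
  obtain ⟨js, hjs⟩ := exists_forall₂ h
  have hlen : (js.map Tm.var).length = ws.length := by simpa using hjs.length_eq.symm
  set K := L.map fun _ => Ty.o with hK
  have hKrep : K = List.replicate L.length Ty.o := by
    rw [hK, List.map_const']
  have hctx : K.reverseAux [] = List.replicate L.length Ty.o := by
    rw [hKrep, List.reverseAux_eq, List.reverse_replicate, List.append_nil]
  have hvars : ∀ w ∈ js.map Tm.var, WT C (K.reverseAux []) w Ty.o := by
    intro w hw
    obtain ⟨j, hj, rfl⟩ := List.mem_map.1 hw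
    refine WT.var ?_
    rw [hctx, List.getElem?_replicate, if_pos]
    exact forall_mem_right_of_forall₂ hjs (P := fun j => j < L.length)
      (fun _ _ h => by obtain ⟨r, i, h, -⟩ := h; omega) j hj
  have hc' : WT C (List.replicate (js.map Tm.var).length Ty.o) c B := hlen ▸ hc
  have hd := (hc'.fill hvars).lams
  refine ⟨_, hd, fun f g hf hfg => ?_⟩
  have hfw : VecWT C (L.map f) K := (vecObs_ground fun r hr => .refl (hf r hr)).left
  have e1 := BetaEq.lams_apps (us := L.map f) (As := K) (t := c.fill (js.map Tm.var)) Tm.var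
    (by simp [hK])
  rw [Tm.subst_var] at e1
  have hsub := isSub_consAll (IsSub.nil Tm.var []) hfw
  have w1 : WT C [] ((Tm.lams K (c.fill (js.map Tm.var))).apps (L.map f)) B := hd.apps hfw
  refine (e1.obsEquiv w1 ((hc'.fill hvars).subst hsub)).trans ?_
  rw [Tm.fill_subst hc'.1 rfl]
  refine LR.obs (hc'.lr_betaEq ?_)
  have hrel : List.Forall₂ (LR C BetaEq Ty.o)
      ((js.map Tm.var).map (Tm.subst (consAll (L.map f) Tm.var))) (ws.map g) := by
    rw [List.map_map, List.forall₂_map_left_iff, List.forall₂_map_right_iff]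
    refine List.forall₂_iff_get.2 ⟨hjs.length_eq.symm, fun k h1 h2 => ?_⟩
    obtain ⟨r, i, hij, hr, hwr⟩ := hjs.get h2 h1
    have e := consAll_apply (L.map f) Tm.var (i := i) (j := js.get ⟨k, h1⟩) (by simpa using hij)
    rw [List.getElem?_map, hr] at e
    have e' : consAll (L.map f) Tm.var (js.get ⟨k, h1⟩) = f r := (Option.some.inj e).symm
    refine ObsEquiv.lr ?_
    change ObsEquiv C Ty.o (consAll (L.map f) Tm.var (js.get ⟨k, h1⟩)) (g (ws.get ⟨k, h2⟩))
    rw [e']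
    exact hfg _ (List.get_mem _ _) r (List.mem_of_getElem? hr) hwr
  have := lrSub_fill hrel
  rwa [List.length_map] at this

/-- The main step in the soundness of certificates: the functions represented by `L` are closed
under cells. -/
theorem HCell.exists_representative {ps : List (List Ty × List (List Tm))} {L : List Tm}
    {V : List (List Tm)} {b : Tm}
    (hAs : As = ps.map fun p => Ty.arrs p.1)
    (hV : VecComplete C As V) (hM : ∀ p ∈ ps, VecComplete C (p.1.map (holeTy L)) p.2)
    (hL : ∀ r ∈ L, WT C [] r (Ty.arrs As))
    (hconst : ∀ a ∈ C, ∃ r ∈ L, ∀ us ∈ V, Halts (r.apps us) a)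
    (hcell : ∀ i < ps.length, ∀ ms ∈ (ps.getD i ([], [])).2, ∃ r ∈ L, ∀ us ∈ V,
        SameValue (r.apps us) ((us.getD i (Tm.const 0)).apps
          (ms.map fun m => m.apps (L.map fun r => r.apps us))))
    (hb : HCell C (As.reverseAux []) b Ty.o) :
    ∃ r ∈ L, ∀ us, VecWT C us As → BetaEq (r.apps us) (b.subst (consAll us Tm.var)) := by
  have hLo : ∀ r ∈ L, ∀ us vs, VecObs C As us vs → ObsEquiv C Ty.o (r.apps us) (r.apps vs) := by
    intro r hr us vs h
    have := ObsEquiv.refl (hL r hr)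
    rw [Ty.arrs_eq_foldr] at this
    exact this.apps h
  generalize hΓ : As.reverseAux [] = Γ at hb
  generalize hT : Ty.o = T at hb
  induction hb with
  | @const Γ a ha =>
    obtain ⟨r, hr, h⟩ := hconst a ha
    refine ⟨r, hr, fun us hus => ?_⟩
    obtain ⟨vs, hvs, e⟩ := hV.2 us hus
    exact (hLo r hr us vs e).lr.2.2.trans (h vs hvs).betaEq
  | lam => cases hT
  | @cell Γ y Bs cs ws hy hl hc hw _ ih =>
    subst hΓ
    have ih' : ∀ w ∈ ws, ∃ r ∈ L, ∀ us, VecWT C us As →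
        BetaEq (r.apps us) (w.subst (consAll us Tm.var)) := fun w hw => ih w hw rfl rfl
    obtain ⟨i, hi, hAi⟩ := getElem?_reverse_ctx hy
    have hilt : i < ps.length := by
      have := congrArg List.length hAs
      rw [List.length_map] at this
      omega
    have hps : ps.getD i ([], []) = ps[i] := by simp [List.getD, hilt]
    have hBs : ps[i].1 = Bs := by
      refine Ty.arrs_injective ?_
      rw [hAs, List.getElem?_map, List.getElem?_eq_getElem hilt] at hAi
      exact Option.some.inj hAi
    have hIC : IsCell C ws.length cs Bs := ⟨hl, fun j c B h1 h2 => (hc j c B h1 h2).wt⟩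
    -- By induction each content agrees with an element of `L`, so each context of the cell becomes
    -- a closed term of type `holeTy L B`.
    obtain ⟨ds, hds⟩ := exists_forall₂ (l := cs.zip Bs)
      (R := fun (p : Tm × Ty) d => WT C [] d (holeTy L p.2) ∧ ∀ f g : Tm → Tm,
        (∀ r ∈ L, WT C [] (f r) Ty.o) →
        (∀ w ∈ ws, ∀ r ∈ L, (∀ us, VecWT C us As →
          BetaEq (r.apps us) (w.subst (consAll us Tm.var))) → ObsEquiv C Ty.o (f r) (g w)) →
        ObsEquiv C p.2 (d.apps (L.map f)) (p.1.fill (ws.map g))) (by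
      rintro ⟨c, B⟩ hp
      obtain ⟨j, hj⟩ := List.getElem?_of_mem hp
      rw [List.getElem?_zip_eq_some] at hj
      exact exists_hole_abstraction (hIC.2 j c B hj.1 hj.2) _ ih')
    have hdlen : ds.length = Bs.length := by
      have := hds.length_eq
      rw [List.length_zip, hl, min_self] at this
      exact this.symm
    have hdj : ∀ (j : ℕ) (c d : Tm) (B : Ty), cs[j]? = some c → ds[j]? = some d →
        Bs[j]? = some B → WT C [] d (holeTy L B) ∧ ∀ f g : Tm → Tm,
        (∀ r ∈ L, WT C [] (f r) Ty.o) →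
        (∀ w ∈ ws, ∀ r ∈ L, (∀ us, VecWT C us As →
          BetaEq (r.apps us) (w.subst (consAll us Tm.var))) → ObsEquiv C Ty.o (f r) (g w)) →
        ObsEquiv C B (d.apps (L.map f)) (c.fill (ws.map g)) := by
      intro j c d B h1 h2 h3
      have hz : (cs.zip Bs)[j]? = some (c, B) := List.getElem?_zip_eq_some.2 ⟨h1, h3⟩
      obtain ⟨hz1, hz2⟩ := List.getElem?_eq_some_iff.1 hz
      obtain ⟨hd1, hd2⟩ := List.getElem?_eq_some_iff.1 h2
      have := hds.get hz1 hd1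
      simp only [List.get_eq_getElem, hz2, hd2] at this
      exact this
    have hdw : VecWT C ds (Bs.map (holeTy L)) := by
      refine List.forall₂_iff_get.2 ⟨by simpa using hdlen, fun j h1 h2 => ?_⟩
      have h3 : j < Bs.length := by simpa using h2
      have h4 : j < cs.length := hl ▸ h3
      have := (hdj j _ _ _ (List.getElem?_eq_getElem h4) (List.getElem?_eq_getElem h1)
        (List.getElem?_eq_getElem h3)).1
      simpa using this
    have hM' := hM ps[i] (List.getElem_mem hilt)
    rw [hBs] at hM'
    -- The contexts may be replaced by an equivalent listed vector, for which the closure condition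
    -- names `r`; below, the arguments are likewise replaced by a vector of `V`, where the condition
    -- was tested.
    obtain ⟨ms, hms, hdm⟩ := hM'.2 ds hdw
    obtain ⟨r, hr, hrv⟩ := hcell i hilt ms (by rw [hps]; exact hms)
    refine ⟨r, hr, fun us hus => ?_⟩
    obtain ⟨vs, hvs, e⟩ := hV.2 us hus
    have hvw := e.symm.left
    obtain ⟨u, v, hui, hvi, huv⟩ := e.getElem? hAi
    have hu : consAll us Tm.var y = u := by
      have := consAll_apply us Tm.var (i := i) (j := y) (by rw [hi, hus.length_eq])
      rw [hui] at this
      exact (Option.some.inj this).symm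
    have hv : vs.getD i (Tm.const 0) = v := by simp [List.getD, hvi]
    have hfin := hrv vs hvs
    rw [hv] at hfin
    rw [hIC.subst rfl, Tm.subst, hu]
    refine ((hLo r hr us vs e).lr.2.2.trans hfin.betaEq).trans ?_
    rw [Ty.arrs_eq_foldr] at huv
    refine (huv.symm.apps ?_).lr.2.2
    refine vecObs_of_getElem? ?_ (by simpa using hl) fun j m' c' B h1 h2 h3 => ?_
    · rw [List.length_map, ← hdm.symm.left.length_eq.symm, List.length_map]
    · simp only [List.getElem?_map, Option.map_eq_some_iff] at h1 h2
      obtain ⟨m, hm, rfl⟩ := h1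
      obtain ⟨c, hc', rfl⟩ := h2
      obtain ⟨d, m₀, hd, hm₀, hdm'⟩ := hdm.getElem? (i := j) (A := holeTy L B) (by simp [h3])
      obtain rfl := Option.some.inj (hm.symm.trans hm₀)
      have h4 : ObsEquiv C B (m.apps (L.map fun r => r.apps vs))
          (d.apps (L.map fun r => r.apps us)) :=
        ObsEquiv.apps (As := L.map fun _ => Ty.o) hdm'.symm
          (vecObs_ground fun r hr => hLo r hr _ _ e.symm)
      refine h4.trans ((hdj j c d B hc' hd h3).2 (fun r => r.apps us)
        (Tm.subst (consAll us Tm.var)) ?_ fun w hw' r hr hwr => ?_)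
      · exact fun r hr => (hLo r hr us us (.refl hus)).left
      · refine (hwr us hus).obsEquiv (hLo r hr us us (.refl hus)).left ?_
        exact (hw w hw').wt.subst (isSub_consAll (IsSub.nil _ _) hus)

theorem Cert.vecComplete {V : List (List Tm)} (h : Cert C As V) : VecComplete C As V := by
  induction h with
  | nil =>
    refine ⟨by simp, fun us hus => ?_⟩
    cases hus
    exact ⟨[], by simp, .nil⟩
  | cons _ _ ih ih' => exact ih.cons ih'
  | @cells ps L V _ _ hL hconst hcell ihV ihM =>
    rw [vecComplete_singleton]
    refine ⟨hL, fun t ht => ?_⟩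
    obtain ⟨t', ht', e⟩ := ht.exists_hCell
    obtain ⟨b, hb, rfl⟩ := ht'.exists_body
    obtain ⟨r, hr, h⟩ := hb.exists_representative rfl ihV ihM hL hconst hcell
    refine ⟨r, hr, e.trans ?_⟩
    rw [obsEquiv_arrs_iff]
    refine ⟨ht'.wt, hL r hr, fun us hus => ?_⟩
    have := BetaEq.lams_apps (t := b) Tm.var hus.length_eq
    rw [Tm.subst_var] at this
    exact this.trans (h us hus).symm

/-! ### Existence of certificates -/

/-- The order of a type. -/
def Ty.order : Ty → ℕ
  | Ty.o => 0
  | Ty.arr A B => max (A.order + 1) B.order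

theorem Ty.order_lt_arrs (h : A ∈ As) : A.order < (Ty.arrs As).order := by
  induction As with
  | nil => simp at h
  | cons B As ih =>
    rcases List.mem_cons.1 h with rfl | h
    · exact lt_of_lt_of_le (Nat.lt_succ_self _) (le_max_left _ _)
    · exact lt_of_lt_of_le (ih h) (le_max_right _ _)

/-- Ground arguments hardly raise the order. This makes the recursion behind certificates well
founded, however long `L` is. -/
theorem order_holeTy (L : List Tm) (B : Ty) : (holeTy L B).order ≤ max 1 B.order := by
  induction L with
  | nil => exact le_max_right _ _
  | cons r L ih => exact max_le (le_max_left _ _) ih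

theorem exists_cert_vec (h : ∀ A ∈ As, ∃ V, Cert C [A] V) : ∃ V, Cert C As V := by
  induction As with
  | nil => exact ⟨_, .nil⟩
  | cons A As ih =>
    obtain ⟨U, hU⟩ := h A List.mem_cons_self
    obtain ⟨V, hV⟩ := ih fun B hB => h B (List.mem_cons_of_mem _ hB)
    exact ⟨_, hU.cons hV⟩

theorem Complete.exists_mem_of_body {L : List Tm} (hL : Complete C (Ty.arrs As) L) {e : Tm}
    (he : WT C (As.reverseAux []) e Ty.o) : ∃ r ∈ L, ∀ us, VecWT C us As →
      SameValue (r.apps us) (e.subst (consAll us Tm.var)) := by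
  have hlam : WT C [] (Tm.lams As e) (Ty.arrs As) := by
    rw [Ty.arrs_eq_foldr]; exact he.lams
  obtain ⟨r, hr, h⟩ := hL.2 _ hlam
  refine ⟨r, hr, fun us hus => ?_⟩
  have h1 := BetaEq.lams_apps (t := e) Tm.var hus.length_eq
  rw [Tm.subst_var] at h1
  have h2 := (obsEquiv_arrs_iff.1 h).2.2 us hus
  have h3 := h.right
  rw [Ty.arrs_eq_foldr] at h3
  exact (h2.symm.trans h1).sameValue (h3.apps hus)
    (he.subst (isSub_consAll (IsSub.nil _ _) hus))

/-- For `L` one takes any complete list, which exists by finiteness. The required constant functions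
and cells are definable by closed terms, hence represented in `L`; the other premises concern types
of lower order. -/
theorem exists_cert_singleton (C : Finset ℕ) (n : ℕ) :
    ∀ A : Ty, A.order < n → ∃ V, Cert C [A] V := by
  induction n with
  | zero => intro A h; omega
  | succ n ih =>
    intro A hA
    obtain ⟨As, rfl⟩ := A.exists_eq_arrs
    obtain ⟨Bss, hBss⟩ := exists_forall₂ (l := As) (R := fun A Bs => Ty.arrs Bs = A) fun A _ => by
      obtain ⟨Bs, h⟩ := A.exists_eq_arrs
      exact ⟨Bs, h.symm⟩
    have hAs := map_eq_of_forall₂ hBss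
    obtain ⟨L, hL⟩ := exists_complete C (Ty.arrs As)
    obtain ⟨V, hV⟩ := exists_cert_vec (C := C) (As := As) fun A hA' =>
      ih A (by have := Ty.order_lt_arrs hA'; omega)
    obtain ⟨ps, hps⟩ := exists_forall₂ (l := Bss)
      (R := fun Bs (p : List Ty × List (List Tm)) => p.1 = Bs ∧
        Cert C (p.1.map (holeTy L)) p.2) fun Bs hBs => by
      obtain ⟨M, hM⟩ := exists_cert_vec (C := C) (As := Bs.map (holeTy L)) fun D hD => by
        obtain ⟨B, hB, rfl⟩ := List.mem_map.1 hD
        refine ih _ ?_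
        have h1 := order_holeTy L B
        have h2 := Ty.order_lt_arrs hB
        have h3 : (Ty.arrs Bs).order < (Ty.arrs As).order :=
          Ty.order_lt_arrs (hAs ▸ List.mem_map_of_mem hBs)
        -- `B` is an argument of an argument of the given type, so that type has order at least
        -- `B.order + 2`, which exceeds `max 1 B.order`.
        omega
      exact ⟨(Bs, M), rfl, hM⟩
    have hpAs : (ps.map fun p => Ty.arrs p.1) = As := by
      rw [← hAs, ← map_eq_of_forall₂ (hps.imp fun _ _ h => h.1), List.map_map]
      rfl
    have hpM : ∀ p ∈ ps, Cert C (p.1.map (holeTy L)) p.2 :=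
      forall_mem_right_of_forall₂ hps fun _ _ h => h.2
    refine ⟨L.map fun r => [r], ?_⟩
    rw [← hpAs] at hL hV ⊢
    refine .cells hV hpM hL.1 (fun a ha => ?_) fun i hi ms hms => ?_
    · obtain ⟨r, hr, h⟩ := hL.exists_mem_of_body (WT.const ha)
      refine ⟨r, hr, fun us hus => ?_⟩
      have h1 := hL.1 r hr
      rw [Ty.arrs_eq_foldr] at h1
      have hus' := hV.vecComplete.1 us hus
      exact (h1.apps hus').halts (h us hus').betaEq
    · rw [hpAs] at hL hV
      have hlen : As.length = ps.length := by rw [← hpAs, List.length_map]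
      have hgetD : ps.getD i ([], []) = ps[i] := by simp [List.getD, hi]
      rw [hgetD] at hms
      have hmw := (hpM ps[i] (List.getElem_mem hi)).vecComplete.1 ms hms
      have hAi : As[i]? = some (Ty.arrs ps[i].1) := by
        rw [← hpAs, List.getElem?_map, List.getElem?_eq_getElem hi]; rfl
      set Γ := As.reverseAux [] with hΓ
      have hvar : ∀ k A, As[k]? = some A → Γ[As.length - 1 - k]? = some A := by
        intro k A hk
        obtain ⟨hk', rfl⟩ := List.getElem?_eq_some_iff.1 hk
        have : Γ = As.reverse := rfl
        rw [this, List.getElem?_reverse (by omega),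
          show As.length - 1 - (As.length - 1 - k) = k by omega, hk]
      set xs := (List.range As.length).map fun k => Tm.var (As.length - 1 - k) with hxs
      have hxw : List.Forall₂ (fun u A => WT C Γ u A) xs As := by
        refine List.forall₂_iff_get.2 ⟨by simp [hxs], fun k h1 h2 => ?_⟩
        simp only [hxs, List.get_eq_getElem, List.getElem_map, List.getElem_range]
        exact .var (hvar k _ (List.getElem?_eq_getElem h2))
      have weaken : ∀ {t A}, WT C [] t A → WT C Γ t A := by
        intro t A h
        have := h.subst (IsSub.nil Tm.var Γ)
        rwa [Tm.subst_var] at this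
      have hLw : ∀ w ∈ L.map fun r => r.apps xs, WT C Γ w Ty.o := by
        intro w hw
        obtain ⟨r, hr, rfl⟩ := List.mem_map.1 hw
        have := weaken (hL.1 r hr)
        rw [Ty.arrs_eq_foldr] at this
        exact this.apps hxw
      -- The required cell as an open term: the `i`-th argument is its head, and the hole indexed by
      -- `r` contains `r` applied to all argument variables `xs`.
      set e := (Tm.var (As.length - 1 - i)).apps
        (ms.map fun m => m.apps (L.map fun r => r.apps xs)) with he
      have hew : WT C Γ e Ty.o := by
        have h0 : WT C Γ (Tm.var (As.length - 1 - i)) (ps[i].1.foldr Ty.arr Ty.o) := by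
          rw [← Ty.arrs_eq_foldr]
          exact .var (hvar i _ hAi)
        refine h0.apps ?_
        rw [List.forall₂_map_left_iff]
        rw [VecWT, List.forall₂_map_right_iff] at hmw
        refine hmw.imp fun m B hm => ?_
        refine (weaken hm).apps ?_
        rw [List.forall₂_map_left_iff, List.forall₂_map_right_iff, List.forall₂_same]
        exact fun r hr => hLw _ (List.mem_map.2 ⟨r, hr, rfl⟩)
      obtain ⟨r, hr, h⟩ := hL.exists_mem_of_body hew
      refine ⟨r, hr, fun us hus => ?_⟩
      have hus' := hV.vecComplete.1 us hus
      have hxu : xs.map (Tm.subst (consAll us Tm.var)) = us := by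
        refine List.ext_getElem? fun k => ?_
        by_cases hk : k < As.length
        · rw [consAll_apply us Tm.var (i := k) (j := As.length - 1 - k)
            (by rw [hus'.length_eq]; omega)]
          simp [hxs, hk, Tm.subst]
        · rw [List.getElem?_eq_none (by simpa [hxs] using hk),
            List.getElem?_eq_none (by rw [hus'.length_eq]; omega)]
      have hes : e.subst (consAll us Tm.var) = (us.getD i (Tm.const 0)).apps
          (ms.map fun m => m.apps (L.map fun r => r.apps us)) := by
        rw [he, Tm.apps_subst, Tm.subst]
        congr 1
        · have := consAll_apply us Tm.var (i := i) (j := As.length - 1 - i)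
            (by rw [hus'.length_eq]; omega)
          simp [List.getD, this]
        · rw [List.map_map]
          refine List.map_congr_left fun m hm => ?_
          simp only [Function.comp, Tm.apps_subst, List.map_map]
          obtain ⟨k, hk, rfl⟩ := List.getElem_of_mem hm
          have hcl := (hmw.get hk (by rw [← hmw.length_eq]; exact hk)).1.subst_closed
            (consAll us Tm.var)
          simp only [List.get_eq_getElem] at hcl
          rw [hcl]
          congr 1
          refine List.map_congr_left fun r hr => ?_
          simp only [Function.comp, Tm.apps_subst, hxu, (hL.1 r hr).1.subst_closed]
      rw [← hes]
      exact h us hus'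

theorem exists_cert (C : Finset ℕ) (As : List Ty) : ∃ V, Cert C As V :=
  exists_cert_vec fun A _ => exists_cert_singleton C (A.order + 1) A (Nat.lt_succ_self _)

end

/-! ### Recursively enumerable predicates -/

section

open Encodable

variable {α β δ : Type} [Primcodable α] [Primcodable β]

/-- `p` is the projection of a primitive recursive relation. -/
def Sigma1 (p : α → Prop) : Prop :=
  ∃ q : α → ℕ → Prop, PrimrecRel q ∧ ∀ a, p a ↔ ∃ n, q a n

theorem primrecPred_exists_mem_option {o : α → Option β} {r : α → β → Prop} (ho : Primrec o)
    (hr : PrimrecRel r) : PrimrecPred fun a => ∃ b ∈ o a, r a b := by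
  classical
  have h : Primrec fun a => (Option.casesOn (o a) false fun b => decide (r a b) : Bool) :=
    Primrec.option_casesOn ho (Primrec.const _) (PrimrecPred.decide hr)
  refine (h.of_eq (g := fun a => decide (∃ b ∈ o a, r a b)) fun a => ?_).primrecPred
  cases o a <;> simp

namespace Sigma1

theorem of_eq {p q : α → Prop} (hp : Sigma1 p) (h : ∀ a, q a ↔ p a) : Sigma1 q := by
  obtain ⟨r, hr, e⟩ := hp
  exact ⟨r, hr, fun a => (h a).trans (e a)⟩

theorem of_primrec {p : α → Prop} (hp : PrimrecPred p) : Sigma1 p :=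
  ⟨fun a _ => p a, hp.comp Primrec.fst, fun a => by simp⟩

theorem comp {p : β → Prop} {f : α → β} (hp : Sigma1 p) (hf : Primrec f) :
    Sigma1 fun a => p (f a) := by
  obtain ⟨r, hr, e⟩ := hp
  exact ⟨fun a n => r (f a) n, hr.comp (hf.comp Primrec.fst) Primrec.snd, fun a => e (f a)⟩

theorem exists_nat {r : α → ℕ → Prop} (h : Sigma1 fun x : α × ℕ => r x.1 x.2) :
    Sigma1 fun a => ∃ n, r a n := by
  obtain ⟨q, hq, e⟩ := h
  refine ⟨fun a n => q (a, n.unpair.1) n.unpair.2, ?_, fun a => ?_⟩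
  · have h2 := Primrec.unpair.comp (Primrec.snd (α := α) (β := ℕ))
    exact hq.comp (Primrec.fst.pair (Primrec.fst.comp h2)) (Primrec.snd.comp h2)
  · constructor
    · rintro ⟨n, hn⟩
      obtain ⟨m, hm⟩ := (e (a, n)).1 hn
      exact ⟨Nat.pair n m, by simpa using hm⟩
    · rintro ⟨n, hn⟩
      exact ⟨_, (e (a, n.unpair.1)).2 ⟨_, hn⟩⟩

theorem option {o : α → Option β} {r : α → β → Prop} (ho : Primrec o)
    (h : Sigma1 fun x : α × β => r x.1 x.2) : Sigma1 fun a => ∃ b ∈ o a, r a b := by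
  obtain ⟨q, hq, e⟩ := h
  refine ⟨fun a n => ∃ b ∈ o a, q (a, b) n, ?_, fun a => ?_⟩
  · refine primrecPred_exists_mem_option (r := fun (x : α × ℕ) b => q (x.1, b) x.2)
      (ho.comp Primrec.fst) ?_
    exact hq.comp ((Primrec.fst.comp Primrec.fst).pair Primrec.snd)
      (Primrec.snd.comp Primrec.fst)
  · simp only [e (_, _)]
    grind

theorem exists_code {r : α → β → Prop} (h : Sigma1 fun x : α × β => r x.1 x.2) :
    Sigma1 fun a => ∃ b, r a b := by
  have h1 : Sigma1 fun a : α => ∃ n : ℕ, ∃ b ∈ (decode n : Option β), r a b := by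
    refine exists_nat (r := fun a n => ∃ b ∈ (decode n : Option β), r a b) ?_
    refine option (r := fun (x : α × ℕ) b => r x.1 b) (Primrec.decode.comp Primrec.snd) ?_
    exact h.comp ((Primrec.fst.comp Primrec.fst).pair Primrec.snd)
  refine h1.of_eq fun a => ⟨fun ⟨b, hb⟩ => ⟨encode b, b, by simp, hb⟩, ?_⟩
  rintro ⟨n, b, -, hb⟩
  exact ⟨b, hb⟩

theorem and {p q : α → Prop} (hp : Sigma1 p) (hq : Sigma1 q) : Sigma1 fun a => p a ∧ q a := by
  obtain ⟨r, hr, e⟩ := hp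
  obtain ⟨s, hs, f⟩ := hq
  have h : Sigma1 fun a => ∃ x : ℕ × ℕ, r a x.1 ∧ s a x.2 := by
    refine exists_code (of_primrec (PrimrecPred.and ?_ ?_))
    · exact hr.comp Primrec.fst (Primrec.fst.comp Primrec.snd)
    · exact hs.comp Primrec.fst (Primrec.snd.comp Primrec.snd)
  refine h.of_eq fun a => ?_
  rw [e, f]
  exact ⟨fun ⟨⟨n, hn⟩, m, hm⟩ => ⟨(n, m), hn, hm⟩, fun ⟨x, hn, hm⟩ => ⟨⟨_, hn⟩, _, hm⟩⟩

theorem or {p q : α → Prop} (hp : Sigma1 p) (hq : Sigma1 q) : Sigma1 fun a => p a ∨ q a := by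
  obtain ⟨r, hr, e⟩ := hp
  obtain ⟨s, hs, f⟩ := hq
  refine ⟨fun a n => r a n ∨ s a n, PrimrecPred.or hr hs, fun a => ?_⟩
  simp only [e, f, ← exists_or]

theorem exists_bound {P : δ → ℕ → Prop} {l : List δ} (h : ∀ b ∈ l, ∃ n, P b n) :
    ∃ n, ∀ b ∈ l, ∃ m ∈ List.range n, P b m := by
  induction l with
  | nil => exact ⟨0, by simp⟩
  | cons b l ih =>
    obtain ⟨n, hn⟩ := ih fun b hb => h b (List.mem_cons_of_mem _ hb)
    obtain ⟨m, hm⟩ := h b List.mem_cons_self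
    refine ⟨max n (m + 1), fun c hc => ?_⟩
    obtain rfl | hc := List.mem_cons.1 hc
    · exact ⟨m, by simp, hm⟩
    · obtain ⟨k, hk, hP⟩ := hn c hc
      exact ⟨k, by simp at hk ⊢; omega, hP⟩

/-- Collection: one bound serves for the witnesses of all elements of the list, and a bounded search
is primitive recursive. -/
theorem forall_mem {l : α → List β} {r : α → β → Prop} (hl : Primrec l)
    (h : Sigma1 fun x : α × β => r x.1 x.2) : Sigma1 fun a => ∀ b ∈ l a, r a b := by
  obtain ⟨q, hq, e⟩ := h
  refine ⟨fun a n => ∀ b ∈ l a, ∃ m ∈ List.range n, q (a, b) m, ?_, fun a => ?_⟩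
  · have h1 : PrimrecRel fun (m : ℕ) (x : β × (α × ℕ)) => q (x.2.1, x.1) m := by
      have h0 := Primrec.snd (α := ℕ) (β := β × (α × ℕ))
      exact hq.comp ((Primrec.fst.comp (Primrec.snd.comp h0)).pair (Primrec.fst.comp h0))
        Primrec.fst
    have h2 : PrimrecRel fun (b : β) (x : α × ℕ) => ∃ m ∈ List.range x.2, q (x.1, b) m :=
      h1.exists_mem_list.comp (Primrec.list_range.comp (Primrec.snd.comp Primrec.snd)) Primrec.id
    exact h2.forall_mem_list.comp (hl.comp Primrec.fst) Primrec.id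
  · constructor
    · intro ha
      exact exists_bound fun b hb => (e (a, b)).1 (ha b hb)
    · rintro ⟨n, hn⟩ b hb
      obtain ⟨m, -, hm⟩ := hn b hb
      exact (e (a, b)).2 ⟨m, hm⟩

theorem primrecRel_mem : PrimrecRel fun (b : β) (l : List β) => b ∈ l :=
  (Primrec.eq.exists_mem_list.comp Primrec.snd Primrec.fst).of_eq fun x => by simp

theorem exists_mem {l : α → List β} {r : α → β → Prop} (hl : Primrec l)
    (h : Sigma1 fun x : α × β => r x.1 x.2) : Sigma1 fun a => ∃ b ∈ l a, r a b :=
  exists_code (r := fun a b => b ∈ l a ∧ r a b)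
    ((of_primrec (primrecRel_mem.comp Primrec.snd (hl.comp Primrec.fst))).and h)

theorem rePred {p : α → Prop} (hp : Sigma1 p) : REPred p := by
  classical
  obtain ⟨q, hq, e⟩ := hp
  have h : Partrec fun a => Nat.rfindOpt fun n => if q a n then some () else none := by
    refine Partrec.rfindOpt (Primrec.to_comp (α := α × ℕ) ?_)
    exact Primrec.ite hq (Primrec.const _) (Primrec.const _)
  refine h.dom_re.of_eq fun a => ?_
  rw [Nat.rfindOpt_dom, e]
  simp

theorem computablePred {p : α → Prop} (hp : Sigma1 p) (hn : Sigma1 fun a => ¬ p a) :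
    ComputablePred p :=
  ComputablePred.computable_iff_re_compl_re'.2 ⟨hp.rePred, hn.rePred⟩

/-- Unbounded search for a pair of a code of `b` and a witness of the relation; totality ensures
that it ends. -/
theorem exists_computable [Inhabited β] {r : α → β → Prop}
    (h : Sigma1 fun x : α × β => r x.1 x.2) (ht : ∀ a, ∃ b, r a b) :
    ∃ f : α → β, Computable f ∧ ∀ a, r a (f a) := by
  classical
  obtain ⟨q, hq, e⟩ := h
  set P : α → ℕ → Prop := fun a n => ∃ b ∈ (decode n.unpair.1 : Option β), q (a, b) n.unpair.2
    with hP
  have hP1 : PrimrecRel P := by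
    have h0 := Primrec.unpair.comp (Primrec.snd (α := α) (β := ℕ))
    refine primrecPred_exists_mem_option
      (r := fun (x : α × ℕ) b => q (x.1, b) x.2.unpair.2)
      (Primrec.decode.comp (Primrec.fst.comp h0)) ?_
    exact hq.comp ((Primrec.fst.comp Primrec.fst).pair Primrec.snd)
      (Primrec.snd.comp (h0.comp Primrec.fst))
  have hP2 : ∀ a, ∃ n, P a n := by
    intro a
    obtain ⟨b, hb⟩ := ht a
    obtain ⟨m, hm⟩ := (e (a, b)).1 hb
    exact ⟨Nat.pair (encode b) m, b, by simp, by simpa using hm⟩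
  have hc : Computable fun a => Nat.find (hP2 a) :=
    Computable.find ⟨inferInstance, (PrimrecPred.decide hP1).to_comp⟩ hP2
  refine ⟨fun a => ((decode (Nat.find (hP2 a)).unpair.1 : Option β).getD default), ?_,
    fun a => ?_⟩
  · refine (Primrec.option_getD.to_comp.comp (Computable.decode.comp
      (Primrec.fst.to_comp.comp (Primrec.unpair.to_comp.comp hc))) (Computable.const default))
  · obtain ⟨b, hb, hq'⟩ := Nat.find_spec (hP2 a)
    simp only [Option.mem_def.1 hb, Option.getD_some]
    exact (e (a, b)).2 ⟨_, hq'⟩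

end Sigma1

/-! ### Inductively defined predicates -/

/-- The predicate inductively defined by the rules `S prems concl`. -/
inductive Derivable (S : List δ → δ → Prop) : δ → Prop
  | intro {prems : List δ} {b : δ} : S prems b → (∀ c ∈ prems, Derivable S c) → Derivable S b

open Classical in
/-- The conclusions obtained by the derivation steps `l`. -/
noncomputable def derive (q : List δ × δ → ℕ → Prop) (l : List ((List δ × δ) × ℕ))
    (D : List δ) : List δ :=
  l.foldr (fun x D => if (∀ c ∈ x.1.1, c ∈ D) ∧ q x.1 x.2 then x.1.2 :: D else D) D

theorem derive_mono (q : List δ × δ → ℕ → Prop) (l : List ((List δ × δ) × ℕ)) {D E : List δ}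
    (h : D ⊆ E) : derive q l D ⊆ derive q l E := by
  induction l with
  | nil => exact h
  | cons x l ih =>
    simp only [derive, List.foldr_cons] at ih ⊢
    intro b hb
    split_ifs at hb with h1
    · rw [if_pos ⟨fun c hc => ih (h1.1 c hc), h1.2⟩]
      obtain rfl | hb := List.mem_cons.1 hb
      · exact List.mem_cons_self
      · exact List.mem_cons_of_mem _ (ih hb)
    · split_ifs
      · exact List.mem_cons_of_mem _ (ih hb)
      · exact ih hb

theorem subset_derive (q : List δ × δ → ℕ → Prop) (l : List ((List δ × δ) × ℕ)) (D : List δ) :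
    D ⊆ derive q l D := by
  induction l with
  | nil => exact fun _ h => h
  | cons x l ih =>
    simp only [derive, List.foldr_cons] at ih ⊢
    split_ifs
    · exact fun b hb => List.mem_cons_of_mem _ (ih hb)
    · exact ih

theorem derive_append (q : List δ × δ → ℕ → Prop) (l m : List ((List δ × δ) × ℕ)) (D : List δ) :
    derive q (l ++ m) D = derive q l (derive q m D) := by
  simp [derive]

/-- A derivation tree is flattened to a list of steps, each with the witness that it is a rule
instance. The right fold executes the last step of the list first, so the conclusion is put in front
of the concatenated derivations of its premises. -/
theorem derivable_iff {S : List δ → δ → Prop} {q : List δ × δ → ℕ → Prop}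
    (e : ∀ x : List δ × δ, S x.1 x.2 ↔ ∃ n, q x n) (b : δ) :
    Derivable S b ↔ ∃ l, b ∈ derive q l [] := by
  constructor
  · intro h
    induction h with
    | @intro prems b hS hd ih =>
      have key : ∃ l, ∀ c ∈ prems, c ∈ derive q l [] := by
        clear hS hd
        induction prems with
        | nil => exact ⟨[], by simp⟩
        | cons c prems ih' =>
          obtain ⟨l, hl⟩ := ih' fun c hc => ih c (List.mem_cons_of_mem _ hc)
          obtain ⟨m, hm⟩ := ih c List.mem_cons_self
          refine ⟨m ++ l, fun d hd => ?_⟩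
          rw [derive_append]
          obtain rfl | hd := List.mem_cons.1 hd
          · exact derive_mono q m (by simp) hm
          · exact subset_derive q m _ (hl d hd)
      obtain ⟨l, hl⟩ := key
      obtain ⟨n, hn⟩ := (e (prems, b)).1 hS
      refine ⟨((prems, b), n) :: l, ?_⟩
      have h1 : (∀ c ∈ prems, c ∈ derive q l []) ∧ q (prems, b) n := ⟨hl, hn⟩
      simp only [derive] at h1
      simp only [derive, List.foldr_cons]
      rw [if_pos h1]
      exact List.mem_cons_self
  · rintro ⟨l, hl⟩
    induction l generalizing b with
    | nil => simp [derive] at hl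
    | cons x l ih =>
      simp only [derive, List.foldr_cons] at ih hl
      split_ifs at hl with h1
      · obtain rfl | hl := List.mem_cons.1 hl
        · exact .intro ((e x.1).2 ⟨_, h1.2⟩) fun c hc => ih c (h1.1 c hc)
        · exact ih b hl
      · exact ih b hl

theorem Sigma1.derivable {S : List β → β → Prop}
    (h : Sigma1 fun x : List β × β => S x.1 x.2) : Sigma1 (Derivable S) := by
  classical
  obtain ⟨q, hq, e⟩ := h
  refine (Sigma1.exists_code (β := List ((List β × β) × ℕ))
    (r := fun b l => b ∈ derive q l []) (.of_primrec (Sigma1.primrecRel_mem.comp Primrec.fst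
      (g := fun x : β × List ((List β × β) × ℕ) => derive q x.2 []) ?_))).of_eq
      fun b => derivable_iff e b
  refine Primrec.list_foldr
    (h := fun _ (y : ((List β × β) × ℕ) × List β) => if (∀ c ∈ y.1.1.1, c ∈ y.2) ∧ q y.1.1 y.1.2 then y.1.1.2 :: y.2 else y.2)
    Primrec.snd (Primrec.const []) ?_
  have h0 := Primrec.snd (α := β × List ((List β × β) × ℕ))
    (β := ((List β × β) × ℕ) × List β)
  have h1 := Primrec.fst.comp (Primrec.fst.comp h0)
  have h2 := Primrec.snd.comp h0
  refine Primrec.ite (PrimrecPred.and ?_ ?_) ?_ h2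
  · exact Sigma1.primrecRel_mem.forall_mem_list.comp (Primrec.fst.comp h1) h2
  · exact hq.comp h1 (Primrec.snd.comp (Primrec.fst.comp h0))
  · exact Primrec.list_cons.comp (Primrec.snd.comp h1) h2

end

/-! ### Primitive recursive functions on the syntax -/

section

open Encodable Denumerable

variable {α β σ : Type} [Primcodable α] [Primcodable β] [Primcodable σ]

theorem Ty.encode_eq (A : Ty) : encode A = A.toNat := rfl

theorem Tm.encode_eq (t : Tm) : encode t = t.toNat := rfl

theorem Ty.ofNat_encode_eq {n : ℕ} {A : Ty} (h : A.toNat = n) : Denumerable.ofNat Ty n = A := by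
  rw [← h, ← Ty.encode_eq, Denumerable.ofNat_encode]

theorem Tm.ofNat_encode_eq {n : ℕ} {t : Tm} (h : t.toNat = n) : Denumerable.ofNat Tm n = t := by
  rw [← h, ← Tm.encode_eq, Denumerable.ofNat_encode]

theorem primrec_arr : Primrec₂ Ty.arr := by
  refine ((Primrec.ofNat Ty).comp (Primrec.succ.comp (Primrec₂.natPair.comp
    (Primrec.encode.comp Primrec.fst) (Primrec.encode.comp Primrec.snd)))).of_eq fun x => ?_
  exact Ty.ofNat_encode_eq rfl

theorem primrec_four_mul : Primrec fun n : ℕ => 4 * n :=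
  Primrec.nat_mul.comp (Primrec.const 4) Primrec.id

theorem primrec_var : Primrec Tm.var :=
  ((Primrec.ofNat Tm).comp primrec_four_mul).of_eq fun _ => Tm.ofNat_encode_eq rfl

theorem primrec_const : Primrec Tm.const :=
  ((Primrec.ofNat Tm).comp (Primrec.succ.comp primrec_four_mul)).of_eq
    fun _ => Tm.ofNat_encode_eq rfl

theorem primrec_app : Primrec₂ Tm.app := by
  refine ((Primrec.ofNat Tm).comp (Primrec.nat_add.comp (primrec_four_mul.comp
    (Primrec₂.natPair.comp (Primrec.encode.comp Primrec.fst) (Primrec.encode.comp Primrec.snd)))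
    (Primrec.const 2))).of_eq fun x => ?_
  exact Tm.ofNat_encode_eq rfl

theorem primrec_lam : Primrec₂ Tm.lam := by
  refine ((Primrec.ofNat Tm).comp (Primrec.nat_add.comp (primrec_four_mul.comp
    (Primrec₂.natPair.comp (Primrec.encode.comp Primrec.fst) (Primrec.encode.comp Primrec.snd)))
    (Primrec.const 3))).of_eq fun x => ?_
  exact Tm.ofNat_encode_eq rfl

/-- The domain and codomain of an arrow type. -/
def Ty.dest : Ty → Option (Ty × Ty)
  | Ty.o => none
  | Ty.arr A B => some (A, B)

theorem primrec_dest : Primrec Ty.dest := by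
  have h : Primrec fun A : Ty => (Nat.casesOn (encode A) none fun n =>
      some (Denumerable.ofNat Ty n.unpair.1, Denumerable.ofNat Ty n.unpair.2) :
      Option (Ty × Ty)) := by
    refine Primrec.nat_casesOn Primrec.encode (Primrec.const none) ?_
    have h0 := Primrec.unpair.comp (Primrec.snd (α := Ty) (β := ℕ))
    exact Primrec.option_some.comp (((Primrec.ofNat Ty).comp (Primrec.fst.comp h0)).pair
      ((Primrec.ofNat Ty).comp (Primrec.snd.comp h0)))
  refine h.of_eq fun A => ?_
  cases A with
  | o => rfl
  | arr A B =>
    simp only [Ty.encode_eq, Ty.toNat, Ty.dest, Nat.unpair_pair]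
    rw [Ty.ofNat_encode_eq rfl, Ty.ofNat_encode_eq rfl]

/-- The index of a variable or of a constant, and the immediate components of a term. -/
def Tm.view : Tm → (ℕ ⊕ ℕ) ⊕ ((Tm × Tm) ⊕ (Ty × Tm))
  | Tm.var i => .inl (.inl i)
  | Tm.const c => .inl (.inr c)
  | Tm.app s t => .inr (.inl (s, t))
  | Tm.lam A t => .inr (.inr (A, t))

theorem primrec_view : Primrec Tm.view := by
  have h : Primrec fun t : Tm =>
      (if encode t % 4 = 0 then .inl (.inl (encode t / 4)) else
       if encode t % 4 = 1 then .inl (.inr (encode t / 4)) else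
       if encode t % 4 = 2 then .inr (.inl (Denumerable.ofNat Tm (encode t / 4).unpair.1,
          Denumerable.ofNat Tm (encode t / 4).unpair.2)) else
        .inr (.inr (Denumerable.ofNat Ty (encode t / 4).unpair.1,
          Denumerable.ofNat Tm (encode t / 4).unpair.2)) :
        (ℕ ⊕ ℕ) ⊕ ((Tm × Tm) ⊕ (Ty × Tm))) := by
    have hm : Primrec fun t : Tm => encode t % 4 :=
      Primrec.nat_mod.comp Primrec.encode (Primrec.const 4)
    have hd : Primrec fun t : Tm => encode t / 4 :=
      Primrec.nat_div.comp Primrec.encode (Primrec.const 4)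
    have h1 := Primrec.fst.comp (Primrec.unpair.comp hd)
    have h2 := Primrec.snd.comp (Primrec.unpair.comp hd)
    refine Primrec.ite (Primrec.eq.comp hm (Primrec.const 0))
      (Primrec.sumInl.comp (Primrec.sumInl.comp hd)) ?_
    refine Primrec.ite (Primrec.eq.comp hm (Primrec.const 1))
      (Primrec.sumInl.comp (Primrec.sumInr.comp hd)) ?_
    refine Primrec.ite (Primrec.eq.comp hm (Primrec.const 2))
      (Primrec.sumInr.comp (Primrec.sumInl.comp ?_)) (Primrec.sumInr.comp (Primrec.sumInr.comp ?_))
    · exact ((Primrec.ofNat Tm).comp h1).pair ((Primrec.ofNat Tm).comp h2)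
    · exact ((Primrec.ofNat Ty).comp h1).pair ((Primrec.ofNat Tm).comp h2)
  refine h.of_eq fun t => ?_
  cases t with
  | var i => simp [Tm.encode_eq, Tm.toNat, Tm.view]
  | const c =>
    have h1 : (4 * c + 1) % 4 = 1 := by omega
    have h2 : (4 * c + 1) / 4 = c := by omega
    simp [Tm.encode_eq, Tm.toNat, Tm.view, h1, h2]
  | app s t =>
    have h1 : (4 * Nat.pair s.toNat t.toNat + 2) % 4 = 2 := by omega
    have h2 : (4 * Nat.pair s.toNat t.toNat + 2) / 4 = Nat.pair s.toNat t.toNat := by omega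
    simp [Tm.encode_eq, Tm.toNat, Tm.view, h1, h2, Tm.ofNat_encode_eq rfl]
  | lam A t =>
    have h1 : (4 * Nat.pair A.toNat t.toNat + 3) % 4 = 3 := by omega
    have h2 : (4 * Nat.pair A.toNat t.toNat + 3) / 4 = Nat.pair A.toNat t.toNat := by omega
    simp [Tm.encode_eq, Tm.toNat, Tm.view, h1, h2, Tm.ofNat_encode_eq rfl, Ty.ofNat_encode_eq rfl]

/-- Structural recursion on terms, the parameter being changed under abstractions. -/
theorem primrec_tm_rec {f : α × Tm → σ} {v c : α × ℕ → σ} {p : (α × (Tm × Tm)) × (σ × σ) → σ}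
    {b : (α × (Ty × Tm)) × σ → σ} {k : α × (Ty × Tm) → α} (hv : Primrec v) (hc : Primrec c)
    (hp : Primrec p) (hb : Primrec b) (hk : Primrec k)
    (ev : ∀ a i, f (a, .var i) = v (a, i)) (ec : ∀ a i, f (a, .const i) = c (a, i))
    (ep : ∀ a s t, f (a, .app s t) = p ((a, (s, t)), (f (a, s), f (a, t))))
    (eb : ∀ a A t, f (a, .lam A t) = b ((a, (A, t)), f (k (a, (A, t)), t))) : Primrec f := by
  -- `l` lists the arguments of the recursive calls and `g` combines their results; the code of the
  -- term decreases along `l`, as course-of-values recursion requires.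
  let l : α × Tm → List (α × Tm) := fun x =>
    Sum.casesOn x.2.view (fun _ => [])
      fun y => Sum.casesOn y (fun z => [(x.1, z.1), (x.1, z.2)]) fun z => [(k (x.1, z), z.2)]
  let g : α × Tm → List σ → Option σ := fun x r =>
    Sum.casesOn x.2.view
      (fun y => Sum.casesOn y (fun i => some (v (x.1, i))) fun i => some (c (x.1, i)))
      fun y => Sum.casesOn y
        (fun z => r[0]?.bind fun w => r[1]?.map fun w' => p ((x.1, z), (w, w')))
        fun z => r[0]?.map fun w => b ((x.1, z), w)
  have hl : Primrec l := by
    refine Primrec.sumCasesOn (primrec_view.comp Primrec.snd) (Primrec.const []).to₂ ?_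
    refine Primrec.sumCasesOn (α := (α × Tm) × ((Tm × Tm) ⊕ (Ty × Tm)))
      (f := fun x => x.2) Primrec.snd ?_ ?_
    · have h0 : Primrec fun x : ((α × Tm) × ((Tm × Tm) ⊕ (Ty × Tm))) × (Tm × Tm) => x.1.1.1 :=
        Primrec.fst.comp (Primrec.fst.comp Primrec.fst)
      exact Primrec.list_cons.comp (h0.pair (Primrec.fst.comp Primrec.snd))
        (Primrec.list_cons.comp (h0.pair (Primrec.snd.comp Primrec.snd)) (Primrec.const []))
    · have h0 : Primrec fun x : ((α × Tm) × ((Tm × Tm) ⊕ (Ty × Tm))) × (Ty × Tm) => x.1.1.1 :=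
        Primrec.fst.comp (Primrec.fst.comp Primrec.fst)
      exact Primrec.list_cons.comp ((hk.comp (h0.pair Primrec.snd)).pair
        (Primrec.snd.comp Primrec.snd)) (Primrec.const [])
  have hg : Primrec₂ g := by
    refine Primrec.sumCasesOn (α := (α × Tm) × List σ)
      (primrec_view.comp (Primrec.snd.comp Primrec.fst)) ?_ ?_
    · refine Primrec.sumCasesOn (α := ((α × Tm) × List σ) × (ℕ ⊕ ℕ)) Primrec.snd ?_ ?_
      · exact Primrec.option_some.comp (hv.comp ((Primrec.fst.comp (Primrec.fst.comp
          (Primrec.fst.comp Primrec.fst))).pair Primrec.snd))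
      · exact Primrec.option_some.comp (hc.comp ((Primrec.fst.comp (Primrec.fst.comp
          (Primrec.fst.comp Primrec.fst))).pair Primrec.snd))
    · refine Primrec.sumCasesOn (α := ((α × Tm) × List σ) × ((Tm × Tm) ⊕ (Ty × Tm)))
        Primrec.snd ?_ ?_
      · refine Primrec.option_bind
          (α := (((α × Tm) × List σ) × ((Tm × Tm) ⊕ (Ty × Tm))) × (Tm × Tm))
          (Primrec.list_getElem?.comp (Primrec.snd.comp (Primrec.fst.comp Primrec.fst))
            (Primrec.const 0)) ?_
        refine Primrec.option_map
          (α := ((((α × Tm) × List σ) × ((Tm × Tm) ⊕ (Ty × Tm))) × (Tm × Tm)) × σ)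
          (Primrec.list_getElem?.comp (Primrec.snd.comp (Primrec.fst.comp
            (Primrec.fst.comp Primrec.fst))) (Primrec.const 1)) ?_
        have h0 := Primrec.fst (α := ((((α × Tm) × List σ) × ((Tm × Tm) ⊕ (Ty × Tm))) ×
          (Tm × Tm)) × σ) (β := σ)
        have h1 := Primrec.fst.comp h0
        exact hp.comp (((Primrec.fst.comp (Primrec.fst.comp (Primrec.fst.comp
          (Primrec.fst.comp h1)))).pair (Primrec.snd.comp h1)).pair
          ((Primrec.snd.comp h0).pair Primrec.snd))
      · refine Primrec.option_map
          (α := (((α × Tm) × List σ) × ((Tm × Tm) ⊕ (Ty × Tm))) × (Ty × Tm))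
          (Primrec.list_getElem?.comp (Primrec.snd.comp (Primrec.fst.comp Primrec.fst))
            (Primrec.const 0)) ?_
        have h0 := Primrec.fst (α := (((α × Tm) × List σ) × ((Tm × Tm) ⊕ (Ty × Tm))) ×
          (Ty × Tm)) (β := σ)
        exact hb.comp (((Primrec.fst.comp (Primrec.fst.comp (Primrec.fst.comp
          (Primrec.fst.comp h0)))).pair (Primrec.snd.comp h0)).pair Primrec.snd)
  refine Primrec.nat_omega_rec' f (m := fun x => encode x.2) (Primrec.encode.comp Primrec.snd)
    hl hg ?_ ?_
  · rintro ⟨a, t⟩ ⟨a', t'⟩ h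
    have hp1 := Nat.left_le_pair
    have hp2 := Nat.right_le_pair
    simp only [Tm.encode_eq]
    cases t with
    | var i => simp [l, Tm.view] at h
    | const i => simp [l, Tm.view] at h
    | app s t =>
      have e1 := hp1 s.toNat t.toNat
      have e2 := hp2 s.toNat t.toNat
      simp only [l, Tm.view, List.mem_cons, Prod.mk.injEq, List.not_mem_nil, or_false] at h
      simp only [Tm.toNat]
      rcases h with ⟨-, rfl⟩ | ⟨-, rfl⟩ <;> omega
    | lam A t =>
      have e2 := hp2 A.toNat t.toNat
      simp only [l, Tm.view, List.mem_cons, Prod.mk.injEq, List.not_mem_nil, or_false] at h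
      simp only [Tm.toNat]
      rcases h with ⟨-, rfl⟩
      omega
  · rintro ⟨a, t⟩
    cases t with
    | var i => simp [g, Tm.view, ev]
    | const i => simp [g, Tm.view, ec]
    | app s t => simp [l, g, Tm.view, ep]
    | lam A t => simp [l, g, Tm.view, eb]

/-- The shift by `d` of the free variables of a term, above the first `n` ones. -/
def liftAt (d n i : ℕ) : ℕ := if i < n then i else i + d

theorem upRen_liftAt (d n : ℕ) : upRen (liftAt d n) = liftAt d (n + 1) := by
  funext i
  cases i with
  | zero => simp [upRen, liftAt]
  | succ i => simp only [upRen, liftAt]; split_ifs <;> omega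

theorem primrec_liftAt : Primrec fun x : (ℕ × ℕ) × ℕ => liftAt x.1.1 x.1.2 x.2 :=
  Primrec.ite (Primrec.nat_lt.comp Primrec.snd (Primrec.snd.comp Primrec.fst)) Primrec.snd
    (Primrec.nat_add.comp Primrec.snd (Primrec.fst.comp Primrec.fst))

/-- Arbitrary renamings have no codes. The family `liftAt d n` is given by two numbers and closed
under `upRen`, so recursion with a parameter applies; `fillSubst` plays the same role for
substitutions. -/
theorem primrec_rename_liftAt :
    Primrec fun x : (ℕ × ℕ) × Tm => x.2.rename (liftAt x.1.1 x.1.2) := by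
  refine primrec_tm_rec (v := fun x => .var (liftAt x.1.1 x.1.2 x.2)) (c := fun x => .const x.2)
    (p := fun x => .app x.2.1 x.2.2) (b := fun x => .lam x.1.2.1 x.2)
    (k := fun x => (x.1.1, x.1.2 + 1)) ?_ ?_ ?_ ?_ ?_ (fun _ _ => rfl) (fun _ _ => rfl)
    (fun _ _ _ => rfl) ?_
  · exact primrec_var.comp primrec_liftAt
  · exact primrec_const.comp Primrec.snd
  · exact primrec_app.comp (Primrec.fst.comp Primrec.snd) (Primrec.snd.comp Primrec.snd)
  · exact primrec_lam.comp (Primrec.fst.comp (Primrec.snd.comp Primrec.fst)) Primrec.snd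
  · exact (Primrec.fst.comp Primrec.fst).pair (Primrec.succ.comp (Primrec.snd.comp Primrec.fst))
  · intro a A t
    simp only [Tm.rename, upRen_liftAt]

/-- The substitution that fills the holes below `n` binders. -/
def fillSubst (ws : List Tm) (n i : ℕ) : Tm :=
  if i < n then .var i
  else (ws[i - n]?).elim (.var i) fun w => w.rename (liftAt n 0)

theorem upSubst_fillSubst (ws : List Tm) (n : ℕ) :
    upSubst (fillSubst ws n) = fillSubst ws (n + 1) := by
  funext i
  cases i with
  | zero => simp [upSubst, fillSubst]
  | succ i =>
    simp only [upSubst, fillSubst, Nat.add_lt_add_iff_right, Nat.add_sub_add_right]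
    split_ifs with h
    · rfl
    · cases ws[i - n]? with
      | none => rfl
      | some w =>
        simp only [Option.elim, Tm.rename_rename]
        congr 1

theorem fill_eq (ws : List Tm) (t : Tm) : t.fill ws = t.subst (fillSubst ws 0) := by
  have h : (fun k => ws.getD k (Tm.var k)) = fillSubst ws 0 := by
    funext i
    simp only [fillSubst, Nat.not_lt_zero, if_false, Nat.sub_zero, List.getD]
    cases ws[i]? with
    | none => rfl
    | some w =>
      have : liftAt 0 0 = id := by funext i; simp [liftAt]
      simp [Option.elim, this, Tm.rename_id]
  rw [Tm.fill, h]

theorem primrec_fillSubst :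
    Primrec fun x : (List Tm × ℕ) × ℕ => fillSubst x.1.1 x.1.2 x.2 := by
  have hn : Primrec fun x : (List Tm × ℕ) × ℕ => x.1.2 := Primrec.snd.comp Primrec.fst
  refine Primrec.ite (Primrec.nat_lt.comp Primrec.snd hn) (primrec_var.comp Primrec.snd) ?_
  have h : Primrec fun x : (List Tm × ℕ) × ℕ => (Option.casesOn (x.1.1[x.2 - x.1.2]?)
      (Tm.var x.2) fun w => w.rename (liftAt x.1.2 0) : Tm) := by
    refine Primrec.option_casesOn (Primrec.list_getElem?.comp (Primrec.fst.comp Primrec.fst)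
      (Primrec.nat_sub.comp Primrec.snd hn)) (primrec_var.comp Primrec.snd) ?_
    exact primrec_rename_liftAt.comp (((hn.comp Primrec.fst).pair (Primrec.const 0)).pair
      Primrec.snd)
  refine h.of_eq fun x => ?_
  cases x.1.1[x.2 - x.1.2]? <;> rfl

theorem primrec_fill : Primrec₂ Tm.fill := by
  have h : Primrec fun x : (List Tm × ℕ) × Tm => x.2.subst (fillSubst x.1.1 x.1.2) := by
    refine primrec_tm_rec (v := fun x => fillSubst x.1.1 x.1.2 x.2) (c := fun x => .const x.2)
      (p := fun x => .app x.2.1 x.2.2) (b := fun x => .lam x.1.2.1 x.2)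
      (k := fun x => (x.1.1, x.1.2 + 1)) primrec_fillSubst ?_ ?_ ?_ ?_ (fun _ _ => rfl)
      (fun _ _ => rfl) (fun _ _ _ => rfl) ?_
    · exact primrec_const.comp Primrec.snd
    · exact primrec_app.comp (Primrec.fst.comp Primrec.snd) (Primrec.snd.comp Primrec.snd)
    · exact primrec_lam.comp (Primrec.fst.comp (Primrec.snd.comp Primrec.fst)) Primrec.snd
    · exact (Primrec.fst.comp Primrec.fst).pair (Primrec.succ.comp (Primrec.snd.comp Primrec.fst))
    · intro a A t
      simp only [Tm.subst, upSubst_fillSubst]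
  exact (h.comp ((Primrec.fst.pair (Primrec.const 0)).pair Primrec.snd)).of_eq
    fun x => (fill_eq x.1 x.2).symm

theorem primrec_apps : Primrec₂ Tm.apps :=
  Primrec.list_foldl (f := fun x : Tm × List Tm => x.2) (g := fun x => x.1)
    (h := fun _ y => Tm.app y.1 y.2) Primrec.snd Primrec.fst (primrec_app.comp
      (Primrec.fst.comp Primrec.snd) (Primrec.snd.comp Primrec.snd))

theorem primrec_foldr_arr : Primrec fun x : List Ty × Ty => x.1.foldr Ty.arr x.2 :=
  Primrec.list_foldr (f := fun x : List Ty × Ty => x.1) (g := fun x => x.2)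
    (h := fun _ y => Ty.arr y.1 y.2) Primrec.fst Primrec.snd
    (primrec_arr.comp (Primrec.fst.comp Primrec.snd) (Primrec.snd.comp Primrec.snd))

theorem primrec_arrs : Primrec Ty.arrs :=
  (primrec_foldr_arr.comp (Primrec.id.pair (Primrec.const Ty.o))).of_eq
    fun As => (Ty.arrs_eq_foldr As).symm

/-! ### Finite sets of constants -/

/-- The elements of a finite set of natural numbers, read off from its code. -/
def elems (C : Finset ℕ) : List ℕ := raise' (Denumerable.ofNat (List ℕ) (eqv (Finset ℕ) C)) 0

theorem mem_elems {C : Finset ℕ} {c : ℕ} : c ∈ elems C ↔ c ∈ C := by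
  conv_rhs => rw [← (eqv (Finset ℕ)).symm_apply_apply C]
  change _ ↔ c ∈ Finset.map (eqv ℕ).symm.toEmbedding
    (raise'Finset (Denumerable.ofNat (List ℕ) (eqv (Finset ℕ) C)) 0)
  rw [Finset.mem_map_equiv]
  rfl

/-- A finite set is coded by the gaps between its elements. Carrying the offset in the accumulator
makes decoding a left fold, hence primitive recursive. -/
theorem foldl_raise' (l acc : List ℕ) (n : ℕ) :
    (l.foldl (fun (s : List ℕ × ℕ) m => (s.1 ++ [m + s.2], m + s.2 + 1)) (acc, n)).1 =
      acc ++ raise' l n := by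
  induction l generalizing acc n with
  | nil => simp [raise']
  | cons m l ih => simp [raise', ih]

theorem primrec_elems : Primrec elems := by
  have h : Primrec fun l : List ℕ =>
      (l.foldl (fun (s : List ℕ × ℕ) m => (s.1 ++ [m + s.2], m + s.2 + 1)) ([], 0)).1 := by
    refine Primrec.fst.comp (Primrec.list_foldl (f := fun l : List ℕ => l)
      (g := fun _ => (([], 0) : List ℕ × ℕ))
      (h := fun _ (y : (List ℕ × ℕ) × ℕ) => (y.1.1 ++ [y.2 + y.1.2], y.2 + y.1.2 + 1))
      Primrec.id (Primrec.const _) ?_)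
    have h0 := Primrec.snd (α := List ℕ) (β := (List ℕ × ℕ) × ℕ)
    have h1 := Primrec.nat_add.comp (Primrec.snd.comp h0) (Primrec.snd.comp (Primrec.fst.comp h0))
    exact (Primrec.list_append.comp (Primrec.fst.comp (Primrec.fst.comp h0))
      (Primrec.list_cons.comp h1 (Primrec.const []))).pair (Primrec.succ.comp h1)
  exact (h.comp ((Primrec.ofNat (List ℕ)).comp Primrec.encode)).of_eq
    fun C => by rw [foldl_raise', List.nil_append]; rfl

/-! ### Type inference -/

open Classical in
/-- The type of a term whose constants belong to `C`. -/
noncomputable def typeOf (C : Finset ℕ) : List Ty → Tm → Option Ty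
  | Γ, Tm.var i => Γ[i]?
  | _, Tm.const c => if c ∈ elems C then some Ty.o else none
  | Γ, Tm.app s t => (typeOf C Γ s).bind fun F => F.dest.bind fun x =>
      (typeOf C Γ t).bind fun A => if A = x.1 then some x.2 else none
  | Γ, Tm.lam A t => (typeOf C (A :: Γ) t).map (Ty.arr A)

theorem typeOf_eq_some {C : Finset ℕ} {Γ : List Ty} {t : Tm} {A : Ty} :
    typeOf C Γ t = some A ↔ WT C Γ t A := by
  constructor
  · intro h
    induction t generalizing Γ A with
    | var i => exact .var h
    | const c =>
      simp only [typeOf, mem_elems] at h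
      split_ifs at h with hc
      cases h
      exact .const hc
    | app s t ihs iht =>
      simp only [typeOf, Option.bind_eq_some_iff] at h
      obtain ⟨F, hF, ⟨B, D⟩, hx, B', hB, h⟩ := h
      split_ifs at h with e
      cases h
      subst e
      cases F with
      | o => cases hx
      | arr _ _ => cases hx; exact .app (ihs hF) (iht hB)
    | lam B t ih =>
      simp only [typeOf, Option.map_eq_some_iff] at h
      obtain ⟨D, hD, rfl⟩ := h
      exact .lam (ih hD)
  · rintro ⟨h, hc⟩
    induction h with
    | var h => exact h
    | const =>
      simp only [Tm.consts, Finset.singleton_subset_iff] at hc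
      simp [typeOf, mem_elems, hc]
    | app _ _ ih ih' =>
      simp only [Tm.consts, Finset.union_subset_iff] at hc
      simp [typeOf, ih hc.1, ih' hc.2, Ty.dest]
    | lam _ ih => simp [typeOf, ih hc]

theorem primrec_typeOf :
    Primrec fun x : (Finset ℕ × List Ty) × Tm => typeOf x.1.1 x.1.2 x.2 := by
  classical
  refine primrec_tm_rec (α := Finset ℕ × List Ty) (σ := Option Ty) (v := fun x => x.1.2[x.2]?)
    (c := fun x => if x.2 ∈ elems x.1.1 then some Ty.o else none)
    (p := fun x => x.2.1.bind fun F => F.dest.bind fun y =>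
      x.2.2.bind fun A => if A = y.1 then some y.2 else none)
    (b := fun x => x.2.map (Ty.arr x.1.2.1)) (k := fun x => (x.1.1, x.2.1 :: x.1.2))
    ?_ ?_ ?_ ?_ ?_ (fun _ _ => rfl) ?_ (fun _ _ _ => ?_) (fun _ _ _ => rfl)
  · exact Primrec.list_getElem?.comp (Primrec.snd.comp Primrec.fst) Primrec.snd
  · refine Primrec.ite ?_ (Primrec.const _) (Primrec.const _)
    exact Sigma1.primrecRel_mem.comp Primrec.snd
      (primrec_elems.comp (Primrec.fst.comp Primrec.fst))
  · refine Primrec.option_bind (Primrec.fst.comp Primrec.snd) ?_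
    refine Primrec.option_bind (primrec_dest.comp Primrec.snd) ?_
    refine Primrec.option_bind (Primrec.snd.comp (Primrec.snd.comp
      (Primrec.fst.comp Primrec.fst))) ?_
    exact Primrec.ite (Primrec.eq.comp Primrec.snd (Primrec.fst.comp
      (Primrec.snd.comp Primrec.fst))) (Primrec.option_some.comp (Primrec.snd.comp
      (Primrec.snd.comp Primrec.fst))) (Primrec.const none)
  · refine Primrec.option_map Primrec.snd ?_
    exact primrec_arr.comp (Primrec.fst.comp (Primrec.snd.comp (Primrec.fst.comp Primrec.fst)))
      Primrec.snd
  · exact (Primrec.fst.comp Primrec.fst).pair (Primrec.list_cons.comp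
      (Primrec.fst.comp Primrec.snd) (Primrec.snd.comp Primrec.fst))
  · intro a i
    simp only [typeOf]
  · simp only [typeOf]

theorem primrecPred_wt {C : α → Finset ℕ} {Γ : α → List Ty} {t : α → Tm} {A : α → Ty}
    (hC : Primrec C) (hΓ : Primrec Γ) (ht : Primrec t) (hA : Primrec A) :
    PrimrecPred fun a => WT (C a) (Γ a) (t a) (A a) :=
  (Primrec.eq.comp (primrec_typeOf.comp ((hC.pair hΓ).pair ht))
    (Primrec.option_some.comp hA)).of_eq fun _ => typeOf_eq_some

end

section

variable {α β γ δ : Type} [Primcodable α] [Primcodable β] [Primcodable γ]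

/-! ### Rule schemes with enumerable side conditions -/

theorem primrec_id : Primrec fun a : α => a := Primrec.id

theorem primrec₂_mk {f : α → β → γ} (h : Primrec fun x : α × β => f x.1 x.2) : Primrec₂ f := h

/-- The rules `f c / g c`, where `c` satisfies the side condition `s`. -/
def RuleSet (f : γ → List β) (g : γ → β) (s : γ → Prop) (l : List β) (b : β) : Prop :=
  ∃ c, l = f c ∧ b = g c ∧ s c

theorem Sigma1.ruleSet {f : γ → List β} {g : γ → β} {s : γ → Prop} (hf : Primrec f)
    (hg : Primrec g) (hs : Sigma1 s) : Sigma1 fun x : List β × β => RuleSet f g s x.1 x.2 := by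
  refine exists_code (((of_primrec ?_).and ((of_primrec ?_).and (hs.comp Primrec.snd))))
  · exact Primrec.eq.comp (Primrec.fst.comp Primrec.fst) (hf.comp Primrec.snd)
  · exact Primrec.eq.comp (Primrec.snd.comp Primrec.fst) (hg.comp Primrec.snd)

theorem sigma1_true : Sigma1 fun _ : α => True := .of_primrec (PrimrecPred.of_eq
  (Primrec.eq.comp Primrec.id Primrec.id) fun _ => by simp)

/-! ### Evaluation is recursively enumerable -/

/-- The judgements `Run t e S a`. -/
abbrev RunJ : Type := (Tm × Tm) × (List (Tm × Tm) × ℕ)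

theorem primrec_extEnv : Primrec₂ extEnv :=
  primrec_app.comp (primrec_app.comp (Primrec.fst.comp Primrec.fst)
    (Primrec.snd.comp Primrec.fst)) Primrec.snd

/-- The rules for constants. -/
def runConst : List RunJ → RunJ → Prop :=
  RuleSet (γ := ℕ × Tm) (fun _ => []) (fun c => ((.const c.1, c.2), ([], c.1))) fun _ => True

/-- The rules for applications. -/
def runApp : List RunJ → RunJ → Prop :=
  RuleSet (γ := (Tm × (Tm × Tm)) × (List (Tm × Tm) × ℕ))
    (fun c => [((c.1.1, c.1.2.2), ((c.1.2.1, c.1.2.2) :: c.2.1, c.2.2))])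
    (fun c => ((.app c.1.1 c.1.2.1, c.1.2.2), c.2)) fun _ => True

/-- The rules for abstractions. -/
def runLam : List RunJ → RunJ → Prop :=
  RuleSet (γ := ((Ty × Tm) × (Tm × (Tm × Tm))) × (List (Tm × Tm) × ℕ))
    (fun c => [((c.1.1.2, extEnv c.1.2.2 c.1.2.1), c.2)])
    (fun c => ((.lam c.1.1.1 c.1.1.2, c.1.2.1), (c.1.2.2 :: c.2.1, c.2.2))) fun _ => True

/-- The rules for the variable with index `0`. -/
def runZero : List RunJ → RunJ → Prop :=
  RuleSet (γ := ((Tm × Tm) × Tm) × (List (Tm × Tm) × ℕ)) (fun c => [(c.1.1, c.2)])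
    (fun c => ((.var 0, extEnv c.1.1 c.1.2), c.2)) fun _ => True

/-- The rules for the other variables. -/
def runSucc : List RunJ → RunJ → Prop :=
  RuleSet (γ := (ℕ × ((Tm × Tm) × Tm)) × (List (Tm × Tm) × ℕ))
    (fun c => [((.var c.1.1, c.1.2.2), c.2)])
    (fun c => ((.var (c.1.1 + 1), extEnv c.1.2.1 c.1.2.2), c.2)) fun _ => True

/-- The rules of the abstract machine. -/
def runRule (l : List RunJ) (b : RunJ) : Prop :=
  runConst l b ∨ runApp l b ∨ runLam l b ∨ runZero l b ∨ runSucc l b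

theorem run_iff {t e : Tm} {S : List (Tm × Tm)} {a : ℕ} :
    Run t e S a ↔ Derivable runRule ((t, e), (S, a)) := by
  constructor
  · intro h
    induction h with
    | const a e => exact .intro (.inl ⟨(a, e), rfl, rfl, trivial⟩) (by simp)
    | @app s u e S a _ ih =>
      exact .intro (.inr (.inl ⟨((s, (u, e)), (S, a)), rfl, rfl, trivial⟩)) (by simpa using ih)
    | @lam A t e c S a _ ih =>
      exact .intro (.inr (.inr (.inl ⟨(((A, t), (e, c)), (S, a)), rfl, rfl, trivial⟩)))
        (by simpa using ih)
    | @zero c e S a _ ih =>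
      exact .intro (.inr (.inr (.inr (.inl ⟨((c, e), (S, a)), rfl, rfl, trivial⟩))))
        (by simpa using ih)
    | @succ i c e S a _ ih =>
      exact .intro (.inr (.inr (.inr (.inr ⟨((i, (c, e)), (S, a)), rfl, rfl, trivial⟩))))
        (by simpa using ih)
  · suffices h : ∀ b, Derivable runRule b → Run b.1.1 b.1.2 b.2.1 b.2.2 from h _
    intro b h
    induction h with
    | @intro l b hS _ ih =>
      rcases hS with ⟨c, rfl, rfl, -⟩ | ⟨c, rfl, rfl, -⟩ | ⟨c, rfl, rfl, -⟩ | ⟨c, rfl, rfl, -⟩ |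
        ⟨c, rfl, rfl, -⟩
      · exact .const _ _
      · exact .app (ih _ (List.mem_singleton.2 rfl))
      · exact .lam (ih _ (List.mem_singleton.2 rfl))
      · exact .zero (ih _ (List.mem_singleton.2 rfl))
      · exact .succ (ih _ (List.mem_singleton.2 rfl))

theorem sigma1_runRule : Sigma1 fun x : List RunJ × RunJ => runRule x.1 x.2 := by
  refine .or (.ruleSet ?_ ?_ sigma1_true) (.or (.ruleSet ?_ ?_ sigma1_true)
    (.or (.ruleSet ?_ ?_ sigma1_true) (.or (.ruleSet ?_ ?_ sigma1_true)
      (.ruleSet ?_ ?_ sigma1_true))))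
  all_goals
    repeat' with_reducible first
      | exact Primrec.const _
      | exact primrec_id
      | refine Primrec.fst.comp ?_
      | refine Primrec.snd.comp ?_
      | refine Primrec.pair ?_ ?_
      | refine Primrec.list_cons.comp ?_ ?_
      | refine primrec_app.comp ?_ ?_
      | refine primrec_lam.comp ?_ ?_
      | refine primrec_extEnv.comp ?_ ?_
      | refine primrec_var.comp ?_
      | refine primrec_const.comp ?_
      | refine Primrec.succ.comp ?_

theorem Sigma1.halts {t : α → Tm} {a : α → ℕ} (ht : Primrec t) (ha : Primrec a) :
    Sigma1 fun x => Halts (t x) (a x) := by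
  have h : Sigma1 fun x => Derivable runRule ((t x, Tm.const 0), (([] : List (Tm × Tm)), a x)) :=
    sigma1_runRule.derivable.comp ((ht.pair (Primrec.const _)).pair ((Primrec.const _).pair ha))
  exact h.of_eq fun x => run_iff

theorem Sigma1.sameValue {t u : α → Tm} (ht : Primrec t) (hu : Primrec u) :
    Sigma1 fun x => SameValue (t x) (u x) :=
  exists_code ((halts (ht.comp Primrec.fst) Primrec.snd).and
    (halts (hu.comp Primrec.fst) Primrec.snd))

/-! ### Hereditary cellular terms are recursively enumerable -/

/-- The judgements `HereditaryCellular Γ t A`. -/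
abbrev CellJ : Type := List Ty × (Tm × Ty)

/-- The rules for constants. -/
def cellConst : List CellJ → CellJ → Prop :=
  RuleSet (γ := List Ty × ℕ) (fun _ => []) (fun c => (c.1, (.const c.2, .o))) fun _ => True

/-- The rules for abstractions. -/
def cellLam : List CellJ → CellJ → Prop :=
  RuleSet (γ := (List Ty × Ty) × (Tm × Ty)) (fun c => [(c.1.2 :: c.1.1, c.2)])
    (fun c => (c.1.1, (.lam c.1.2 c.2.1, .arr c.1.2 c.2.2))) fun _ => True

/-- The rules for cells. -/
def cellCell : List CellJ → CellJ → Prop :=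
  -- Contexts are paired with their types in one list, so the equality of lengths in
  -- `HereditaryCellular.cell` is automatic.
  RuleSet (γ := (List Ty × ℕ) × (List (Tm × Ty) × List Tm))
    (fun c => (c.2.1.map fun p => (c.2.2.map fun _ => Ty.o, p)) ++
      c.2.2.map fun w => (c.1.1, (w, Ty.o)))
    (fun c => (c.1.1, ((Tm.var c.1.2).apps (c.2.1.map fun p => p.1.fill c.2.2), .o)))
    fun c => c.1.1[c.1.2]? = some (Ty.arrs (c.2.1.map fun p => p.2))

/-- The rules for hereditary cellular terms. -/
def cellRule (l : List CellJ) (b : CellJ) : Prop :=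
  cellConst l b ∨ cellLam l b ∨ cellCell l b

theorem hereditaryCellular_iff {Γ : List Ty} {t : Tm} {A : Ty} :
    HereditaryCellular Γ t A ↔ Derivable cellRule (Γ, (t, A)) := by
  constructor
  · intro h
    induction h with
    | @const Γ a => exact .intro (.inl ⟨(Γ, a), rfl, rfl, trivial⟩) (by simp)
    | @lam Γ t A B _ ih =>
      exact .intro (.inr (.inl ⟨((Γ, A), (t, B)), rfl, rfl, trivial⟩)) (by simpa using ih)
    | @cell Γ y Bs cs ws hy hlen _ _ ihc ihw =>
      have h1 : (cs.zip Bs).map (fun p => p.1) = cs := List.map_fst_zip (le_of_eq hlen)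
      have h2 : (cs.zip Bs).map (fun p => p.2) = Bs := List.map_snd_zip (le_of_eq hlen.symm)
      refine .intro (.inr (.inr ⟨((Γ, y), (cs.zip Bs, ws)), rfl, ?_, ?_⟩)) ?_
      · conv_lhs => rw [← h1, List.map_map]
        rfl
      · simp only [h2, hy]
      · intro b hb
        obtain hb | hb := List.mem_append.1 hb
        · obtain ⟨⟨c, B⟩, hp, rfl⟩ := List.mem_map.1 hb
          obtain ⟨j, hj⟩ := List.mem_iff_getElem?.1 hp
          have := List.getElem?_zip_eq_some.1 hj
          have := ihc j c B this.1 this.2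
          rwa [← List.map_const'] at this
        · obtain ⟨w, hw, rfl⟩ := List.mem_map.1 hb
          exact ihw w hw
  · suffices h : ∀ b, Derivable cellRule b → HereditaryCellular b.1 b.2.1 b.2.2 from h _
    intro b h
    induction h with
    | @intro l b hS _ ih =>
      rcases hS with ⟨c, rfl, rfl, -⟩ | ⟨c, rfl, rfl, -⟩ | ⟨c, rfl, rfl, hy⟩
      · exact .const
      · exact .lam (ih _ (List.mem_singleton.2 rfl))
      · obtain ⟨⟨Γ, y⟩, ps, ws⟩ := c
        have := HereditaryCellular.cell (cs := ps.map fun p => p.1) (ws := ws) hy (by simp) ?_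
          fun w hw => ih _ (List.mem_append_right _ (List.mem_map.2 ⟨w, hw, rfl⟩))
        · rwa [List.map_map] at this
        · intro j c B hc hB
          rw [List.getElem?_map, Option.map_eq_some_iff] at hc hB
          obtain ⟨p, hp, rfl⟩ := hc
          obtain ⟨p', hp', rfl⟩ := hB
          obtain rfl : p = p' := Option.some.inj (hp.symm.trans hp')
          have := ih _ (List.mem_append_left _ (List.mem_map.2
            ⟨p, List.mem_iff_getElem?.2 ⟨j, hp⟩, rfl⟩))
          rwa [List.map_const'] at this

theorem sigma1_cellRule : Sigma1 fun x : List CellJ × CellJ => cellRule x.1 x.2 := by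
  refine .or (.ruleSet ?_ ?_ sigma1_true) (.or (.ruleSet ?_ ?_ sigma1_true)
    (.ruleSet ?_ ?_ (.of_primrec (Primrec.eq.comp ?_ ?_))))
  all_goals
    repeat' with_reducible first
      | exact Primrec.const _
      | exact primrec_id
      | refine Primrec.fst.comp ?_
      | refine Primrec.snd.comp ?_
      | refine Primrec.pair ?_ ?_
      | refine Primrec.list_cons.comp ?_ ?_
      | refine Primrec.list_append.comp ?_ ?_
      | refine Primrec.list_getElem?.comp ?_ ?_
      | refine Primrec.list_map ?_ ?_
      | refine primrec₂_mk ?_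
      | refine Primrec.option_some.comp ?_
      | refine primrec_lam.comp ?_ ?_
      | refine primrec_arr.comp ?_ ?_
      | refine primrec_apps.comp ?_ ?_
      | refine primrec_fill.comp ?_ ?_
      | refine primrec_arrs.comp ?_
      | refine primrec_var.comp ?_
      | refine primrec_const.comp ?_

theorem Sigma1.hereditaryCellular {t : α → Tm} {A : α → Ty} (ht : Primrec t) (hA : Primrec A) :
    Sigma1 fun x => HereditaryCellular [] (t x) (A x) := by
  have h : Sigma1 fun x => Derivable cellRule (([] : List Ty), (t x, A x)) :=
    sigma1_cellRule.derivable.comp ((Primrec.const _).pair (ht.pair hA))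
  exact h.of_eq fun x => hereditaryCellular_iff

end

section

variable {α : Type} [Primcodable α]

/-! ### Observational equivalence is decidable -/

theorem primrec_holeTy : Primrec₂ holeTy :=
  primrec_foldr_arr.comp ((Primrec.list_map Primrec.fst (Primrec.const Ty.o).to₂).pair Primrec.snd)

/-- The judgements `Cert C As V`. -/
abbrev CertJ : Type := Finset ℕ × (List Ty × List (List Tm))

/-- The parameters of the rule `Cert.cells`. -/
abbrev CertParam : Type :=
  (Finset ℕ × List (List Ty × List (List Tm))) × (List Tm × List (List Tm))

/-- The type `A` in the conclusion of the rule `Cert.cells`, as the list of its arguments. -/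
def CertParam.args (c : CertParam) : List Ty := c.1.2.map fun p => Ty.arrs p.1

/-- The side conditions of the rule `Cert.cells`. -/
def CertParam.Side (c : CertParam) : Prop :=
  (∀ r ∈ c.2.1, WT c.1.1 [] r (Ty.arrs c.args)) ∧
  (∀ a ∈ elems c.1.1, ∃ r ∈ c.2.1, ∀ us ∈ c.2.2, Halts (r.apps us) a) ∧
  ∀ i ∈ List.range c.1.2.length, ∀ ms ∈ (c.1.2.getD i ([], [])).2, ∃ r ∈ c.2.1, ∀ us ∈ c.2.2,
    SameValue (r.apps us) ((us.getD i (Tm.const 0)).apps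
      (ms.map fun m => m.apps (c.2.1.map fun r => r.apps us)))

/-- The rule for the empty vector. -/
def certNil : List CertJ → CertJ → Prop :=
  RuleSet (γ := Finset ℕ) (fun _ => []) (fun c => (c, ([], [[]]))) fun _ => True

/-- The rules for nonempty vectors. -/
def certCons : List CertJ → CertJ → Prop :=
  RuleSet (γ := (Finset ℕ × (Ty × List Ty)) × (List (List Tm) × List (List Tm)))
    (fun c => [(c.1.1, ([c.1.2.1], c.2.1)), (c.1.1, (c.1.2.2, c.2.2))])
    (fun c => (c.1.1, (c.1.2.1 :: c.1.2.2,
      c.2.1.flatMap fun us => c.2.2.map fun vs => us ++ vs))) fun _ => True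

/-- The rules for cells. -/
def certCells : List CertJ → CertJ → Prop :=
  RuleSet (γ := CertParam)
    (fun c => (c.1.1, (c.args, c.2.2)) ::
      c.1.2.map fun p => (c.1.1, (p.1.map fun B => holeTy c.2.1 B, p.2)))
    (fun c => (c.1.1, ([Ty.arrs c.args], c.2.1.map fun r => [r]))) CertParam.Side

/-- The rules for certificates. -/
def certRule (l : List CertJ) (b : CertJ) : Prop :=
  certNil l b ∨ certCons l b ∨ certCells l b

theorem cert_iff {C : Finset ℕ} {As : List Ty} {V : List (List Tm)} :
    Cert C As V ↔ Derivable certRule (C, (As, V)) := by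
  constructor
  · intro h
    induction h with
    | nil => exact .intro (.inl ⟨C, rfl, rfl, trivial⟩) (by simp)
    | @cons A As U V _ _ ih ih' =>
      refine .intro (.inr (.inl ⟨((C, (A, As)), (U, V)), rfl, rfl, trivial⟩)) fun c hc => ?_
      simp only [List.mem_cons, List.not_mem_nil, or_false] at hc
      obtain rfl | rfl := hc
      · exact ih
      · exact ih'
    | @cells ps L V _ _ h1 h2 h3 ihV ihM =>
      refine .intro (.inr (.inr ⟨((C, ps), (L, V)), rfl, rfl, h1, fun a ha => ?_,
        fun i hi => ?_⟩)) fun c hc => ?_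
      · exact h2 a (mem_elems.1 ha)
      · exact h3 i (List.mem_range.1 hi)
      · obtain rfl | hc := List.mem_cons.1 hc
        · exact ihV
        · obtain ⟨p, hp, rfl⟩ := List.mem_map.1 hc
          exact ihM p hp
  · suffices h : ∀ b, Derivable certRule b → Cert b.1 b.2.1 b.2.2 from h _
    intro b h
    induction h with
    | @intro l b hS _ ih =>
      rcases hS with ⟨c, rfl, rfl, -⟩ | ⟨c, rfl, rfl, -⟩ | ⟨c, rfl, rfl, h1, h2, h3⟩
      · exact .nil
      · exact .cons (ih _ List.mem_cons_self)
          (ih _ (List.mem_cons_of_mem _ (List.mem_singleton.2 rfl)))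
      · exact .cells (ih _ List.mem_cons_self)
          (fun p hp => ih _ (List.mem_cons_of_mem _ (List.mem_map.2 ⟨p, hp, rfl⟩))) h1
          (fun a ha => h2 a (mem_elems.2 ha)) fun i hi => h3 i (List.mem_range.2 hi)

theorem primrec_args : Primrec CertParam.args :=
  Primrec.list_map (Primrec.snd.comp Primrec.fst)
    (primrec_arrs.comp (Primrec.fst.comp Primrec.snd))

/-- Typing is decidable, evaluation is enumerable, and every universal quantifier ranges over a
list. -/
theorem sigma1_side : Sigma1 CertParam.Side := by
  refine .and (.forall_mem ?_ (.of_primrec (primrecPred_wt ?_ ?_ ?_ ?_)))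
    (.and (.forall_mem ?_ (.exists_mem ?_ (.forall_mem ?_ (.halts ?_ ?_))))
      (.forall_mem ?_ (.forall_mem ?_ (.exists_mem ?_ (.forall_mem ?_ (.sameValue ?_ ?_))))))
  all_goals
    repeat' with_reducible first
      | exact Primrec.const _
      | exact primrec_id
      | exact Primrec.snd
      | refine Primrec.fst.comp ?_
      | refine Primrec.snd.comp ?_
      | refine Primrec.list_range.comp ?_
      | refine Primrec.list_length.comp ?_
      | refine (Primrec.list_getD _).comp ?_ ?_
      | refine Primrec.list_map ?_ ?_
      | refine primrec₂_mk ?_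
      | refine primrec_apps.comp ?_ ?_
      | refine primrec_arrs.comp ?_
      | refine primrec_args.comp ?_
      | refine primrec_elems.comp ?_

theorem sigma1_certRule : Sigma1 fun x : List CertJ × CertJ => certRule x.1 x.2 := by
  refine .or (.ruleSet ?_ ?_ sigma1_true) (.or (.ruleSet ?_ ?_ sigma1_true)
    (.ruleSet ?_ ?_ sigma1_side))
  all_goals
    repeat' with_reducible first
      | exact Primrec.const _
      | exact primrec_id
      | refine Primrec.fst.comp ?_
      | refine Primrec.snd.comp ?_
      | refine Primrec.pair ?_ ?_
      | refine Primrec.list_cons.comp ?_ ?_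
      | refine Primrec.list_append.comp ?_ ?_
      | refine Primrec.list_map ?_ ?_
      | refine Primrec.list_flatMap ?_ ?_
      | refine primrec₂_mk ?_
      | refine primrec_arrs.comp ?_
      | refine primrec_args.comp ?_
      | refine primrec_holeTy.comp ?_ ?_

theorem Sigma1.cert {C : α → Finset ℕ} {As : α → List Ty} {V : α → List (List Tm)}
    (hC : Primrec C) (hA : Primrec As) (hV : Primrec V) :
    Sigma1 fun x => Cert (C x) (As x) (V x) :=
  (sigma1_certRule.derivable.comp (hC.pair (hA.pair hV))).of_eq fun _ => cert_iff

/-- Certificates exist for all argument types and each one is sound, so an arbitrary certificate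
found by search provides sufficient test vectors. -/
theorem obsEquiv_iff_exists_cert {C : Finset ℕ} {A : Ty} {t u : Tm} :
    ObsEquiv C A t u ↔ WT C [] t A ∧ WT C [] u A ∧ ∃ x : List Ty × List (List Tm),
      A = Ty.arrs x.1 ∧ Cert C x.1 x.2 ∧ ∀ us ∈ x.2, SameValue (t.apps us) (u.apps us) := by
  constructor
  · intro h
    obtain ⟨As, rfl⟩ := A.exists_eq_arrs
    obtain ⟨V, hV⟩ := exists_cert C As
    exact ⟨h.left, h.right, (As, V), rfl, hV, (hV.vecComplete.obsEquiv_iff.1 h).2.2⟩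
  · rintro ⟨ht, hu, ⟨As, V⟩, rfl, hV, h⟩
    exact hV.vecComplete.obsEquiv_iff.2 ⟨ht, hu, h⟩

/-- Two well-typed inequivalent terms are separated by a certified test vector on which they
evaluate to different constants; this makes inequivalence enumerable too. -/
theorem not_obsEquiv_iff {C : Finset ℕ} {A : Ty} {t u : Tm} :
    ¬ ObsEquiv C A t u ↔ (¬ WT C [] t A ∨ ¬ WT C [] u A) ∨ ∃ x : List Ty × List (List Tm),
      A = Ty.arrs x.1 ∧ Cert C x.1 x.2 ∧ ∃ us ∈ x.2, ∃ y : ℕ × ℕ,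
        Halts (t.apps us) y.1 ∧ Halts (u.apps us) y.2 ∧ y.1 ≠ y.2 := by
  constructor
  · intro h
    by_contra hn
    push Not at hn
    obtain ⟨⟨ht, hu⟩, hn⟩ := hn
    obtain ⟨As, rfl⟩ := A.exists_eq_arrs
    obtain ⟨V, hV⟩ := exists_cert C As
    refine h (hV.vecComplete.obsEquiv_iff.2 ⟨ht, hu, fun us hus => ?_⟩)
    rw [Ty.arrs_eq_foldr] at ht hu
    obtain ⟨a, -, ha⟩ := (ht.apps (hV.vecComplete.1 us hus)).exists_halts
    obtain ⟨b, -, hb⟩ := (hu.apps (hV.vecComplete.1 us hus)).exists_halts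
    obtain rfl : a = b := hn (As, V) rfl hV us hus (a, b) ha hb
    exact ⟨a, ha, hb⟩
  · rintro ((h | h) | ⟨⟨As, V⟩, rfl, hV, us, hus, ⟨a, b⟩, ha, hb, hab⟩) e
    · exact h e.left
    · exact h e.right
    · have := ((hV.vecComplete.obsEquiv_iff.1 e).2.2 us hus).betaEq
      exact hab (ha.betaEq.symm.trans (this.trans hb.betaEq)).const_inj

theorem Sigma1.obsEquiv {C : α → Finset ℕ} {A : α → Ty} {t u : α → Tm} (hC : Primrec C)
    (hA : Primrec A) (ht : Primrec t) (hu : Primrec u) :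
    Sigma1 fun x => ObsEquiv (C x) (A x) (t x) (u x) := by
  refine of_eq ?_ fun x => obsEquiv_iff_exists_cert
  refine .and (.of_primrec (primrecPred_wt hC (.const _) ht hA))
    (.and (.of_primrec (primrecPred_wt hC (.const _) hu hA)) (exists_code (.and (.of_primrec ?_)
      (.and (.cert (hC.comp .fst) (Primrec.fst.comp .snd) (Primrec.snd.comp .snd))
        (.forall_mem (Primrec.snd.comp .snd) (.sameValue ?_ ?_))))))
  · exact Primrec.eq.comp (hA.comp .fst) (primrec_arrs.comp (Primrec.fst.comp .snd))
  · exact primrec_apps.comp (ht.comp (Primrec.fst.comp .fst)) .snd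
  · exact primrec_apps.comp (hu.comp (Primrec.fst.comp .fst)) .snd

theorem Sigma1.not_obsEquiv {C : α → Finset ℕ} {A : α → Ty} {t u : α → Tm} (hC : Primrec C)
    (hA : Primrec A) (ht : Primrec t) (hu : Primrec u) :
    Sigma1 fun x => ¬ ObsEquiv (C x) (A x) (t x) (u x) := by
  refine of_eq ?_ fun x => not_obsEquiv_iff
  refine .or (.or (.of_primrec (primrecPred_wt hC (.const _) ht hA).not)
    (.of_primrec (primrecPred_wt hC (.const _) hu hA).not)) (exists_code (.and (.of_primrec ?_)
      (.and (.cert (hC.comp .fst) (Primrec.fst.comp .snd) (Primrec.snd.comp .snd))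
        (.exists_mem (Primrec.snd.comp .snd) (exists_code (.and (.halts ?_ (Primrec.fst.comp .snd))
          (.and (.halts ?_ (Primrec.snd.comp .snd)) (.of_primrec ?_))))))))
  · exact Primrec.eq.comp (hA.comp .fst) (primrec_arrs.comp (Primrec.fst.comp .snd))
  · exact primrec_apps.comp (ht.comp (Primrec.fst.comp (Primrec.fst.comp .fst)))
      (Primrec.snd.comp .fst)
  · exact primrec_apps.comp (hu.comp (Primrec.fst.comp (Primrec.fst.comp .fst)))
      (Primrec.snd.comp .fst)
  · exact (Primrec.eq.comp (Primrec.fst.comp .snd) (Primrec.snd.comp .snd)).not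

/-! ### Enumeration of representatives -/

/-- Hereditary cellular representatives of all classes, with a certificate of completeness. -/
def Represents (x : Ty × Finset ℕ) (L : List Tm) : Prop :=
  (∀ r ∈ L, WT x.2 [] r x.1 ∧ HereditaryCellular [] r x.1) ∧
  ∃ V, Cert x.2 [x.1] V ∧ ∀ us ∈ V, ∀ t ∈ us, ∃ r ∈ L, ObsEquiv x.2 x.1 t r

theorem sigma1_represents :
    Sigma1 fun x : (Ty × Finset ℕ) × List Tm => Represents x.1 x.2 := by
  refine .and (.forall_mem .snd (.and (.of_primrec (primrecPred_wt ?_ (.const _) .snd ?_))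
    (.hereditaryCellular .snd ?_))) (.exists_code (.and (.cert ?_ ?_ .snd)
      (.forall_mem .snd (.forall_mem .snd (.exists_mem ?_ (.obsEquiv ?_ ?_ ?_ .snd))))))
  all_goals
    repeat' with_reducible first
      | exact Primrec.const _
      | exact primrec_id
      | refine Primrec.fst.comp ?_
      | refine Primrec.snd.comp ?_
      | refine Primrec.list_cons.comp ?_ ?_

/-- The terms in a certificate need not be hereditary cellular, so they are replaced by equivalent
terms that are. -/
theorem exists_hereditaryCellular_list {C : Finset ℕ} {A : Ty} {l : List Tm}
    (h : ∀ t ∈ l, WT C [] t A) : ∃ L : List Tm,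
      (∀ r ∈ L, WT C [] r A ∧ HereditaryCellular [] r A) ∧ ∀ t ∈ l, ∃ r ∈ L, ObsEquiv C A t r := by
  induction l with
  | nil => exact ⟨[], by simp, by simp⟩
  | cons t l ih =>
    obtain ⟨L, h1, h2⟩ := ih fun u hu => h u (List.mem_cons_of_mem _ hu)
    obtain ⟨r, hr, e⟩ := (h t List.mem_cons_self).exists_hCell
    refine ⟨r :: L, List.forall_mem_cons.2 ⟨⟨e.right, hr.hereditaryCellular⟩, h1⟩,
      List.forall_mem_cons.2 ⟨⟨r, List.mem_cons_self, e⟩, fun u hu => ?_⟩⟩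
    obtain ⟨s, hs, e'⟩ := h2 u hu
    exact ⟨s, List.mem_cons_of_mem _ hs, e'⟩

theorem exists_represents (x : Ty × Finset ℕ) : ∃ L, Represents x L := by
  obtain ⟨V, hV⟩ := exists_cert x.2 [x.1]
  have hW : ∀ t ∈ V.flatten, WT x.2 [] t x.1 := by
    intro t ht
    obtain ⟨us, hus, ht⟩ := List.mem_flatten.1 ht
    cases hV.vecComplete.1 us hus with
    | cons hu h =>
      cases h
      rwa [List.mem_singleton.1 ht]
  obtain ⟨L, h1, h2⟩ := exists_hereditaryCellular_list hW
  exact ⟨L, h1, V, hV, fun us hus t ht => h2 t (List.mem_flatten.2 ⟨us, hus, ht⟩)⟩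

theorem Represents.exists_obsEquiv {x : Ty × Finset ℕ} {L : List Tm} (h : Represents x L)
    {t : Tm} (ht : WT x.2 [] t x.1) : ∃ r ∈ L, ObsEquiv x.2 x.1 t r := by
  obtain ⟨-, V, hV, hL⟩ := h
  obtain ⟨us, hus, e⟩ := hV.vecComplete.2 [t] (.cons ht .nil)
  cases e with
  | cons e _ =>
    obtain ⟨r, hr, e'⟩ := hL _ hus _ List.mem_cons_self
    exact ⟨r, hr, e.trans e'⟩

end
end STLC

theorem mainTheorem2 :
    (∃ R : STLC.Ty → Finset ℕ → List STLC.Tm,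
      Computable₂ R ∧
      ∀ (A : STLC.Ty) (C : Finset ℕ),
        (∀ r ∈ R A C, STLC.IsClosedTerm C r A ∧ STLC.HereditaryCellular [] r A) ∧
        (∀ t : STLC.Tm, STLC.IsClosedTerm C t A → ∃ r ∈ R A C, STLC.ObsEquiv C A t r)) ∧
    ComputablePred (fun q : (STLC.Ty × Finset ℕ) × (STLC.Tm × STLC.Tm) =>
      STLC.ObsEquiv q.1.2 q.1.1 q.2.1 q.2.2) := by
  constructor
  -- `R` searches for a list together with the evidence that it represents all classes.
  · obtain ⟨R, hR, h⟩ := STLC.sigma1_represents.exists_computable STLC.exists_represents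
    exact ⟨fun A C => R (A, C), hR, fun A C =>
      ⟨(h (A, C)).1, fun t ht => (h (A, C)).exists_obsEquiv ht⟩⟩
  · have h1 := Primrec.fst (α := STLC.Ty × Finset ℕ) (β := STLC.Tm × STLC.Tm)
    have h2 := Primrec.snd (α := STLC.Ty × Finset ℕ) (β := STLC.Tm × STLC.Tm)
    -- Post's theorem, equivalence and inequivalence both being enumerable.
    exact STLC.Sigma1.computablePred
      (.obsEquiv (Primrec.snd.comp h1) (Primrec.fst.comp h1) (Primrec.fst.comp h2)
        (Primrec.snd.comp h2))
      (.not_obsEquiv (Primrec.snd.comp h1) (Primrec.fst.comp h1) (Primrec.fst.comp h2)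
        (Primrec.snd.comp h2))
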